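/- Graphs are finite and undirected; loops and multiple edges are allowed. For $d:[n]\to\mathbb N$, let $\mathbb G_d$ be the configuration model: each vertex $i$ carries $d(i)$ half-edges, the half-edges are paired by a uniformly random complete matching (if $\sum_i d(i)$ is odd, a uniformly random matching that leaves exactly one half-edge unpaired), and each pair gives an edge between the corresponding vertices. For a graph $G$ whose edges carry labels $\omega(e)\in\{+1,-1\}$, let $$MB(G(\omega))=\max\Big\{\sum_{e\text{ between }V_1\text{ and }V_2}\omega(e)\;:\;V_1,V_2\text{ partition }V(G),\ \big||V_1|-|V_2|\big|\le 1\Big\},$$ and for $p\in[0,1]$ let $HB_p(G)=\mathbb E[MB(G(\omega))]$, where the edges are labelled independently, $+1$ with probability $p$ and $-1$ with probability $1-p$. Theorem. Fix $p\in[\tfrac12,1]$, let $\mu$ be a probability measure on $\mathbb N$ with finite mean $\overline\mu$, and let $d_n:[n]\to\mathbb N$ $(n\ge1)$ converge in distribution to $\mu$, that is, $\frac1n\sum_{i\in[n]}\mathbf 1_{d_n(i)=k}\to\mu(k)$ for every $k\in\mathbb N$ and $\frac1n\sum_{i\in[n]}d_n(i)\to\overline\mu$. Then there is a constant $L\in\mathbb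 R$ such that, if the random graphs $\mathbb G_{d_n}$ are sampled independently, $$\frac1n HB_p(\mathbb G_{d_n})\to L\quad\text{almost surely as }n\to\infty,$$ and moreover $$\lim_{n\to\infty}\frac1n\,\mathbb E\big[HB_p(\mathbb G_{d_n})\big]=L.$$ -/

import Mathlib

open Filter Topology MeasureTheory ProbabilityTheory

open scoped Graph

namespace HybridBisection

section Bisections

variable {α β : Type*}

/-- `V₁, V₂` is a bisection of `G`: a partition of the vertex set into two (possibly empty) parts
whose sizes differ by at most one. Used for graphs with finitely many vertices. -/
structure IsBisection (G : Graph α β) (V₁ V₂ : Set α) : Prop where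
  union_eq : V₁ ∪ V₂ = V(G)
  disjoint : Disjoint V₁ V₂
  balanced : |(V₁.ncard : ℤ) - (V₂.ncard : ℤ)| ≤ 1

/-- The edges of `G` between `V₁` and `V₂`. -/
def crossingEdges (G : Graph α β) (V₁ V₂ : Set α) : Set E(G) :=
  {e | ∃ x ∈ V₁, ∃ y ∈ V₂, G.IsLink e x y}

/-- The value of the cut `(V₁, V₂)` in the graph `G` with `±1` edge labels `s`: the sum of the
labels of the edges between `V₁` and `V₂`. -/
noncomputable def cutValue (G : Graph α β) (s : E(G) → ℤˣ) (V₁ V₂ : Set α) : ℤ :=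
  ∑ᶠ e ∈ crossingEdges G V₁ V₂, (s e : ℤ)

/-- The maximum bisection `MB(G(s))` of the graph `G` with `±1` edge labels `s`. For a finite graph
the set below is finite and non-empty, so that the supremum is a maximum. -/
noncomputable def maxBisection (G : Graph α β) (s : E(G) → ℤˣ) : ℤ :=
  sSup {w | ∃ V₁ V₂ : Set α, IsBisection G V₁ V₂ ∧ w = cutValue G s V₁ V₂}

/-- The probability of the edge label `u`: `+1` has probability `p`, and `-1` has probability
`1 - p`. -/
noncomputable def labelProb (p : ℝ) (u : ℤˣ) : ℝ := if u = 1 then p else 1 - p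

/-- The `p`-hybrid bisection `HB_p(G)` of a finite graph: the expectation of the maximum bisection
when the edges are labelled independently, `+1` with probability `p` and `-1` with probability
`1 - p`. -/
noncomputable def hybridBisection (p : ℝ) (G : Graph α β) [Finite V(G)] [Finite E(G)] : ℝ :=
  ∑ᶠ s : E(G) → ℤˣ, (∏ᶠ e, labelProb p (s e)) * (maxBisection G s : ℝ)

end Bisections

section ConfigurationModel

variable {V : Type*}

/-- The multiset in which each vertex `v` appears `d v` times, as a type: the half-edges. -/
abbrev HalfEdge (d : V → ℕ) : Type _ := Σ v : V, Fin (d v)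

/-- A (possibly partial) matching of a type `H`: a finite set of unordered pairs of distinct
elements, no two of which share an element. -/
structure IsMatching {H : Type*} (m : Finset (Sym2 H)) : Prop where
  not_isDiag : ∀ e ∈ m, ¬ e.IsDiag
  eq_of_mem : ∀ e ∈ m, ∀ f ∈ m, ∀ x, x ∈ e → x ∈ f → e = f

/-- The complete matchings of the half-edges: if the number `N` of half-edges is even, all of them
are paired; if it is odd, exactly one is left over. Both cases say that there are `⌊N / 2⌋`
pairs. -/
def CompleteMatching [Fintype V] (d : V → ℕ) : Type _ :=
  {m : Finset (Sym2 (HalfEdge d)) // IsMatching m ∧ m.card = Fintype.card (HalfEdge d) / 2}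

lemma exists_isMatching_card (H : Type*) [Fintype H] :
    ∃ m : Finset (Sym2 H), IsMatching m ∧ m.card = Fintype.card H / 2 := by
  classical
  let e := (Fintype.equivFin H).symm
  let f : Fin (Fintype.card H / 2) → Sym2 H := fun k =>
    s(e ⟨2 * k, by omega⟩, e ⟨2 * k + 1, by omega⟩)
  have key : ∀ k l x, x ∈ f k → x ∈ f l → k = l := by
    intro k l x hk hl
    simp only [f, Sym2.mem_iff] at hk hl
    rcases hk with rfl | rfl <;> rcases hl with h | h <;>
      simp only [EmbeddingLike.apply_eq_iff_eq, Fin.mk.injEq] at h <;> ext <;> omega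
  have hf : Function.Injective f := by
    intro k l h
    exact key k l (e ⟨2 * k, by omega⟩) (by simp [f]) (by rw [← h]; simp [f])
  refine ⟨Finset.univ.image f, ⟨?_, ?_⟩, ?_⟩
  · intro a ha
    obtain ⟨k, -, rfl⟩ := Finset.mem_image.1 ha
    simp [f]
  · intro a ha b hb x hxa hxb
    obtain ⟨k, -, rfl⟩ := Finset.mem_image.1 ha
    obtain ⟨l, -, rfl⟩ := Finset.mem_image.1 hb
    rw [key k l x hxa hxb]
  · rw [Finset.card_image_of_injective _ hf]
    simp

instance [Fintype V] (d : V → ℕ) : Nonempty (CompleteMatching d) :=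
  let ⟨m, hm⟩ := exists_isMatching_card (HalfEdge d)
  ⟨⟨m, hm⟩⟩

instance [Fintype V] (d : V → ℕ) : Finite (CompleteMatching d) :=
  Subtype.finite

noncomputable instance [Fintype V] (d : V → ℕ) : Fintype (CompleteMatching d) :=
  Fintype.ofFinite _

/-- The graph `G[m]` induced by a set `m` of pairs of half-edges: its vertex set is all of `V`, and
it has one edge for every pair in `m`, between the two vertices (possibly equal) to which the
half-edges of the pair belong. -/
def graphOfMatching {d : V → ℕ} (m : Finset (Sym2 (HalfEdge d))) :
    Graph V (Sym2 (HalfEdge d)) where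
  vertexSet := Set.univ
  IsLink e v w := e ∈ m ∧ e.map Sigma.fst = s(v, w)
  isLink_symm _ _ := ⟨fun _ _ h => ⟨h.1, h.2.trans Sym2.eq_swap⟩⟩
  eq_or_eq_of_isLink_of_isLink e x y v w h h' := by
    rcases Sym2.eq_iff.1 (h.2.symm.trans h'.2) with h'' | h''
    · exact Or.inl h''.1
    · exact Or.inr h''.1
  left_mem_of_isLink _ _ _ _ := Set.mem_univ _

/-- The distribution `𝔾_d` of `G[m]`, for `m` a uniformly random complete matching. -/
noncomputable def configurationModel [Fintype V] (d : V → ℕ) :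
    PMF (Graph V (Sym2 (HalfEdge d))) :=
  (PMF.uniformOfFintype (CompleteMatching d)).map fun m => graphOfMatching m.1

/-- All sets of graphs (on given finite types of vertices and of potential edges) are events. -/
instance (d : V → ℕ) : MeasurableSpace (Graph V (Sym2 (HalfEdge d))) := ⊤

end ConfigurationModel

/-- The degree functions `d n`, on `n` vertices, converge in distribution to the probability
measure `μ` on `ℕ`, whose mean is supposed to be finite: the proportion of vertices of degree `k`
converges to `μ k` for every `k`, and the average degree converges to the mean of `μ`. -/
structure ConvergesInDistribution (d : (n : ℕ) → Fin n → ℕ) (μ : PMF ℕ) : Prop where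
  tendsto_freq : ∀ k : ℕ,
    Tendsto (fun n : ℕ => (1 / (n : ℝ)) * ∑ i : Fin n, if d n i = k then (1 : ℝ) else 0) atTop
      (𝓝 (μ k).toReal)
  tendsto_mean :
    Tendsto (fun n : ℕ => (1 / (n : ℝ)) * ∑ i : Fin n, (d n i : ℝ)) atTop
      (𝓝 (∑' k : ℕ, (k : ℝ) * (μ k).toReal))

end HybridBisection

namespace HybridBisection

open scoped Classical

/-! The expected hybrid bisection is superadditive under disjoint union up to an error of lower
order, which forces its normalisation to converge; concentration turns this into almost sure
convergence.

The engine is a kernel identity. An extra edge xy with label +1 raises the maximum by 1 unless every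
optimal bisection keeps x and y together; with label -1 it lowers the maximum by 1 exactly when
every optimal bisection separates them. So the expected gain is p minus an average of p·[always
together] + (1-p)·[always separated], which equals (2p-1)·[always together] + (1-p)·[always together
or always separated]. Both brackets are equivalence relations, so for p ≥ 1/2 the subtracted
function is a positive semidefinite kernel (`edgeConcave_hybridCut`).

Testing this kernel against the difference of the uniform distributions on the free half-edges of
two sets A and B shows that a random pair across gains at least the average of a random pair inside
A and one inside B, up to diagonal terms (`SideInvariant.insert_add_insert_le`). Replacing crossing
pairs one by one compares a complete matching of A ⊕ B with separate matchings of A and B. Leaving m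
pairs out keeps the diagonal terms small (`SideInvariant.pairSum_sub_le`), and m of order N^(2/3)
gives an error O(N^(2/3)) for N half-edges (`degreeCut_add_le`).

Repeated halving bounds the value for k copies of a degree function from below with an error linear
in k (`degreeCut_copies_ge`). The value is Lipschitz in the degree counts (`abs_degreeCut_sub_le`),
so N vertices can be compared with about N/n copies of the n-vertex instance (`degreeCut_ge`). Hence
each normalised value is, up to a vanishing error, a lower bound for the liminf, and the limit
exists.

A uniformly random complete matching is the image of a fixed one under a uniformly random
permutation, and a transposition changes the value by at most 4. An exponential moment bound on the
symmetric group (`sum_exp_perm_fin_le`) then gives exponentially small tails, and Borel–Cantelli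
finishes. -/

/-- Equality of unordered pairs is decided classically, so that sets of pairs over different types
are compared in the same way. -/
noncomputable instance instDecidableEqSym2Classical (α : Type*) : DecidableEq (Sym2 α) :=
  Classical.decEq _

/-! ### Effect of one extra edge on the maximum bisection -/

section Cuts

variable {H V : Type*}

/-- The vertex sets that form a bisection together with their complements. -/
noncomputable def balancedSets (V : Type*) [Fintype V] : Finset (Finset V) :=
  Finset.univ.filter fun S => |(S.card : ℤ) - (Sᶜ.card : ℤ)| ≤ 1

lemma mem_balancedSets [Fintype V] {S : Finset V} :
    S ∈ balancedSets V ↔ |(S.card : ℤ) - (Sᶜ.card : ℤ)| ≤ 1 := by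
  simp [balancedSets]

lemma mem_balancedSets_iff_card [Fintype V] {S : Finset V} :
    S ∈ balancedSets V ↔ |2 * (S.card : ℤ) - Fintype.card V| ≤ 1 := by
  have := Finset.card_le_univ S
  rw [mem_balancedSets, Finset.card_compl, Nat.cast_sub this, ← sub_add, two_mul, add_sub_right_comm]

lemma balancedSets_nonempty [Fintype V] : (balancedSets V).Nonempty := by
  obtain ⟨S, -, hS⟩ := Finset.exists_subset_card_eq (s := (Finset.univ : Finset V))
    (n := Fintype.card V / 2) (by rw [Finset.card_univ]; omega)
  refine ⟨S, mem_balancedSets.2 ?_⟩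
  have := Finset.card_compl S
  rw [abs_le]
  omega

/-- The pair `e` of half-edges joins `S` to its complement, where `v` maps a half-edge to its
vertex. -/
def Crosses (v : H → V) (S : Finset V) (e : Sym2 H) : Prop :=
  ∃ x y, e = s(x, y) ∧ v x ∈ S ∧ v y ∉ S

lemma crosses_mk {v : H → V} {S : Finset V} {x y : H} :
    Crosses v S s(x, y) ↔ ¬ (v x ∈ S ↔ v y ∈ S) := by
  constructor
  · rintro ⟨a, b, h, ha, hb⟩
    rcases Sym2.eq_iff.1 h with ⟨rfl, rfl⟩ | ⟨rfl, rfl⟩ <;> tauto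
  · intro h
    by_cases hx : v x ∈ S
    · exact ⟨x, y, rfl, hx, by tauto⟩
    · exact ⟨y, x, Sym2.eq_swap, by tauto, hx⟩

/-- The value of the cut `S` when the edges in `P` have label `1` and those in `N` have
label `-1`. -/
noncomputable def signedCut (v : H → V) (P N : Finset (Sym2 H)) (S : Finset V) : ℤ :=
  ((P.filter (Crosses v S)).card : ℤ) - (N.filter (Crosses v S)).card

lemma signedCut_insert_left (v : H → V) {P N : Finset (Sym2 H)} {e : Sym2 H} (he : e ∉ P)
    (S : Finset V) :
    signedCut v (insert e P) N S = signedCut v P N S + if Crosses v S e then 1 else 0 := by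
  unfold signedCut
  rw [Finset.filter_insert]
  split_ifs with h
  · rw [Finset.card_insert_of_notMem (by simp [he])]
    push_cast; ring
  · simp

lemma signedCut_insert_right (v : H → V) {P N : Finset (Sym2 H)} {e : Sym2 H} (he : e ∉ N)
    (S : Finset V) :
    signedCut v P (insert e N) S = signedCut v P N S - if Crosses v S e then 1 else 0 := by
  unfold signedCut
  rw [Finset.filter_insert]
  split_ifs with h
  · rw [Finset.card_insert_of_notMem (by simp [he])]
    push_cast; ring
  · simp

/-- The probability that exactly the edges in `P` get label `1`. -/
noncomputable def labelWeight (p : ℝ) (M P : Finset (Sym2 H)) : ℝ :=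
  p ^ P.card * (1 - p) ^ (M \ P).card

lemma labelWeight_nonneg {p : ℝ} (hp : 0 ≤ p) (hp' : p ≤ 1) (M P : Finset (Sym2 H)) :
    0 ≤ labelWeight p M P :=
  mul_nonneg (pow_nonneg hp _) (pow_nonneg (sub_nonneg.2 hp') _)

lemma sum_labelWeight (p : ℝ) (M : Finset (Sym2 H)) :
    ∑ P ∈ M.powerset, labelWeight p M P = 1 := by
  have := Finset.sum_pow_mul_eq_add_pow p (1 - p) M
  rw [add_sub_cancel, one_pow] at this
  rw [← this]
  refine Finset.sum_congr rfl fun P hP => ?_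
  rw [labelWeight, Finset.card_sdiff_of_subset (Finset.mem_powerset.1 hP)]

lemma labelWeight_insert_left (p : ℝ) {M P : Finset (Sym2 H)} {e : Sym2 H} (he : e ∉ M)
    (hP : P ⊆ M) : labelWeight p (insert e M) (insert e P) = p * labelWeight p M P := by
  rw [labelWeight, labelWeight, Finset.card_insert_of_notMem fun h => he (hP h),
    Finset.insert_sdiff_insert, Finset.sdiff_insert_of_notMem he]
  ring

lemma labelWeight_insert_right (p : ℝ) {M P : Finset (Sym2 H)} {e : Sym2 H} (he : e ∉ M)
    (hP : P ⊆ M) : labelWeight p (insert e M) P = (1 - p) * labelWeight p M P := by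
  rw [labelWeight, labelWeight, Finset.insert_sdiff_of_notMem _ fun h => he (hP h),
    Finset.card_insert_of_notMem (by simp [he])]
  ring

variable [Fintype V]

/-- The maximum bisection when the edges in `P` have label `1` and those in `N` have
label `-1`. -/
noncomputable def maxSignedCut (v : H → V) (P N : Finset (Sym2 H)) : ℤ :=
  (balancedSets V).sup' balancedSets_nonempty (signedCut v P N)

/-- The bisections that attain the maximum. -/
noncomputable def optimalSets (v : H → V) (P N : Finset (Sym2 H)) : Finset (Finset V) :=
  (balancedSets V).filter fun S => signedCut v P N S = maxSignedCut v P N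

lemma signedCut_le (v : H → V) (P N : Finset (Sym2 H)) {S : Finset V} (hS : S ∈ balancedSets V) :
    signedCut v P N S ≤ maxSignedCut v P N :=
  Finset.le_sup' (signedCut v P N) hS

lemma optimalSets_nonempty (v : H → V) (P N : Finset (Sym2 H)) :
    (optimalSets v P N).Nonempty := by
  obtain ⟨S, hS, h⟩ := Finset.exists_mem_eq_sup' balancedSets_nonempty (signedCut v P N)
  exact ⟨S, Finset.mem_filter.2 ⟨hS, h.symm⟩⟩

lemma maxSignedCut_le (v : H → V) (P N : Finset (Sym2 H)) {c : ℤ}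
    (h : ∀ S ∈ balancedSets V, signedCut v P N S ≤ c) : maxSignedCut v P N ≤ c :=
  Finset.sup'_le _ _ h

/-- Cut values are integers, so a bisection that is not optimal is behind by a full unit, which a
single new edge can at most make up. This is why only `optimalSets` matters when an edge is added.
-/
lemma signedCut_add_one_le (v : H → V) (P N : Finset (Sym2 H)) {S : Finset V}
    (hS : S ∈ balancedSets V) (hS' : S ∉ optimalSets v P N) :
    signedCut v P N S + 1 ≤ maxSignedCut v P N := by
  have h1 := signedCut_le v P N hS
  have h2 : signedCut v P N S ≠ maxSignedCut v P N := fun h =>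
    hS' (Finset.mem_filter.2 ⟨hS, h⟩)
  omega

lemma maxSignedCut_insert_left (v : H → V) {P N : Finset (Sym2 H)} {e : Sym2 H} (he : e ∉ P) :
    maxSignedCut v (insert e P) N =
      maxSignedCut v P N + 1 - if ∀ S ∈ optimalSets v P N, ¬ Crosses v S e then 1 else 0 := by
  apply le_antisymm
  · refine maxSignedCut_le _ _ _ fun S hS => ?_
    rw [signedCut_insert_left v he]
    have h0 := signedCut_le v P N hS
    by_cases hopt : S ∈ optimalSets v P N
    · split_ifs with h1 h2 h2
      · exact absurd h1 (h2 S hopt)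
      all_goals omega
    · have := signedCut_add_one_le v P N hS hopt
      split_ifs <;> omega
  · split_ifs with h
    · obtain ⟨S, hS⟩ := optimalSets_nonempty v P N
      have := signedCut_le v (insert e P) N (Finset.mem_filter.1 hS).1
      rw [signedCut_insert_left v he, (Finset.mem_filter.1 hS).2, if_neg (h S hS)] at this
      omega
    · push Not at h
      obtain ⟨S, hS, hc⟩ := h
      have := signedCut_le v (insert e P) N (Finset.mem_filter.1 hS).1
      rw [signedCut_insert_left v he, (Finset.mem_filter.1 hS).2, if_pos hc] at this
      omega

lemma maxSignedCut_insert_right (v : H → V) {P N : Finset (Sym2 H)} {e : Sym2 H} (he : e ∉ N) :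
    maxSignedCut v P (insert e N) =
      maxSignedCut v P N - if ∀ S ∈ optimalSets v P N, Crosses v S e then 1 else 0 := by
  apply le_antisymm
  · refine maxSignedCut_le _ _ _ fun S hS => ?_
    rw [signedCut_insert_right v he]
    have h0 := signedCut_le v P N hS
    by_cases hopt : S ∈ optimalSets v P N
    · split_ifs with h1 h2 h2
      · omega
      · omega
      · exact absurd (h2 S hopt) h1
      · omega
    · have := signedCut_add_one_le v P N hS hopt
      split_ifs <;> omega
  · split_ifs with h
    · obtain ⟨S, hS⟩ := optimalSets_nonempty v P N
      have := signedCut_le v P (insert e N) (Finset.mem_filter.1 hS).1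
      rw [signedCut_insert_right v he, (Finset.mem_filter.1 hS).2, if_pos (h S hS)] at this
      omega
    · push Not at h
      obtain ⟨S, hS, hc⟩ := h
      have := signedCut_le v P (insert e N) (Finset.mem_filter.1 hS).1
      rw [signedCut_insert_right v he, (Finset.mem_filter.1 hS).2, if_neg hc] at this
      omega

/-- The hybrid bisection of the graph with one edge for every pair of half-edges in `M`. -/
noncomputable def hybridCut (p : ℝ) (v : H → V) (M : Finset (Sym2 H)) : ℝ :=
  ∑ P ∈ M.powerset, labelWeight p M P * (maxSignedCut v P (M \ P) : ℝ)

/-- Condition on the labels of the old edges: `P` is the set of positive ones, and the label of `e`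
contributes the two one-edge increments with weights `p` and `1 - p`. -/
lemma hybridCut_insert (p : ℝ) (v : H → V) {M : Finset (Sym2 H)} {e : Sym2 H} (he : e ∉ M) :
    hybridCut p v (insert e M) = hybridCut p v M + p -
      ∑ P ∈ M.powerset, labelWeight p M P *
        (p * (if ∀ S ∈ optimalSets v P (M \ P), ¬ Crosses v S e then 1 else 0) +
          (1 - p) * (if ∀ S ∈ optimalSets v P (M \ P), Crosses v S e then 1 else 0)) := by
  have hp : p = ∑ P ∈ M.powerset, labelWeight p M P * p := by
    rw [← Finset.sum_mul, sum_labelWeight, one_mul]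
  unfold hybridCut
  rw [Finset.sum_powerset_insert he]
  conv_rhs => rw [add_sub_assoc]; enter [2, 1]; rw [hp]
  rw [← Finset.sum_sub_distrib, ← Finset.sum_add_distrib, ← Finset.sum_add_distrib]
  refine Finset.sum_congr rfl fun P hP => ?_
  have hPM := Finset.mem_powerset.1 hP
  have heP : e ∉ P := fun h => he (hPM h)
  rw [labelWeight_insert_left p he hPM, labelWeight_insert_right p he hPM,
    Finset.insert_sdiff_of_notMem _ heP, Finset.insert_sdiff_insert,
    Finset.sdiff_insert_of_notMem he,
    maxSignedCut_insert_right v (by simp [he]), maxSignedCut_insert_left v heP]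
  push_cast
  ring

end Cuts

/-! ### Positive semidefinite kernels and edge gains -/

section Kernels

variable {H : Type*} [Fintype H]

/-- Positive semidefinite kernels on a finite type. -/
def PosSemidefKernel (Q : H → H → ℝ) : Prop :=
  ∀ c : H → ℝ, 0 ≤ ∑ x, ∑ y, c x * c y * Q x y

/-- The quadratic form is the sum, over the equivalence classes, of the squared sums of `c` on the
class. -/
lemma posSemidefKernel_setoid (r : Setoid H) :
    PosSemidefKernel fun x y => if r x y then (1 : ℝ) else 0 := by
  intro c
  have : ∑ x, ∑ y, c x * c y * (if r x y then (1 : ℝ) else 0) =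
      ∑ q : Quotient r, (∑ x, if Quotient.mk r x = q then c x else 0) ^ 2 := by
    simp_rw [pow_two, Finset.sum_mul_sum]
    conv_rhs => rw [Finset.sum_comm]; enter [2, x]; rw [Finset.sum_comm]
    refine Finset.sum_congr rfl fun x _ => Finset.sum_congr rfl fun y _ => ?_
    by_cases h : r x y
    · have h' : Quotient.mk r x = Quotient.mk r y := Quotient.sound h
      simp [h, h', ← ite_and]
    · have h' : ¬ Quotient.mk r x = Quotient.mk r y := fun h' => h (Quotient.exact h')
      simp [h]
      exact fun h'' => absurd h'' h'
  rw [this]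
  exact Finset.sum_nonneg fun q _ => sq_nonneg _

lemma PosSemidefKernel.sum {ι : Type*} (s : Finset ι) (w : ι → ℝ) (Q : ι → H → H → ℝ)
    (hw : ∀ i ∈ s, 0 ≤ w i) (hQ : ∀ i ∈ s, PosSemidefKernel (Q i)) :
    PosSemidefKernel fun x y => ∑ i ∈ s, w i * Q i x y := by
  intro c
  have : ∑ x, ∑ y, c x * c y * ∑ i ∈ s, w i * Q i x y =
      ∑ i ∈ s, w i * ∑ x, ∑ y, c x * c y * Q i x y := by
    simp_rw [Finset.mul_sum]
    conv_lhs => enter [2, x]; rw [Finset.sum_comm]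
    rw [Finset.sum_comm]
    refine Finset.sum_congr rfl fun i _ => Finset.sum_congr rfl fun x _ =>
      Finset.sum_congr rfl fun y _ => by ring
  rw [this]
  exact Finset.sum_nonneg fun i hi => mul_nonneg (hw i hi) (hQ i hi c)

lemma PosSemidefKernel.comp_equiv {Q : H → H → ℝ} (hQ : PosSemidefKernel Q) (g : Equiv.Perm H) :
    PosSemidefKernel fun x y => Q (g x) (g y) := by
  intro c
  have := hQ fun x => c (g.symm x)
  rw [← Equiv.sum_comp g] at this
  conv at this => enter [2, 2, x]; rw [← Equiv.sum_comp g]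
  simpa using this

/-- A function of graphs on a set of half-edges for which the gain from adding an edge is, up to
a constant in `[0, 1]`, minus a positive semidefinite kernel with values in `[0, 1]`. -/
def EdgeConcave (f : Finset (Sym2 H) → ℝ) : Prop :=
  ∀ M, ∃ (k : ℝ) (Q : H → H → ℝ), 0 ≤ k ∧ k ≤ 1 ∧ PosSemidefKernel Q ∧
    (∀ x y, 0 ≤ Q x y ∧ Q x y ≤ 1) ∧
    ∀ x y, x ≠ y → s(x, y) ∉ M → f (insert s(x, y) M) = f M + k - Q x y

/-- Half-edges whose vertices lie on the same side of every cut in `O`. -/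
def sameSide {V : Type*} (v : H → V) (O : Finset (Finset V)) : Setoid H where
  r x y := ∀ S ∈ O, (v x ∈ S ↔ v y ∈ S)
  iseqv := ⟨fun _ _ _ => Iff.rfl, fun h S hS => (h S hS).symm,
    fun h h' S hS => (h S hS).trans (h' S hS)⟩

/-- Half-edges whose vertices lie on the same side of every cut in `O`, or on opposite sides of
every cut in `O`. -/
def alignedSide {V : Type*} (v : H → V) (O : Finset (Finset V)) : Setoid H where
  r x y := (∀ S ∈ O, (v x ∈ S ↔ v y ∈ S)) ∨ ∀ S ∈ O, ¬ (v x ∈ S ↔ v y ∈ S)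
  iseqv := by
    refine ⟨fun _ => Or.inl fun _ _ => Iff.rfl, ?_, ?_⟩
    · rintro x y (h | h)
      · exact Or.inl fun S hS => (h S hS).symm
      · exact Or.inr fun S hS => by have := h S hS; tauto
    · rintro x y z (h | h) (h' | h')
      · exact Or.inl fun S hS => (h S hS).trans (h' S hS)
      · exact Or.inr fun S hS => by have := h S hS; have := h' S hS; tauto
      · exact Or.inr fun S hS => by have := h S hS; have := h' S hS; tauto
      · exact Or.inl fun S hS => by have := h S hS; have := h' S hS; tauto

/-- The loss `p`·[same] + `(1 - p)`·[opposite] is rewritten with the nonnegative coefficients `2 * p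
- 1` and `1 - p` on two equivalence relations. "Opposite" alone is not an equivalence relation, but
"same or opposite" is, and the rewriting is where `1 / 2 ≤ p` enters. -/
lemma edgeConcave_hybridCut {V : Type*} [Fintype V] {p : ℝ} (hp : 1 / 2 ≤ p) (hp' : p ≤ 1)
    (v : H → V) : EdgeConcave (hybridCut p v) := by
  intro M
  let w : Finset (Sym2 H) → ℝ := labelWeight p M
  have hw : ∀ P, 0 ≤ w P := fun P => labelWeight_nonneg (by linarith) hp' M P
  let Q₁ : Finset (Sym2 H) → H → H → ℝ := fun P x y =>
    if sameSide v (optimalSets v P (M \ P)) x y then (1 : ℝ) else 0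
  let Q₂ : Finset (Sym2 H) → H → H → ℝ := fun P x y =>
    if alignedSide v (optimalSets v P (M \ P)) x y then (1 : ℝ) else 0
  let Q : Finset (Sym2 H) → H → H → ℝ := fun P x y => (2 * p - 1) * Q₁ P x y + (1 - p) * Q₂ P x y
  have hQ₁ : ∀ P x y, 0 ≤ Q₁ P x y ∧ Q₁ P x y ≤ 1 := by
    intro P x y; simp only [Q₁]; split_ifs <;> norm_num
  have hQ₂ : ∀ P x y, 0 ≤ Q₂ P x y ∧ Q₂ P x y ≤ 1 := by
    intro P x y; simp only [Q₂]; split_ifs <;> norm_num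
  have hQ : ∀ P x y, 0 ≤ Q P x y ∧ Q P x y ≤ 1 := by
    intro P x y
    have h1 := hQ₁ P x y
    have h2 := hQ₂ P x y
    simp only [Q]
    constructor <;> nlinarith
  refine ⟨p, fun x y => ∑ P ∈ M.powerset, w P * Q P x y, by linarith, hp', ?_, ?_, ?_⟩
  · refine PosSemidefKernel.sum _ _ _ (fun P _ => hw P) fun P _ => ?_
    have := PosSemidefKernel.sum (Finset.univ : Finset Bool)
      (fun b => cond b (2 * p - 1) (1 - p)) (fun b => cond b (Q₁ P) (Q₂ P))
      (by simp; constructor <;> linarith)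
      (by simp; exact ⟨posSemidefKernel_setoid _, posSemidefKernel_setoid _⟩)
    simpa using this
  · intro x y
    refine ⟨Finset.sum_nonneg fun P _ => mul_nonneg (hw P) (hQ P x y).1, ?_⟩
    rw [← sum_labelWeight p M]
    exact Finset.sum_le_sum fun P _ => mul_le_of_le_one_right (hw P) (hQ P x y).2
  · intro x y _ hM
    rw [hybridCut_insert p v hM]
    congr 1
    refine Finset.sum_congr rfl fun P _ => ?_
    congr 1
    -- An optimal bisection exists, so "always together" and "always separated" exclude each other.
    obtain ⟨S, hS⟩ := optimalSets_nonempty v P (M \ P)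
    simp only [crosses_mk, not_not, Q, Q₁, Q₂]
    by_cases h1 : ∀ S ∈ optimalSets v P (M \ P), (v x ∈ S ↔ v y ∈ S)
    · have h2 : ¬ ∀ S ∈ optimalSets v P (M \ P), ¬ (v x ∈ S ↔ v y ∈ S) :=
        fun h => h S hS (h1 S hS)
      rw [if_pos h1, if_neg h2, if_pos (show sameSide v _ x y from h1), if_pos (show alignedSide v _ x y from Or.inl h1)]
      ring
    · rw [if_neg h1, if_neg (show ¬ sameSide v _ x y from h1)]
      by_cases h2 : ∀ S ∈ optimalSets v P (M \ P), ¬ (v x ∈ S ↔ v y ∈ S)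
      · rw [if_pos h2, if_pos (show alignedSide v _ x y from Or.inr h2)]; ring
      · rw [if_neg h2, if_neg (show ¬ alignedSide v _ x y from fun h => h.elim h1 h2)]; ring

lemma EdgeConcave.abs_insert_sub_le {f : Finset (Sym2 H) → ℝ} (hf : EdgeConcave f)
    {M : Finset (Sym2 H)} {e : Sym2 H} (he : ¬ e.IsDiag) : |f (insert e M) - f M| ≤ 1 := by
  by_cases h : e ∈ M
  · simp [Finset.insert_eq_of_mem h]
  induction e using Sym2.ind with | _ x y
  obtain ⟨k, Q, hk, hk', -, hQ, hins⟩ := hf M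
  rw [hins x y (by simpa using he) h, abs_le]
  have := hQ x y
  constructor <;> linarith

/-- Each added pair changes the value by `k - Q x y`, a difference of two numbers in `[0, 1]`; the
pairs are removed one at a time. -/
lemma EdgeConcave.abs_sub_le {f : Finset (Sym2 H) → ℝ} (hf : EdgeConcave f)
    {M M' : Finset (Sym2 H)} (hM : M ⊆ M') (hd : ∀ e ∈ M', ¬ e.IsDiag) :
    |f M' - f M| ≤ ((M'.card : ℝ) - M.card) := by
  induction hn : (M' \ M).card generalizing M' with
  | zero =>
    have : M' = M := by
      rw [Finset.card_eq_zero, Finset.sdiff_eq_empty_iff_subset] at hn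
      exact hn.antisymm hM
    simp [this]
  | succ n ih =>
    obtain ⟨e, he⟩ : (M' \ M).Nonempty := by
      rw [← Finset.card_pos]; omega
    have heM' := (Finset.mem_sdiff.1 he).1
    have heM := (Finset.mem_sdiff.1 he).2
    have h1 := ih (M' := M'.erase e) (fun x hx => Finset.mem_erase.2
      ⟨fun h => heM (h ▸ hx), hM hx⟩) (fun x hx => hd x (Finset.mem_of_mem_erase hx))
      (by rw [Finset.erase_sdiff_comm, Finset.card_erase_of_mem he, hn]; rfl)
    have h2 := hf.abs_insert_sub_le (M := M'.erase e) (hd e heM')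
    rw [Finset.insert_erase heM'] at h2
    have h3 : ((M'.erase e).card : ℝ) = M'.card - 1 := by
      rw [Finset.card_erase_of_mem heM', Nat.cast_sub (Finset.card_pos.2 ⟨e, heM'⟩)]; simp
    rw [h3] at h1
    rw [abs_le] at *
    constructor <;> linarith

end Kernels

/-! ### Relabelling and disjoint unions -/

section Transport

variable {H H' V V' : Type*}

lemma crosses_map (e : H' ↪ H) (v : H → V) (S : Finset V) (q : Sym2 H') :
    Crosses v S (e.sym2Map q) ↔ Crosses (v ∘ e) S q := by
  induction q using Sym2.ind with | _ x y
  rw [Function.Embedding.sym2Map_apply, Sym2.map_mk, crosses_mk, crosses_mk]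
  rfl

lemma signedCut_map (e : H' ↪ H) (v : H → V) (P N : Finset (Sym2 H')) (S : Finset V) :
    signedCut v (P.map e.sym2Map) (N.map e.sym2Map) S = signedCut (v ∘ e) P N S := by
  simp only [signedCut, Finset.filter_map, Finset.card_map, Function.comp_def, crosses_map]

lemma signedCut_compl [Fintype V] (v : H → V) (P N : Finset (Sym2 H)) (S : Finset V) :
    signedCut v P N Sᶜ = signedCut v P N S := by
  have : ∀ e, Crosses v Sᶜ e ↔ Crosses v S e := by
    intro e
    induction e using Sym2.ind with | _ x y
    simp only [crosses_mk, Finset.mem_compl]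
    tauto
  simp only [signedCut, this]

lemma signedCut_comp_equiv (θ : V ≃ V') (v : H → V) (P N : Finset (Sym2 H)) (S : Finset V) :
    signedCut (θ ∘ v) P N (S.map θ.toEmbedding) = signedCut v P N S := by
  have : ∀ e, Crosses (θ ∘ v) (S.map θ.toEmbedding) e ↔ Crosses v S e := by
    intro e
    induction e using Sym2.ind with | _ x y
    simp [crosses_mk]
  simp only [signedCut, this]

lemma sum_powerset_map (e : Sym2 H' ↪ Sym2 H) (M : Finset (Sym2 H')) (φ : Finset (Sym2 H) → ℝ) :
    ∑ P ∈ (M.map e).powerset, φ P = ∑ P ∈ M.powerset, φ (P.map e) := by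
  symm
  refine Finset.sum_bij (fun P _ => P.map e) ?_ ?_ ?_ fun _ _ => rfl
  · intro P hP
    exact Finset.mem_powerset.2 (Finset.map_subset_map.2 (Finset.mem_powerset.1 hP))
  · intro P _ P' _ h
    exact Finset.map_injective _ h
  · intro P hP
    obtain ⟨P', hP', rfl⟩ := Finset.subset_map_iff.1 (Finset.mem_powerset.1 hP)
    exact ⟨P', Finset.mem_powerset.2 hP', rfl⟩

lemma sum_powerset_union {M M' : Finset (Sym2 H)} (hd : Disjoint M M')
    (φ : Finset (Sym2 H) → ℝ) :
    ∑ P ∈ (M ∪ M').powerset, φ P = ∑ P ∈ M.powerset, ∑ P' ∈ M'.powerset, φ (P ∪ P') := by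
  rw [← Finset.sum_product']
  refine Finset.sum_bij' (fun P _ => (P ∩ M, P ∩ M')) (fun q _ => q.1 ∪ q.2) ?_ ?_ ?_ ?_ ?_
  · intro P _
    simp
  · intro q hq
    simp only [Finset.mem_product, Finset.mem_powerset] at hq ⊢
    exact Finset.union_subset_union hq.1 hq.2
  · intro P hP
    rw [← Finset.inter_union_distrib_left]
    exact Finset.inter_eq_left.2 (Finset.mem_powerset.1 hP)
  · rintro ⟨P, P'⟩ hq
    simp only [Finset.mem_product, Finset.mem_powerset] at hq
    have h1 : Disjoint P' M := (hd.mono_right hq.2).symm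
    have h2 : Disjoint P M' := hd.mono_left hq.1
    simp only [Finset.union_inter_distrib_right, Finset.inter_eq_left.2 hq.1,
      Finset.inter_eq_left.2 hq.2, Finset.disjoint_iff_inter_eq_empty.1 h1,
      Finset.disjoint_iff_inter_eq_empty.1 h2, Finset.union_empty, Finset.empty_union]
  · intro P hP
    rw [← Finset.inter_union_distrib_left, Finset.inter_eq_left.2 (Finset.mem_powerset.1 hP)]

lemma disjoint_map_inl_inr (M : Finset (Sym2 H)) (M' : Finset (Sym2 H')) :
    Disjoint (M.map (Function.Embedding.inl (β := H')).sym2Map)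
      (M'.map (Function.Embedding.inr (α := H)).sym2Map) := by
  rw [Finset.disjoint_left]
  intro q hq hq'
  obtain ⟨a, -, rfl⟩ := Finset.mem_map.1 hq
  obtain ⟨b, -, h⟩ := Finset.mem_map.1 hq'
  induction a using Sym2.ind with | _ x y
  induction b using Sym2.ind with | _ z w
  simp [Function.Embedding.sym2Map] at h

/-- The disjoint union of two sets of pairs. -/
noncomputable def pairSum (M : Finset (Sym2 H)) (M' : Finset (Sym2 H')) :
    Finset (Sym2 (H ⊕ H')) :=
  M.map (Function.Embedding.inl).sym2Map ∪ M'.map (Function.Embedding.inr).sym2Map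

lemma card_pairSum (M : Finset (Sym2 H)) (M' : Finset (Sym2 H')) :
    (pairSum M M').card = M.card + M'.card := by
  rw [pairSum, Finset.card_union_of_disjoint (disjoint_map_inl_inr M M'), Finset.card_map,
    Finset.card_map]

lemma pairSum_sdiff (M P : Finset (Sym2 H)) (M' P' : Finset (Sym2 H')) :
    pairSum M M' \ pairSum P P' = pairSum (M \ P) (M' \ P') := by
  have h1 := Finset.disjoint_left.1 (disjoint_map_inl_inr M P')
  have h2 := Finset.disjoint_left.1 (disjoint_map_inl_inr P M')
  ext q
  simp only [pairSum, Finset.map_sdiff, Finset.mem_sdiff, Finset.mem_union]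
  have := @h1 q
  have := @h2 q
  tauto

lemma signedCut_pairSum (v : H → V) (v' : H' → V') (P N : Finset (Sym2 H))
    (P' N' : Finset (Sym2 H')) (S : Finset V) (S' : Finset V') :
    signedCut (Sum.map v v') (pairSum P P') (pairSum N N') (S.disjSum S') =
      signedCut v P N S + signedCut v' P' N' S' := by
  have key : ∀ (A : Finset (Sym2 H)) (B : Finset (Sym2 H')),
      ((pairSum A B).filter (Crosses (Sum.map v v') (S.disjSum S'))).card =
        (A.filter (Crosses v S)).card + (B.filter (Crosses v' S')).card := by
    intro A B
    have : (pairSum A B).filter (Crosses (Sum.map v v') (S.disjSum S')) =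
        pairSum (A.filter (Crosses v S)) (B.filter (Crosses v' S')) := by
      simp only [pairSum, Finset.filter_union, Finset.filter_map]
      congr 2 <;> refine Finset.filter_congr fun q _ => ?_ <;>
      · rw [Function.comp_apply, crosses_map]
        induction q using Sym2.ind with | _ x y
        simp [crosses_mk]
    rw [this, card_pairSum]
  simp only [signedCut, key]
  push_cast
  ring

variable [Fintype V] [Fintype V']

lemma hybridCut_map (p : ℝ) (e : H' ↪ H) (v : H → V) (M : Finset (Sym2 H')) :
    hybridCut p v (M.map e.sym2Map) = hybridCut p (v ∘ e) M := by
  unfold hybridCut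
  rw [sum_powerset_map]
  refine Finset.sum_congr rfl fun P _ => ?_
  have h : M.map e.sym2Map \ P.map e.sym2Map = (M \ P).map e.sym2Map :=
    (Finset.map_sdiff _ _).symm
  simp only [labelWeight, h, Finset.card_map, maxSignedCut]
  congr 3
  funext S
  exact signedCut_map e v P (M \ P) S

lemma map_mem_balancedSets (θ : V ≃ V') {S : Finset V} (hS : S ∈ balancedSets V) :
    S.map θ.toEmbedding ∈ balancedSets V' := by
  rw [mem_balancedSets, Finset.card_compl] at hS ⊢
  rwa [Finset.card_map, ← Fintype.card_congr θ]

lemma maxSignedCut_comp_equiv_ge (θ : V ≃ V') (v : H → V) (P N : Finset (Sym2 H)) :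
    maxSignedCut v P N ≤ maxSignedCut (θ ∘ v) P N :=
  maxSignedCut_le _ _ _ fun S hS => by
    rw [← signedCut_comp_equiv θ]
    exact signedCut_le _ _ _ (map_mem_balancedSets θ hS)

lemma maxSignedCut_comp_equiv (θ : V ≃ V') (v : H → V) (P N : Finset (Sym2 H)) :
    maxSignedCut (θ ∘ v) P N = maxSignedCut v P N := by
  refine le_antisymm ?_ (maxSignedCut_comp_equiv_ge θ v P N)
  have := maxSignedCut_comp_equiv_ge θ.symm (θ ∘ v) P N
  rwa [← Function.comp_assoc, Equiv.symm_comp_self, Function.id_comp] at this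

lemma hybridCut_comp_equiv (p : ℝ) (θ : V ≃ V') (v : H → V) (M : Finset (Sym2 H)) :
    hybridCut p (θ ∘ v) M = hybridCut p v M := by
  simp only [hybridCut, maxSignedCut_comp_equiv]

lemma hybridCut_empty (p : ℝ) (v : H → V) : hybridCut p v ∅ = 0 := by
  have : maxSignedCut v ∅ ∅ = 0 := by
    obtain ⟨S, hS⟩ := optimalSets_nonempty v ∅ ∅
    rw [← (Finset.mem_filter.1 hS).2]
    simp [signedCut]
  simp [hybridCut, this]

/-- Optimal bisections of the two parts are glued. If both have an odd surplus of the same sign, the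
glued set is off by two; complementing one of them keeps its value and cancels the surpluses. -/
lemma maxSignedCut_pairSum (v : H → V) (v' : H' → V') (P N : Finset (Sym2 H))
    (P' N' : Finset (Sym2 H')) :
    maxSignedCut v P N + maxSignedCut v' P' N' ≤
      maxSignedCut (Sum.map v v') (pairSum P P') (pairSum N N') := by
  obtain ⟨S, hS⟩ := optimalSets_nonempty v P N
  obtain ⟨S', hS'⟩ := optimalSets_nonempty v' P' N'
  obtain ⟨hS1, hS2⟩ := Finset.mem_filter.1 hS
  obtain ⟨hS1', hS2'⟩ := Finset.mem_filter.1 hS'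
  rw [← hS2, ← hS2']
  rw [mem_balancedSets_iff_card, abs_le] at hS1 hS1'
  have h1 := Finset.card_le_univ S
  have h2 := Finset.card_le_univ S'
  by_cases h : S.disjSum S' ∈ balancedSets (V ⊕ V')
  · rw [← signedCut_pairSum]
    exact signedCut_le _ _ _ h
  · rw [← signedCut_compl v', ← signedCut_pairSum]
    refine signedCut_le _ _ _ ?_
    rw [mem_balancedSets_iff_card, abs_le, Finset.card_disjSum, Fintype.card_sum] at h ⊢
    rw [Finset.card_compl]
    omega

lemma labelWeight_pairSum (p : ℝ) (M P : Finset (Sym2 H)) (M' P' : Finset (Sym2 H')) :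
    labelWeight p (pairSum M M') (pairSum P P') = labelWeight p M P * labelWeight p M' P' := by
  simp only [labelWeight, pairSum_sdiff, card_pairSum, pow_add]
  ring

/-- The labels on the two parts are independent, so the weights multiply and the deterministic
inequality `maxSignedCut_pairSum` can be averaged. -/
lemma hybridCut_pairSum {p : ℝ} (hp : 0 ≤ p) (hp' : p ≤ 1) (v : H → V) (v' : H' → V')
    (M : Finset (Sym2 H)) (M' : Finset (Sym2 H')) :
    hybridCut p v M + hybridCut p v' M' ≤ hybridCut p (Sum.map v v') (pairSum M M') := by
  have h1 : hybridCut p v M = ∑ P ∈ M.powerset, ∑ P' ∈ M'.powerset,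
      labelWeight p M P * labelWeight p M' P' * maxSignedCut v P (M \ P) := by
    refine Finset.sum_congr rfl fun P _ => ?_
    rw [← Finset.sum_mul, ← Finset.mul_sum, sum_labelWeight, mul_one]
  have h2 : hybridCut p v' M' = ∑ P ∈ M.powerset, ∑ P' ∈ M'.powerset,
      labelWeight p M P * labelWeight p M' P' * maxSignedCut v' P' (M' \ P') := by
    simp_rw [mul_assoc, ← Finset.mul_sum]
    rw [← Finset.sum_mul, sum_labelWeight, one_mul]
    rfl
  have h3 : hybridCut p (Sum.map v v') (pairSum M M') =
      ∑ P ∈ M.powerset, ∑ P' ∈ M'.powerset, labelWeight p M P * labelWeight p M' P' *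
        maxSignedCut (Sum.map v v') (pairSum P P') (pairSum (M \ P) (M' \ P')) := by
    rw [hybridCut, pairSum, sum_powerset_union (disjoint_map_inl_inr M M'), sum_powerset_map]
    refine Finset.sum_congr rfl fun P _ => ?_
    rw [sum_powerset_map]
    refine Finset.sum_congr rfl fun P' _ => ?_
    change labelWeight p (pairSum M M') (pairSum P P') *
      (maxSignedCut (Sum.map v v') (pairSum P P') (pairSum M M' \ pairSum P P') : ℝ) = _
    rw [labelWeight_pairSum, pairSum_sdiff]
  rw [h1, h2, h3, ← Finset.sum_add_distrib]
  refine Finset.sum_le_sum fun P _ => ?_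
  rw [← Finset.sum_add_distrib]
  refine Finset.sum_le_sum fun P' _ => ?_
  rw [← mul_add]
  refine mul_le_mul_of_nonneg_left ?_ (mul_nonneg (labelWeight_nonneg hp hp' _ _)
    (labelWeight_nonneg hp hp' _ _))
  exact_mod_cast maxSignedCut_pairSum v v' P (M \ P) P' (M' \ P')

end Transport

/-! ### Agreement of `hybridBisection` with `hybridCut` -/

section Frozen

variable {V : Type*} {d : V → ℕ}

lemma mem_edgeSet_graphOfMatching {M : Finset (Sym2 (HalfEdge d))} {e : Sym2 (HalfEdge d)} :
    e ∈ E(graphOfMatching M) ↔ e ∈ M := by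
  rw [Graph.edge_mem_iff_exists_isLink]
  constructor
  · rintro ⟨x, y, h⟩
    exact h.1
  · intro h
    induction e using Sym2.ind with | _ x y
    exact ⟨x.1, y.1, h, rfl⟩

/-- The edges with label `1`. -/
noncomputable def positiveEdges (M : Finset (Sym2 (HalfEdge d)))
    (s : E(graphOfMatching M) → ℤˣ) : Finset (Sym2 (HalfEdge d)) :=
  M.filter fun e => ∃ h : e ∈ E(graphOfMatching M), s ⟨e, h⟩ = 1

variable [Fintype V]

lemma isBisection_graphOfMatching_iff (M : Finset (Sym2 (HalfEdge d))) (V₁ V₂ : Set V) :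
    IsBisection (graphOfMatching M) V₁ V₂ ↔
      ∃ S ∈ balancedSets V, V₁ = (S : Set V) ∧ V₂ = ((Sᶜ : Finset V) : Set V) := by
  constructor
  · rintro ⟨h1, h2, h3⟩
    have h4 : V₂ = V₁ᶜ := by
      refine (IsCompl.compl_eq ⟨h2, ?_⟩).symm
      rw [codisjoint_iff]
      exact h1
    subst h4
    refine ⟨V₁.toFinset, ?_, by simp, by simp⟩
    rw [mem_balancedSets]
    rw [← Set.ncard_coe_finset, ← Set.ncard_coe_finset]
    simpa using h3
  · rintro ⟨S, hS, rfl, rfl⟩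
    refine ⟨?_, ?_, ?_⟩
    · simp [graphOfMatching]
    · simp [disjoint_compl_right]
    · rw [Set.ncard_coe_finset, Set.ncard_coe_finset]
      exact mem_balancedSets.1 hS

lemma cutValue_graphOfMatching (M : Finset (Sym2 (HalfEdge d)))
    (s : E(graphOfMatching M) → ℤˣ) (S : Finset V) :
    cutValue (graphOfMatching M) s S ((Sᶜ : Finset V) : Set V) =
      signedCut Sigma.fst (positiveEdges M s) (M \ positiveEdges M s) S := by
  have hcross : ∀ e : E(graphOfMatching M),
      e ∈ crossingEdges (graphOfMatching M) (S : Set V) ((Sᶜ : Finset V) : Set V) ↔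
        Crosses Sigma.fst S e.1 := by
    rintro ⟨e, he⟩
    have he' := mem_edgeSet_graphOfMatching.1 he
    simp only [crossingEdges, Set.mem_ofPred_eq]
    induction e using Sym2.ind with | _ a b
    rw [crosses_mk]
    constructor
    · rintro ⟨x, hx, y, hy, -, h⟩
      simp only [Finset.mem_coe, Finset.mem_compl] at hx hy
      rcases Sym2.eq_iff.1 h with ⟨rfl, rfl⟩ | ⟨rfl, rfl⟩ <;> tauto
    · intro h
      by_cases ha : a.1 ∈ S
      · exact ⟨a.1, ha, b.1, by simp; tauto, he', rfl⟩
      · exact ⟨b.1, by simp; tauto, a.1, by simpa using ha, he', Sym2.eq_swap⟩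
  have hsub : ∑ᶠ e ∈ crossingEdges (graphOfMatching M) (S : Set V) ((Sᶜ : Finset V) : Set V),
      (s e : ℤ) = ∑ e ∈ M, if Crosses Sigma.fst S e then
        (if e ∈ positiveEdges M s then (1 : ℤ) else -1) else 0 := by
    have : Fintype E(graphOfMatching M) := Fintype.ofFinite _
    rw [finsum_mem_eq_finite_toFinset_sum _ (Set.toFinite _)]
    rw [← Finset.sum_filter]
    refine Finset.sum_bij (fun e _ => e.1) ?_ ?_ ?_ ?_
    · intro e he
      rw [Set.Finite.mem_toFinset, hcross] at he
      exact Finset.mem_filter.2 ⟨mem_edgeSet_graphOfMatching.1 e.2, he⟩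
    · intro e _ e' _ h
      exact Subtype.ext h
    · intro e he
      rw [Finset.mem_filter] at he
      refine ⟨⟨e, mem_edgeSet_graphOfMatching.2 he.1⟩, ?_, rfl⟩
      rw [Set.Finite.mem_toFinset, hcross]
      exact he.2
    · rintro ⟨e, he⟩ _
      have hM := mem_edgeSet_graphOfMatching.1 he
      rcases Int.units_eq_one_or (s ⟨e, he⟩) with h | h
      · rw [if_pos]
        · simp [h]
        · exact Finset.mem_filter.2 ⟨hM, he, h⟩
      · rw [if_neg]
        · simp [h]
        · intro h'
          obtain ⟨_, _, h''⟩ := Finset.mem_filter.1 h'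
          rw [h] at h''
          simp at h''
  rw [cutValue, hsub]
  have hP : positiveEdges M s ⊆ M := Finset.filter_subset _ _
  rw [← Finset.sum_sdiff hP, signedCut, Finset.card_filter, Finset.card_filter]
  push_cast
  rw [← sub_eq_zero]
  have h1 : ∑ e ∈ M \ positiveEdges M s, (if Crosses Sigma.fst S e then
      (if e ∈ positiveEdges M s then (1 : ℤ) else -1) else 0) =
      - ∑ e ∈ M \ positiveEdges M s, if Crosses Sigma.fst S e then (1 : ℤ) else 0 := by
    rw [← Finset.sum_neg_distrib]
    refine Finset.sum_congr rfl fun e he => ?_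
    rw [if_neg (Finset.mem_sdiff.1 he).2]
    split_ifs <;> simp
  have h2 : ∑ e ∈ positiveEdges M s, (if Crosses Sigma.fst S e then
      (if e ∈ positiveEdges M s then (1 : ℤ) else -1) else 0) =
      ∑ e ∈ positiveEdges M s, if Crosses Sigma.fst S e then (1 : ℤ) else 0 :=
    Finset.sum_congr rfl fun e he => by rw [if_pos he]
  rw [h1, h2]
  ring

lemma maxBisection_graphOfMatching (M : Finset (Sym2 (HalfEdge d)))
    (s : E(graphOfMatching M) → ℤˣ) :
    maxBisection (graphOfMatching M) s =
      maxSignedCut Sigma.fst (positiveEdges M s) (M \ positiveEdges M s) := by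
  have hset : {w | ∃ V₁ V₂ : Set V, IsBisection (graphOfMatching M) V₁ V₂ ∧
      w = cutValue (graphOfMatching M) s V₁ V₂} =
      signedCut Sigma.fst (positiveEdges M s) (M \ positiveEdges M s) '' (balancedSets V) := by
    ext w
    simp only [Set.mem_ofPred_eq, isBisection_graphOfMatching_iff, Set.mem_image, Finset.mem_coe]
    constructor
    · rintro ⟨_, _, ⟨S, hS, rfl, rfl⟩, rfl⟩
      exact ⟨S, hS, (cutValue_graphOfMatching M s S).symm⟩
    · rintro ⟨S, hS, rfl⟩
      exact ⟨_, _, ⟨S, hS, rfl, rfl⟩, (cutValue_graphOfMatching M s S).symm⟩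
  rw [maxBisection, hset, maxSignedCut, Finset.sup'_eq_csSup_image]

/-- A labelling is encoded by its set of positive edges, which turns the sum over labellings into a
sum over subsets of `M`. -/
lemma hybridBisection_graphOfMatching (p : ℝ) (M : Finset (Sym2 (HalfEdge d))) :
    hybridBisection p (graphOfMatching M) = hybridCut p Sigma.fst M := by
  have : Fintype E(graphOfMatching M) := Fintype.ofFinite _
  rw [hybridBisection, finsum_eq_sum_of_fintype, hybridCut]
  refine Finset.sum_bij' (fun s _ => positiveEdges M s)
    (fun P _ e => if e.1 ∈ P then 1 else -1) ?_ ?_ ?_ ?_ ?_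
  · intro s _
    exact Finset.mem_powerset.2 (Finset.filter_subset _ _)
  · intro P _
    exact Finset.mem_univ _
  · intro s _
    funext e
    simp only [positiveEdges, Finset.mem_filter]
    rcases Int.units_eq_one_or (s e) with h | h
    · rw [if_pos ⟨mem_edgeSet_graphOfMatching.1 e.2, e.2, h⟩, h]
    · rw [if_neg, h]
      rintro ⟨_, _, h'⟩
      rw [h] at h'
      simp at h'
  · intro P hP
    ext e
    simp only [positiveEdges, Finset.mem_filter]
    constructor
    · rintro ⟨_, _, h⟩
      by_contra h'
      rw [if_neg h'] at h
      simp at h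
    · intro h
      have := Finset.mem_powerset.1 hP h
      exact ⟨this, mem_edgeSet_graphOfMatching.2 this, if_pos h⟩
  · intro s _
    rw [maxBisection_graphOfMatching]
    congr 1
    rw [finprod_eq_prod_of_fintype]
    have h1 : ∏ e, labelProb p (s e) =
        ∏ e ∈ M, if e ∈ positiveEdges M s then p else 1 - p := by
      refine Finset.prod_bij (fun e _ => e.1) ?_ ?_ ?_ ?_
      · intro e _
        exact mem_edgeSet_graphOfMatching.1 e.2
      · intro e _ e' _ h
        exact Subtype.ext h
      · intro e he
        exact ⟨⟨e, mem_edgeSet_graphOfMatching.2 he⟩, Finset.mem_univ _, rfl⟩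
      · rintro ⟨e, he⟩ _
        have hM := mem_edgeSet_graphOfMatching.1 he
        simp only [labelProb]
        refine if_congr ?_ rfl rfl
        simp only [positiveEdges, Finset.mem_filter]
        exact ⟨fun h => ⟨hM, he, h⟩, fun ⟨_, _, h⟩ => h⟩
    have hP : positiveEdges M s ⊆ M := Finset.filter_subset _ _
    rw [h1, ← Finset.prod_sdiff hP, labelWeight, mul_comm]
    congr 1
    · rw [Finset.prod_congr rfl fun e he => if_pos he, Finset.prod_const]
    · rw [Finset.prod_congr rfl fun e he => if_neg (Finset.mem_sdiff.1 he).2, Finset.prod_const]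

end Frozen

/-! ### Matchings and the action of permutations of the half-edges -/

section Matchings

variable {H H' : Type*}

lemma IsMatching.subset {M M' : Finset (Sym2 H)} (hM : IsMatching M) (h : M' ⊆ M) :
    IsMatching M' :=
  ⟨fun e he => hM.1 e (h he), fun e he e' he' => hM.2 e (h he) e' (h he')⟩

lemma IsMatching.map {M : Finset (Sym2 H)} (hM : IsMatching M) (e : H ↪ H') :
    IsMatching (M.map e.sym2Map) := by
  constructor
  · intro q hq
    obtain ⟨q, hqM, rfl⟩ := Finset.mem_map.1 hq
    have := hM.1 q hqM
    induction q using Sym2.ind with | _ x y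
    simpa using this
  · intro q hq q' hq' x hx hx'
    obtain ⟨q, hqM, rfl⟩ := Finset.mem_map.1 hq
    obtain ⟨q', hqM', rfl⟩ := Finset.mem_map.1 hq'
    obtain ⟨y, hy, rfl⟩ := Sym2.mem_map.1 hx
    obtain ⟨z, hz, h⟩ := Sym2.mem_map.1 hx'
    rw [e.injective h] at hz
    rw [hM.2 q hqM q' hqM' y hy hz]

/-- Two transpositions suffice: the first takes `a` to `x`, the second takes the new position of `b`
to `y` without touching `x`. -/
lemma exists_perm_of_notMem {C : Set H} {a b x y : H} (hab : a ≠ b) (hxy : x ≠ y)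
    (ha : a ∉ C) (hb : b ∉ C) (hx : x ∉ C) (hy : y ∉ C) :
    ∃ g : Equiv.Perm H, g a = x ∧ g b = y ∧ ∀ c ∈ C, g c = c := by
  have h1 : Equiv.swap a x b ≠ x := by
    rw [Ne, Equiv.swap_apply_eq_iff, Equiv.swap_apply_right]
    exact hab.symm
  have h2 : Equiv.swap a x b ∉ C := by
    rw [Equiv.swap_apply_def]
    split_ifs <;> assumption
  refine ⟨(Equiv.swap a x).trans (Equiv.swap (Equiv.swap a x b) y), ?_, ?_, ?_⟩
  · rw [Equiv.trans_apply, Equiv.swap_apply_left, Equiv.swap_apply_of_ne_of_ne h1.symm hxy]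
  · simp
  · intro c hc
    have h3 : ∀ z ∉ C, c ≠ z := fun z hz h => hz (h ▸ hc)
    rw [Equiv.trans_apply, Equiv.swap_apply_of_ne_of_ne (h3 a ha) (h3 x hx),
      Equiv.swap_apply_of_ne_of_ne (h3 _ h2) (h3 y hy)]

lemma map_eq_self_of_fixed {M : Finset (Sym2 H)} {g : Equiv.Perm H}
    (hg : ∀ e ∈ M, ∀ x ∈ e, g x = x) : M.map g.toEmbedding.sym2Map = M := by
  have key : ∀ e ∈ M, g.toEmbedding.sym2Map e = e := by
    intro e he
    have h := hg e he
    induction e using Sym2.ind with | _ x y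
    simp [h x (by simp), h y (by simp)]
  ext e
  rw [Finset.mem_map]
  constructor
  · rintro ⟨e, he, rfl⟩
    rwa [key e he]
  · intro he
    exact ⟨e, he, key e he⟩

lemma map_insert_pair (g : H ↪ H') (x y : H) (M : Finset (Sym2 H)) :
    (insert s(x, y) M).map g.sym2Map = insert s(g x, g y) (M.map g.sym2Map) := by
  rw [Finset.map_insert]
  rfl

lemma map_sym2Map_trans {H'' : Type*} (g : H ↪ H') (g' : H' ↪ H'') (M : Finset (Sym2 H)) :
    (M.map g.sym2Map).map g'.sym2Map = M.map (g.trans g').sym2Map := by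
  rw [Finset.map_map]
  congr 1
  ext e
  induction e using Sym2.ind with | _ x y
  rfl

variable [Fintype H]

/-- The unmatched half-edges. -/
noncomputable def freeHalfEdges (M : Finset (Sym2 H)) : Finset H :=
  Finset.univ.filter fun x => ∀ e ∈ M, x ∉ e

lemma mem_freeHalfEdges {M : Finset (Sym2 H)} {x : H} :
    x ∈ freeHalfEdges M ↔ ∀ e ∈ M, x ∉ e := by
  simp [freeHalfEdges]

lemma notMem_of_mem_freeHalfEdges {M : Finset (Sym2 H)} {x y : H} (hx : x ∈ freeHalfEdges M) :
    s(x, y) ∉ M := fun h => mem_freeHalfEdges.1 hx _ h (Sym2.mem_mk_left x y)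

lemma mem_freeHalfEdges_insert {M : Finset (Sym2 H)} {x y z : H} :
    z ∈ freeHalfEdges (insert s(x, y) M) ↔ z ∈ freeHalfEdges M ∧ z ≠ x ∧ z ≠ y := by
  simp only [mem_freeHalfEdges, Finset.mem_insert, forall_eq_or_imp, Sym2.mem_iff]
  tauto

lemma isMatching_insert {M : Finset (Sym2 H)} {x y : H} (hM : IsMatching M) (hxy : x ≠ y)
    (hx : x ∈ freeHalfEdges M) (hy : y ∈ freeHalfEdges M) :
    IsMatching (insert s(x, y) M) := by
  rw [mem_freeHalfEdges] at hx hy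
  constructor
  · intro e he
    rcases Finset.mem_insert.1 he with rfl | he
    · simpa using hxy
    · exact hM.1 e he
  · intro e he e' he' z hz hz'
    rcases Finset.mem_insert.1 he with h1 | h1 <;> rcases Finset.mem_insert.1 he' with h2 | h2
    · rw [h1, h2]
    · rw [h1] at hz
      rcases Sym2.mem_iff.1 hz with h | h <;> rw [h] at hz'
      · exact absurd hz' (hx _ h2)
      · exact absurd hz' (hy _ h2)
    · rw [h2] at hz'
      rcases Sym2.mem_iff.1 hz' with h | h <;> rw [h] at hz
      · exact absurd hz (hx _ h1)
      · exact absurd hz (hy _ h1)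
    · exact hM.2 e h1 e' h2 z hz hz'

lemma IsMatching.of_insert {M : Finset (Sym2 H)} {x y : H} (hM : IsMatching (insert s(x, y) M))
    (he : s(x, y) ∉ M) :
    IsMatching M ∧ x ≠ y ∧ x ∈ freeHalfEdges M ∧ y ∈ freeHalfEdges M := by
  refine ⟨hM.subset (Finset.subset_insert _ _), ?_, ?_, ?_⟩
  · simpa using hM.1 _ (Finset.mem_insert_self _ _)
  all_goals
    rw [mem_freeHalfEdges]
    intro e he' hx
    have := hM.2 _ (Finset.mem_insert_self _ _) e (Finset.mem_insert_of_mem he') _ (by simp) hx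
    exact he (this ▸ he')

lemma card_freeHalfEdges {M : Finset (Sym2 H)} (hM : IsMatching M) :
    (freeHalfEdges M).card + 2 * M.card = Fintype.card H := by
  induction M using Finset.induction_on with
  | empty => simp [freeHalfEdges, Finset.card_univ]
  | insert e M he ih =>
    induction e using Sym2.ind with | _ x y
    obtain ⟨hM', hxy, hx, hy⟩ := hM.of_insert he
    have h1 : freeHalfEdges (insert s(x, y) M) = ((freeHalfEdges M).erase x).erase y := by
      ext z
      rw [mem_freeHalfEdges_insert, Finset.mem_erase, Finset.mem_erase]
      tauto
    have h2 := ih hM'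
    rw [h1, Finset.card_erase_of_mem (Finset.mem_erase.2 ⟨hxy.symm, hy⟩),
      Finset.card_erase_of_mem hx, Finset.card_insert_of_notMem he]
    have h3 : 1 < (freeHalfEdges M).card := Finset.one_lt_card.2 ⟨x, hx, y, hy, hxy⟩
    omega

/-- Complete matchings: at most one half-edge is unmatched. -/
def IsCompleteMatching (M : Finset (Sym2 H)) : Prop :=
  IsMatching M ∧ M.card = Fintype.card H / 2

lemma IsMatching.exists_complete {M : Finset (Sym2 H)} (hM : IsMatching M) :
    ∃ M', M ⊆ M' ∧ IsCompleteMatching M' := by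
  induction hn : Fintype.card H / 2 - M.card generalizing M with
  | zero =>
    have := card_freeHalfEdges hM
    exact ⟨M, subset_rfl, hM, by omega⟩
  | succ n ih =>
    have := card_freeHalfEdges hM
    obtain ⟨x, hx, y, hy, hxy⟩ := Finset.one_lt_card.1 (show 1 < (freeHalfEdges M).card by omega)
    have hcard := Finset.card_insert_of_notMem
      (notMem_of_mem_freeHalfEdges (M := M) (x := x) (y := y) hx)
    obtain ⟨M', h1, h2⟩ := ih (isMatching_insert hM hxy hx hy) (by omega)
    exact ⟨M', (Finset.subset_insert _ _).trans h1, h2⟩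

lemma exists_isCompleteMatching (H : Type*) [Fintype H] :
    ∃ M : Finset (Sym2 H), IsCompleteMatching M :=
  exists_isMatching_card H

/-- The symmetric group acts transitively on matchings of a given size. Hence a uniformly random
complete matching can be modelled by applying a random permutation to any fixed one. -/
lemma IsMatching.exists_perm {M M' : Finset (Sym2 H)} (hM : IsMatching M) (hM' : IsMatching M')
    (h : M.card = M'.card) : ∃ g : Equiv.Perm H, M.map g.toEmbedding.sym2Map = M' := by
  induction M using Finset.induction_on generalizing M' with
  | empty =>
    rw [Finset.card_empty, eq_comm, Finset.card_eq_zero] at h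
    exact ⟨1, by simp [h]⟩
  | insert e M he ih =>
    induction e using Sym2.ind with | _ x y
    obtain ⟨hM₁, hxy, hx, hy⟩ := hM.of_insert he
    rw [Finset.card_insert_of_notMem he] at h
    obtain ⟨e', he'⟩ := Finset.card_pos.1 (show 0 < M'.card by omega)
    obtain ⟨M₁', he'', rfl⟩ : ∃ M₁', e' ∉ M₁' ∧ insert e' M₁' = M' :=
      ⟨M'.erase e', by simp, Finset.insert_erase he'⟩
    induction e' using Sym2.ind with | _ x' y'
    obtain ⟨hM₁', hxy', hx', hy'⟩ := hM'.of_insert he''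
    rw [Finset.card_insert_of_notMem he''] at h
    obtain ⟨g, rfl⟩ := ih hM₁ hM₁' (by omega)
    have hfree : ∀ z ∈ freeHalfEdges M, g z ∈ freeHalfEdges (M.map g.toEmbedding.sym2Map) := by
      intro z hz
      rw [mem_freeHalfEdges] at hz ⊢
      intro q hq hzq
      obtain ⟨q, hqM, rfl⟩ := Finset.mem_map.1 hq
      obtain ⟨w, hw, hwz⟩ := Sym2.mem_map.1 hzq
      rw [g.injective hwz] at hw
      exact hz q hqM hw
    obtain ⟨ρ, h1, h2, h3⟩ := exists_perm_of_notMem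
      (C := {z | z ∉ freeHalfEdges (M.map g.toEmbedding.sym2Map)})
      (g.injective.ne hxy) hxy' (by simpa using hfree x hx) (by simpa using hfree y hy)
      (by simpa using hx') (by simpa using hy')
    refine ⟨g.trans ρ, ?_⟩
    rw [Equiv.trans_toEmbedding, ← map_sym2Map_trans, map_insert_pair, map_insert_pair]
    have h4 : (M.map g.toEmbedding.sym2Map).map ρ.toEmbedding.sym2Map =
        M.map g.toEmbedding.sym2Map := by
      refine map_eq_self_of_fixed fun e he z hz => h3 z ?_
      intro hz'
      exact mem_freeHalfEdges.1 hz' e he hz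
    rw [h4]
    simp [h1, h2]

end Matchings

/-! ### Two sets of half-edges: inner pairs against crossing pairs -/

section Sides

variable {A B : Type*}

/-- Pairs with one half-edge on either side. -/
def IsCross (e : Sym2 (A ⊕ B)) : Prop := ∃ a b, e = s(Sum.inl a, Sum.inr b)

lemma not_isCross_inl (x y : A) : ¬ IsCross (s(Sum.inl x, Sum.inl y) : Sym2 (A ⊕ B)) := by
  rintro ⟨a, b, h⟩
  simp at h

lemma not_isCross_inr (x y : B) : ¬ IsCross (s(Sum.inr x, Sum.inr y) : Sym2 (A ⊕ B)) := by
  rintro ⟨a, b, h⟩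
  simp at h

/-- The number of pairs in `M` with one half-edge on either side. -/
noncomputable def crossCount (M : Finset (Sym2 (A ⊕ B))) : ℕ := (M.filter IsCross).card

lemma crossCount_insert_of_not {M : Finset (Sym2 (A ⊕ B))} {e : Sym2 (A ⊕ B)} (h : ¬ IsCross e) :
    crossCount (insert e M) = crossCount M := by
  rw [crossCount, Finset.filter_insert, if_neg h, crossCount]

lemma crossCount_insert_of_isCross {M : Finset (Sym2 (A ⊕ B))} {e : Sym2 (A ⊕ B)}
    (h : IsCross e) (he : e ∉ M) : crossCount (insert e M) = crossCount M + 1 := by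
  rw [crossCount, Finset.filter_insert, if_pos h, Finset.card_insert_of_notMem (by simp [he]),
    crossCount]

lemma exists_eq_pairSum {M : Finset (Sym2 (A ⊕ B))} (hM : ∀ e ∈ M, ¬ IsCross e) :
    ∃ (MA : Finset (Sym2 A)) (MB : Finset (Sym2 B)), M = pairSum MA MB := by
  refine ⟨M.preimage Function.Embedding.inl.sym2Map (Function.Embedding.injective _).injOn,
    M.preimage Function.Embedding.inr.sym2Map (Function.Embedding.injective _).injOn, ?_⟩
  ext e
  simp only [pairSum, Finset.mem_union, Finset.mem_map, Finset.mem_preimage]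
  constructor
  · intro he
    induction e using Sym2.ind with | _ x y
    rcases x with x | x <;> rcases y with y | y
    · exact Or.inl ⟨s(x, y), he, rfl⟩
    · exact absurd ⟨x, y, rfl⟩ (hM _ he)
    · exact absurd ⟨y, x, Sym2.eq_swap⟩ (hM _ he)
    · exact Or.inr ⟨s(x, y), he, rfl⟩
  · rintro (⟨q, hq, rfl⟩ | ⟨q, hq, rfl⟩) <;> exact hq

lemma IsMatching.of_map {H H' : Type*} {M : Finset (Sym2 H)} {e : H ↪ H'}
    (h : IsMatching (M.map e.sym2Map)) : IsMatching M := by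
  constructor
  · intro q hq hd
    refine h.1 _ (Finset.mem_map_of_mem _ hq) ?_
    induction q using Sym2.ind with | _ x y
    simpa using hd
  · intro q hq q' hq' x hx hx'
    exact e.sym2Map.injective (h.2 _ (Finset.mem_map_of_mem _ hq) _ (Finset.mem_map_of_mem _ hq')
      (e x) (Sym2.mem_map.2 ⟨x, hx, rfl⟩) (Sym2.mem_map.2 ⟨x, hx', rfl⟩))

lemma isMatching_pairSum_iff {MA : Finset (Sym2 A)} {MB : Finset (Sym2 B)} :
    IsMatching (pairSum MA MB) ↔ IsMatching MA ∧ IsMatching MB := by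
  constructor
  · intro h
    exact ⟨(h.subset Finset.subset_union_left).of_map, (h.subset Finset.subset_union_right).of_map⟩
  · rintro ⟨hA, hB⟩
    have hA' := hA.map (Function.Embedding.inl (β := B))
    have hB' := hB.map (Function.Embedding.inr (α := A))
    constructor
    · intro e he
      rcases Finset.mem_union.1 he with he | he
      · exact hA'.1 e he
      · exact hB'.1 e he
    · have key : ∀ e ∈ MA.map (Function.Embedding.inl (β := B)).sym2Map,
          ∀ e' ∈ MB.map (Function.Embedding.inr (α := A)).sym2Map, ∀ x, x ∈ e → x ∉ e' := by
        intro e he e' he' x hx hx'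
        obtain ⟨q, -, rfl⟩ := Finset.mem_map.1 he
        obtain ⟨q', -, rfl⟩ := Finset.mem_map.1 he'
        obtain ⟨y, -, rfl⟩ := Sym2.mem_map.1 hx
        obtain ⟨z, -, h⟩ := Sym2.mem_map.1 hx'
        simp at h
      intro e he e' he' x hx hx'
      rcases Finset.mem_union.1 he with he | he <;> rcases Finset.mem_union.1 he' with he' | he'
      · exact hA'.2 e he e' he' x hx hx'
      · exact absurd hx' (key e he e' he' x hx)
      · exact absurd hx (key e' he' e he x hx')
      · exact hB'.2 e he e' he' x hx hx'

lemma pairSum_mono {M N : Finset (Sym2 A)} {M' N' : Finset (Sym2 B)} (h : M ⊆ N) (h' : M' ⊆ N') :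
    pairSum M M' ⊆ pairSum N N' :=
  Finset.union_subset_union (Finset.map_subset_map.2 h) (Finset.map_subset_map.2 h')

/-- The embedding that applies permutations on both sides. -/
def sumPerm (g : Equiv.Perm A × Equiv.Perm B) : Equiv.Perm (A ⊕ B) := Equiv.sumCongr g.1 g.2

lemma map_pairSum (g : Equiv.Perm A × Equiv.Perm B) (MA : Finset (Sym2 A)) (MB : Finset (Sym2 B)) :
    (pairSum MA MB).map (sumPerm g).toEmbedding.sym2Map =
      pairSum (MA.map g.1.toEmbedding.sym2Map) (MB.map g.2.toEmbedding.sym2Map) := by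
  rw [pairSum, Finset.map_union, pairSum, map_sym2Map_trans, map_sym2Map_trans,
    map_sym2Map_trans, map_sym2Map_trans]
  rfl

/-- Functions of graphs that are invariant under permutations of the half-edges on each side. -/
def SideInvariant (f : Finset (Sym2 (A ⊕ B)) → ℝ) : Prop :=
  ∀ g M, f (M.map (sumPerm g).toEmbedding.sym2Map) = f M

/-- Only off-diagonal values are controlled; the diagonal costs at most 1 per element. After
normalisation this is the origin of the errors `1 / S.card` and `1 / T.card` below. -/
lemma sum_sum_le_of_offDiag {C : Type*} {U : Finset C} {R : C → C → ℝ} {q : ℝ} (hq : 0 ≤ q)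
    (h : ∀ x ∈ U, ∀ y ∈ U, x ≠ y → R x y = q) (h1 : ∀ x y, R x y ≤ 1) :
    ∑ x ∈ U, ∑ y ∈ U, R x y ≤ (U.card : ℝ) ^ 2 * q + U.card := by
  have : ∀ x ∈ U, ∑ y ∈ U, R x y ≤ U.card * q + 1 := by
    intro x hx
    calc ∑ y ∈ U, R x y ≤ ∑ y ∈ U, (q + if x = y then 1 else 0) := by
          refine Finset.sum_le_sum fun y hy => ?_
          split_ifs with hxy
          · linarith [h1 x y]
          · rw [h x hx y hy hxy, add_zero]
      _ = U.card * q + 1 := by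
          rw [Finset.sum_add_distrib, Finset.sum_ite_eq, if_pos hx]; simp
  calc ∑ x ∈ U, ∑ y ∈ U, R x y ≤ ∑ x ∈ U, (U.card * q + 1) := Finset.sum_le_sum this
    _ = _ := by simp; ring

variable [Fintype A] [Fintype B]

lemma SideInvariant.eq_of_isCompleteMatching {f : Finset (Sym2 (A ⊕ B)) → ℝ}
    (hf : SideInvariant f) {MA NA : Finset (Sym2 A)} {MB NB : Finset (Sym2 B)}
    (hMA : IsCompleteMatching MA) (hNA : IsCompleteMatching NA)
    (hMB : IsCompleteMatching MB) (hNB : IsCompleteMatching NB) :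
    f (pairSum MA MB) = f (pairSum NA NB) := by
  obtain ⟨g, rfl⟩ := hMA.1.exists_perm hNA.1 (hMA.2.trans hNA.2.symm)
  obtain ⟨g', rfl⟩ := hMB.1.exists_perm hNB.1 (hMB.2.trans hNB.2.symm)
  rw [← hf (g, g') (pairSum MA MB), map_pairSum]

lemma card_le_half {H : Type*} [Fintype H] {M : Finset (Sym2 H)} (hM : IsMatching M) :
    (M.card : ℝ) ≤ Fintype.card H / 2 := by
  have h := card_freeHalfEdges hM
  have : 2 * M.card ≤ Fintype.card H := by omega
  have : (2 * M.card : ℝ) ≤ Fintype.card H := by exact_mod_cast this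
  linarith

/-- Drop the crossing pairs, then complete the matching on each side. Both moves are paid for by the
Lipschitz bound, and by side invariance the complete matchings reached are as good as `MA` and `MB`.
-/
lemma SideInvariant.abs_sub_pairSum_le {f : Finset (Sym2 (A ⊕ B)) → ℝ}
    (hf : SideInvariant f) (hc : EdgeConcave f) {M : Finset (Sym2 (A ⊕ B))} (hM : IsMatching M)
    {MA : Finset (Sym2 A)} {MB : Finset (Sym2 B)} (hMA : IsCompleteMatching MA)
    (hMB : IsCompleteMatching MB) :
    |f M - f (pairSum MA MB)| ≤
      2 * crossCount M + (Fintype.card A + Fintype.card B : ℝ) / 2 - M.card := by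
  obtain ⟨NA, NB, hN⟩ := exists_eq_pairSum (M := M.filter fun e => ¬ IsCross e)
    (fun e he => (Finset.mem_filter.1 he).2)
  have hsub : pairSum NA NB ⊆ M := hN ▸ Finset.filter_subset _ _
  have hNm := hM.subset hsub
  obtain ⟨hNA, hNB⟩ := isMatching_pairSum_iff.1 hNm
  obtain ⟨NA', hA1, hA2⟩ := hNA.exists_complete
  obtain ⟨NB', hB1, hB2⟩ := hNB.exists_complete
  rw [hf.eq_of_isCompleteMatching hMA hA2 hMB hB2]
  have h1 := hc.abs_sub_le hsub hM.1
  have h2 := hc.abs_sub_le (pairSum_mono hA1 hB1) (isMatching_pairSum_iff.2 ⟨hA2.1, hB2.1⟩).1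
  have h3 : (M.card : ℝ) = crossCount M + (pairSum NA NB).card := by
    rw [← hN, crossCount]
    exact_mod_cast (Finset.card_filter_add_card_filter_not (s := M) IsCross).symm
  have h4 := card_le_half hA2.1
  have h5 := card_le_half hB2.1
  have h6 : ((pairSum NA' NB').card : ℝ) = NA'.card + NB'.card := by
    rw [card_pairSum]; push_cast; ring
  rw [abs_le] at *
  constructor <;> linarith

/-- The unmatched half-edges on the left side. -/
noncomputable def freeLeft (M : Finset (Sym2 (A ⊕ B))) : Finset A :=
  Finset.univ.filter fun a => Sum.inl a ∈ freeHalfEdges M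

/-- The unmatched half-edges on the right side. -/
noncomputable def freeRight (M : Finset (Sym2 (A ⊕ B))) : Finset B :=
  Finset.univ.filter fun b => Sum.inr b ∈ freeHalfEdges M

lemma mem_freeLeft {M : Finset (Sym2 (A ⊕ B))} {a : A} :
    a ∈ freeLeft M ↔ Sum.inl a ∈ freeHalfEdges M := by simp [freeLeft]

lemma mem_freeRight {M : Finset (Sym2 (A ⊕ B))} {b : B} :
    b ∈ freeRight M ↔ Sum.inr b ∈ freeHalfEdges M := by simp [freeRight]

lemma card_freeLeft_add_card_freeRight (M : Finset (Sym2 (A ⊕ B))) :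
    (freeLeft M).card + (freeRight M).card = (freeHalfEdges M).card := by
  rw [← Finset.card_disjSum]
  congr 1
  ext x
  rcases x with x | x <;> simp [mem_freeLeft, mem_freeRight]

lemma freeLeft_insert_cross {M : Finset (Sym2 (A ⊕ B))} {a : A} {b : B}
    (ha : a ∈ freeLeft M) :
    (freeLeft (insert s(Sum.inl a, Sum.inr b) M)).card + 1 = (freeLeft M).card := by
  have : freeLeft (insert s(Sum.inl a, Sum.inr b) M) = (freeLeft M).erase a := by
    ext z
    simp only [mem_freeLeft, mem_freeHalfEdges_insert, Finset.mem_erase]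
    simp; tauto
  rw [this, Finset.card_erase_add_one ha]

lemma freeRight_insert_cross {M : Finset (Sym2 (A ⊕ B))} {a : A} {b : B}
    (hb : b ∈ freeRight M) :
    (freeRight (insert s(Sum.inl a, Sum.inr b) M)).card + 1 = (freeRight M).card := by
  have : freeRight (insert s(Sum.inl a, Sum.inr b) M) = (freeRight M).erase b := by
    ext z
    simp only [mem_freeRight, mem_freeHalfEdges_insert, Finset.mem_erase]
    simp; tauto
  rw [this, Finset.card_erase_add_one hb]

lemma freeLeft_insert_left {M : Finset (Sym2 (A ⊕ B))} {x y : A} (hxy : x ≠ y)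
    (hx : x ∈ freeLeft M) (hy : y ∈ freeLeft M) :
    (freeLeft (insert s(Sum.inl x, Sum.inl y) M)).card + 2 = (freeLeft M).card := by
  have : freeLeft (insert s(Sum.inl x, Sum.inl y) M) = ((freeLeft M).erase x).erase y := by
    ext z
    simp only [mem_freeLeft, mem_freeHalfEdges_insert, Finset.mem_erase]
    simp; tauto
  have h1 := Finset.card_erase_add_one hx
  have h2 := Finset.card_erase_add_one (Finset.mem_erase.2 ⟨hxy.symm, hy⟩)
  rw [this]
  omega

lemma freeRight_insert_left {M : Finset (Sym2 (A ⊕ B))} {x y : A} :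
    freeRight (insert s(Sum.inl x, Sum.inl y) M) = freeRight M := by
  ext z
  simp [mem_freeRight, mem_freeHalfEdges_insert]

lemma freeRight_insert_right {M : Finset (Sym2 (A ⊕ B))} {x y : B} (hxy : x ≠ y)
    (hx : x ∈ freeRight M) (hy : y ∈ freeRight M) :
    (freeRight (insert s(Sum.inr x, Sum.inr y) M)).card + 2 = (freeRight M).card := by
  have : freeRight (insert s(Sum.inr x, Sum.inr y) M) = ((freeRight M).erase x).erase y := by
    ext z
    simp only [mem_freeRight, mem_freeHalfEdges_insert, Finset.mem_erase]
    simp; tauto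
  have h1 := Finset.card_erase_add_one hx
  have h2 := Finset.card_erase_add_one (Finset.mem_erase.2 ⟨hxy.symm, hy⟩)
  rw [this]
  omega

lemma freeLeft_insert_right {M : Finset (Sym2 (A ⊕ B))} {x y : B} :
    freeLeft (insert s(Sum.inr x, Sum.inr y) M) = freeLeft M := by
  ext z
  simp [mem_freeLeft, mem_freeHalfEdges_insert]

/-- The averages of a positive semidefinite kernel over two finite sets and over their product. -/
lemma PosSemidefKernel.two_mul_avg_le {Q : A ⊕ B → A ⊕ B → ℝ} (hQ : PosSemidefKernel Q)
    (hQ1 : ∀ x y, Q x y ≤ 1) {S : Finset A} {T : Finset B} (hS : S.Nonempty) (hT : T.Nonempty)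
    {qA qB qC : ℝ} (hqA : 0 ≤ qA) (hqB : 0 ≤ qB)
    (hA : ∀ x ∈ S, ∀ y ∈ S, x ≠ y → Q (Sum.inl x) (Sum.inl y) = qA)
    (hB : ∀ x ∈ T, ∀ y ∈ T, x ≠ y → Q (Sum.inr x) (Sum.inr y) = qB)
    (hC : ∀ x ∈ S, ∀ y ∈ T, Q (Sum.inl x) (Sum.inr y) = qC)
    (hC' : ∀ x ∈ S, ∀ y ∈ T, Q (Sum.inr y) (Sum.inl x) = qC) :
    2 * qC ≤ qA + qB + 1 / S.card + 1 / T.card := by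
  have hs : (0 : ℝ) < S.card := by exact_mod_cast hS.card_pos
  have ht : (0 : ℝ) < T.card := by exact_mod_cast hT.card_pos
  have h1 := sum_sum_le_of_offDiag (U := S) (R := fun x y => Q (Sum.inl x) (Sum.inl y)) hqA hA fun _ _ => hQ1 _ _
  have h2 := sum_sum_le_of_offDiag (U := T) (R := fun x y => Q (Sum.inr x) (Sum.inr y)) hqB hB fun _ _ => hQ1 _ _
  -- The test function is the uniform distribution on `S` minus the uniform distribution on `T`; its
  -- quadratic form is the average over `S × S` plus that over `T × T` minus twice the mixed
  -- average.
  have h := hQ (Sum.elim (fun a => if a ∈ S then 1 / (S.card : ℝ) else 0)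
    fun b => if b ∈ T then - (1 / (T.card : ℝ)) else 0)
  simp only [Fintype.sum_sum_type, Sum.elim_inl, Sum.elim_inr, ite_mul, zero_mul, mul_ite,
    mul_zero, Finset.sum_add_distrib, Finset.sum_ite_mem, Finset.univ_inter,
    Finset.sum_ite_irrel, Finset.sum_const_zero] at h
  have e1 : ∑ x ∈ S, ∑ y ∈ S, 1 / (S.card : ℝ) * (1 / S.card) * Q (Sum.inl x) (Sum.inl y) =
      (1 / (S.card : ℝ)) ^ 2 * ∑ x ∈ S, ∑ y ∈ S, Q (Sum.inl x) (Sum.inl y) := by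
    simp only [Finset.mul_sum]
    refine Finset.sum_congr rfl fun x _ => Finset.sum_congr rfl fun y _ => by ring
  have e2 : ∑ x ∈ T, ∑ y ∈ T, -(1 / (T.card : ℝ)) * -(1 / (T.card : ℝ)) *
      Q (Sum.inr x) (Sum.inr y) =
      (1 / (T.card : ℝ)) ^ 2 * ∑ x ∈ T, ∑ y ∈ T, Q (Sum.inr x) (Sum.inr y) := by
    simp only [Finset.mul_sum]
    refine Finset.sum_congr rfl fun x _ => Finset.sum_congr rfl fun y _ => by ring
  have e3 : ∑ x ∈ S, ∑ y ∈ T, 1 / (S.card : ℝ) * -(1 / (T.card : ℝ)) *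
      Q (Sum.inl x) (Sum.inr y) = - qC := by
    rw [Finset.sum_congr rfl fun x hx => Finset.sum_congr rfl fun y hy => by rw [hC x hx y hy]]
    simp
    field_simp
  have e4 : ∑ y ∈ T, ∑ x ∈ S, -(1 / (T.card : ℝ)) * (1 / (S.card : ℝ)) *
      Q (Sum.inr y) (Sum.inl x) = - qC := by
    rw [Finset.sum_congr rfl fun y hy => Finset.sum_congr rfl fun x hx => by rw [hC' x hx y hy]]
    simp
    field_simp
  rw [e1, e2, e3, e4] at h
  have h1' : (1 / (S.card : ℝ)) ^ 2 * ∑ x ∈ S, ∑ y ∈ S, Q (Sum.inl x) (Sum.inl y) ≤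
      qA + 1 / S.card := by
    refine (mul_le_mul_of_nonneg_left h1 (by positivity)).trans_eq ?_
    field_simp
  have h2' : (1 / (T.card : ℝ)) ^ 2 * ∑ x ∈ T, ∑ y ∈ T, Q (Sum.inr x) (Sum.inr y) ≤
      qB + 1 / T.card := by
    refine (mul_le_mul_of_nonneg_left h2 (by positivity)).trans_eq ?_
    field_simp
  linarith

/-- Some permutation of the left side moves one free pair to the other and fixes every matched
half-edge. So the value depends only on the kind of the added pair, which makes the kernel constant
on free pairs of each kind. -/
lemma SideInvariant.insert_inl_eq {f : Finset (Sym2 (A ⊕ B)) → ℝ} (hf : SideInvariant f)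
    {M : Finset (Sym2 (A ⊕ B))} {x y x' y' : A} (hxy : x ≠ y) (hxy' : x' ≠ y')
    (hx : x ∈ freeLeft M) (hy : y ∈ freeLeft M) (hx' : x' ∈ freeLeft M) (hy' : y' ∈ freeLeft M) :
    f (insert s(Sum.inl x, Sum.inl y) M) = f (insert s(Sum.inl x', Sum.inl y') M) := by
  obtain ⟨g, h1, h2, h3⟩ := exists_perm_of_notMem (C := {z | z ∉ freeLeft M}) hxy hxy'
    (by simpa using hx) (by simpa using hy) (by simpa using hx') (by simpa using hy')
  rw [← hf (g, 1), map_insert_pair, map_eq_self_of_fixed]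
  · simp [sumPerm, h1, h2]
  · rintro e he (z | z) hz
    · exact congrArg Sum.inl (h3 z fun h => mem_freeHalfEdges.1 (mem_freeLeft.1 h) e he hz)
    · rfl

lemma SideInvariant.insert_inr_eq {f : Finset (Sym2 (A ⊕ B)) → ℝ} (hf : SideInvariant f)
    {M : Finset (Sym2 (A ⊕ B))} {x y x' y' : B} (hxy : x ≠ y) (hxy' : x' ≠ y')
    (hx : x ∈ freeRight M) (hy : y ∈ freeRight M) (hx' : x' ∈ freeRight M)
    (hy' : y' ∈ freeRight M) :
    f (insert s(Sum.inr x, Sum.inr y) M) = f (insert s(Sum.inr x', Sum.inr y') M) := by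
  obtain ⟨g, h1, h2, h3⟩ := exists_perm_of_notMem (C := {z | z ∉ freeRight M}) hxy hxy'
    (by simpa using hx) (by simpa using hy) (by simpa using hx') (by simpa using hy')
  rw [← hf (1, g), map_insert_pair, map_eq_self_of_fixed]
  · simp [sumPerm, h1, h2]
  · rintro e he (z | z) hz
    · rfl
    · exact congrArg Sum.inr (h3 z fun h => mem_freeHalfEdges.1 (mem_freeRight.1 h) e he hz)

lemma SideInvariant.insert_cross_eq {f : Finset (Sym2 (A ⊕ B)) → ℝ} (hf : SideInvariant f)
    {M : Finset (Sym2 (A ⊕ B))} {x x' : A} {y y' : B}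
    (hx : x ∈ freeLeft M) (hy : y ∈ freeRight M) (hx' : x' ∈ freeLeft M)
    (hy' : y' ∈ freeRight M) :
    f (insert s(Sum.inl x, Sum.inr y) M) = f (insert s(Sum.inl x', Sum.inr y') M) := by
  rw [← hf (Equiv.swap x x', Equiv.swap y y'), map_insert_pair, map_eq_self_of_fixed]
  · simp [sumPerm]
  · rintro e he (z | z) hz
    · refine congrArg Sum.inl (Equiv.swap_apply_of_ne_of_ne ?_ ?_) <;> rintro rfl
      · exact mem_freeHalfEdges.1 (mem_freeLeft.1 hx) e he hz
      · exact mem_freeHalfEdges.1 (mem_freeLeft.1 hx') e he hz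
    · refine congrArg Sum.inr (Equiv.swap_apply_of_ne_of_ne ?_ ?_) <;> rintro rfl
      · exact mem_freeHalfEdges.1 (mem_freeRight.1 hy) e he hz
      · exact mem_freeHalfEdges.1 (mem_freeRight.1 hy') e he hz

/-- Adding a pair inside either side gains on average no more than adding a pair between the
sides. -/
lemma SideInvariant.insert_add_insert_le {f : Finset (Sym2 (A ⊕ B)) → ℝ} (hf : SideInvariant f)
    (hc : EdgeConcave f) {M : Finset (Sym2 (A ⊕ B))} {a a₁ a₂ : A} {b b₁ b₂ : B}
    (ha : a ∈ freeLeft M) (ha₁ : a₁ ∈ freeLeft M) (ha₂ : a₂ ∈ freeLeft M) (haa : a₁ ≠ a₂)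
    (hb : b ∈ freeRight M) (hb₁ : b₁ ∈ freeRight M) (hb₂ : b₂ ∈ freeRight M) (hbb : b₁ ≠ b₂) :
    f (insert s(Sum.inl a₁, Sum.inl a₂) M) + f (insert s(Sum.inr b₁, Sum.inr b₂) M) ≤
      2 * f (insert s(Sum.inl a, Sum.inr b) M) +
        1 / (freeLeft M).card + 1 / (freeRight M).card := by
  obtain ⟨k, Q, -, -, hQ, hQ1, hins⟩ := hc M
  have hl : ∀ {x : A} {y : A ⊕ B}, x ∈ freeLeft M → s(Sum.inl x, y) ∉ M := fun hx =>
    notMem_of_mem_freeHalfEdges (mem_freeLeft.1 hx)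
  have hr : ∀ {x : B} {y : A ⊕ B}, x ∈ freeRight M → s(Sum.inr x, y) ∉ M := fun hx =>
    notMem_of_mem_freeHalfEdges (mem_freeRight.1 hx)
  have hA : ∀ x ∈ freeLeft M, ∀ y ∈ freeLeft M, x ≠ y →
      Q (Sum.inl x) (Sum.inl y) = f M + k - f (insert s(Sum.inl a₁, Sum.inl a₂) M) := by
    intro x hx y hy hxy
    rw [hf.insert_inl_eq haa hxy ha₁ ha₂ hx hy,
      hins _ _ (Sum.inl_injective.ne hxy) (hl hx)]
    ring
  have hB : ∀ x ∈ freeRight M, ∀ y ∈ freeRight M, x ≠ y →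
      Q (Sum.inr x) (Sum.inr y) = f M + k - f (insert s(Sum.inr b₁, Sum.inr b₂) M) := by
    intro x hx y hy hxy
    rw [hf.insert_inr_eq hbb hxy hb₁ hb₂ hx hy,
      hins _ _ (Sum.inr_injective.ne hxy) (hr hx)]
    ring
  have hC : ∀ x ∈ freeLeft M, ∀ y ∈ freeRight M,
      Q (Sum.inl x) (Sum.inr y) = f M + k - f (insert s(Sum.inl a, Sum.inr b) M) := by
    intro x hx y hy
    rw [hf.insert_cross_eq ha hb hx hy, hins _ _ (by simp) (hl hx)]
    ring
  have hC' : ∀ x ∈ freeLeft M, ∀ y ∈ freeRight M,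
      Q (Sum.inr y) (Sum.inl x) = f M + k - f (insert s(Sum.inl a, Sum.inr b) M) := by
    intro x hx y hy
    rw [hf.insert_cross_eq ha hb hx hy, Sym2.eq_swap, hins _ _ (by simp) (hr hy)]
    ring
  have h := hQ.two_mul_avg_le (fun x y => (hQ1 x y).2) ⟨a, ha⟩ ⟨b, hb⟩
    (hA a₁ ha₁ a₂ ha₂ haa ▸ (hQ1 _ _).1) (hB b₁ hb₁ b₂ hb₂ hbb ▸ (hQ1 _ _).1) hA hB hC hC'
  linarith

end Sides

/-! ### Interpolation between one joint matching and two separate ones -/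

section Interpolation

variable {A B : Type*} [Fintype A] [Fintype B]

lemma exists_insert_cross {M : Finset (Sym2 (A ⊕ B))} (hM : IsMatching M)
    (hc : 0 < crossCount M) :
    ∃ (M₀ : Finset (Sym2 (A ⊕ B))) (a : A) (b : B), s(Sum.inl a, Sum.inr b) ∉ M₀ ∧
      M = insert s(Sum.inl a, Sum.inr b) M₀ ∧ IsMatching M₀ ∧ a ∈ freeLeft M₀ ∧
        b ∈ freeRight M₀ := by
  obtain ⟨e, he⟩ := Finset.card_pos.1 hc
  obtain ⟨heM, a, b, rfl⟩ := Finset.mem_filter.1 he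
  have h1 : M = insert s(Sum.inl a, Sum.inr b) (M.erase s(Sum.inl a, Sum.inr b)) :=
    (Finset.insert_erase heM).symm
  have h2 : s(Sum.inl a, Sum.inr b) ∉ M.erase s(Sum.inl a, Sum.inr b) := by simp
  rw [h1] at hM
  obtain ⟨h3, -, h4, h5⟩ := hM.of_insert h2
  exact ⟨_, a, b, h2, h1, h3, mem_freeLeft.2 h4, mem_freeRight.2 h5⟩

/-- Induction on the number `c` of crossing pairs, with the number `l` of free half-edges fixed. One
crossing pair is exchanged for an inner pair on either side with equal weights. The imbalance of
free half-edges then performs a simple random walk with steps ±2, so squared imbalance plus `4 * c`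
is preserved on average. This potential pays for the event that one side runs short of free
half-edges. -/
lemma SideInvariant.pairSum_sub_le_aux {f : Finset (Sym2 (A ⊕ B)) → ℝ} (hf : SideInvariant f)
    (hc : EdgeConcave f) {MA : Finset (Sym2 A)} {MB : Finset (Sym2 B)}
    (hMA : IsCompleteMatching MA) (hMB : IsCompleteMatching MB) {l : ℝ} (hl : 0 < l) (c : ℕ) :
    ∀ M : Finset (Sym2 (A ⊕ B)), IsMatching M → crossCount M = c →
      (Fintype.card A + Fintype.card B : ℝ) - 2 * M.card = l →
      f (pairSum MA MB) - (l / 2 + 4 / l * c + 4 * (Fintype.card A + Fintype.card B) / l ^ 2 *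
        (((freeLeft M).card - (freeRight M).card : ℝ) ^ 2 + 4 * c)) ≤ f M := by
  have hN : (0 : ℝ) ≤ Fintype.card A + Fintype.card B := by positivity
  generalize hNN : (Fintype.card A + Fintype.card B : ℝ) = N at *
  induction c with
  | zero =>
    intro M hM hcM hlM
    have h := (abs_le.1 (hf.abs_sub_pairSum_le hc hM hMA hMB)).1
    rw [hcM, hNN] at h
    have h2 : 0 ≤ 4 * N / l ^ 2 * (((freeLeft M).card - (freeRight M).card : ℝ) ^ 2) := by
      positivity
    push_cast at h ⊢
    linarith
  | succ c ih =>
    intro M hM hcM hlM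
    have hcrude := (abs_le.1 (hf.abs_sub_pairSum_le hc hM hMA hMB)).1
    rw [hcM, hNN] at hcrude
    have hcN : ((c : ℝ) + 1) ≤ N / 2 := by
      have h1 : crossCount M ≤ M.card := Finset.card_filter_le _ _
      rw [hcM] at h1
      have h2 : ((c : ℝ) + 1) ≤ M.card := by exact_mod_cast h1
      linarith
    obtain ⟨M₀, a, b, hab, rfl, hM₀, ha, hb⟩ := exists_insert_cross hM (by omega)
    have hLa := freeLeft_insert_cross (b := b) ha
    have hLb := freeRight_insert_cross (a := a) hb
    have hcard := card_freeHalfEdges hM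
    rw [← card_freeLeft_add_card_freeRight, Fintype.card_sum] at hcard
    rw [crossCount_insert_of_isCross ⟨a, b, rfl⟩ hab] at hcM
    have hMc := Finset.card_insert_of_notMem hab
    set M := insert s(Sum.inl a, Sum.inr b) M₀ with hMdef
    have hsum : ((freeLeft M).card + (freeRight M).card : ℝ) = l := by
      have : ((freeLeft M).card + (freeRight M).card + 2 * M.card : ℝ) = N := by
        rw [← hNN]; exact_mod_cast hcard
      linarith
    have hα : ((freeLeft M).card + 1 : ℝ) = (freeLeft M₀).card := by exact_mod_cast hLa
    have hβ : ((freeRight M).card + 1 : ℝ) = (freeRight M₀).card := by exact_mod_cast hLb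
    set α : ℝ := ((freeLeft M).card : ℝ) with hαdef
    set β : ℝ := ((freeRight M).card : ℝ) with hβdef
    push_cast
    have hl4 : 0 ≤ 4 / l * ((c : ℝ) + 1) := by positivity
    -- With a large imbalance the potential term alone is at least `N`, and the crude Lipschitz
    -- bound suffices. Otherwise `α` and `β` both exceed `l / 4`, and an exchange costs at most `4 /
    -- l`.
    by_cases hD : l ^ 2 / 4 ≤ (α - β) ^ 2
    · have h1 : N ≤ 4 * N / l ^ 2 * (α - β) ^ 2 := by
        calc N = 4 * N / l ^ 2 * (l ^ 2 / 4) := by field_simp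
          _ ≤ _ := mul_le_mul_of_nonneg_left hD (by positivity)
      have h2 : 0 ≤ 4 * N / l ^ 2 * (4 * ((c : ℝ) + 1)) := by positivity
      push_cast at hcrude
      rw [mul_add]
      linarith
    · push Not at hD
      have hDlt : |α - β| < l / 2 := by
        refine abs_lt_of_sq_lt_sq ?_ (by positivity)
        linarith
      have hαl : l / 4 < α := by linarith [(abs_lt.1 hDlt).1]
      have hβl : l / 4 < β := by linarith [(abs_lt.1 hDlt).2]
      have hα0 : 0 < (freeLeft M).card := by
        have : (0 : ℝ) < (freeLeft M).card := by linarith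
        exact_mod_cast this
      have hβ0 : 0 < (freeRight M).card := by
        have : (0 : ℝ) < (freeRight M).card := by linarith
        exact_mod_cast this
      obtain ⟨a₁, ha₁, a₂, ha₂, haa⟩ := Finset.one_lt_card.1
        (show 1 < (freeLeft M₀).card by omega)
      obtain ⟨b₁, hb₁, b₂, hb₂, hbb⟩ := Finset.one_lt_card.1
        (show 1 < (freeRight M₀).card by omega)
      have hstep := hf.insert_add_insert_le hc ha ha₁ ha₂ haa hb hb₁ hb₂ hbb
      rw [← hMdef] at hstep
      have hn1 : s(Sum.inl a₁, Sum.inl a₂) ∉ M₀ :=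
        notMem_of_mem_freeHalfEdges (mem_freeLeft.1 ha₁)
      have hn2 : s(Sum.inr b₁, Sum.inr b₂) ∉ M₀ :=
        notMem_of_mem_freeHalfEdges (mem_freeRight.1 hb₁)
      have hcM₀ : crossCount M₀ = c := by omega
      have hMc' : (M.card : ℝ) = M₀.card + 1 := by exact_mod_cast hMc
      have h1 := ih (insert s(Sum.inl a₁, Sum.inl a₂) M₀)
        (isMatching_insert hM₀ (Sum.inl_injective.ne haa) (mem_freeLeft.1 ha₁)
          (mem_freeLeft.1 ha₂))
        ((crossCount_insert_of_not (not_isCross_inl _ _)).trans hcM₀)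
        (by rw [Finset.card_insert_of_notMem hn1]; push_cast; rw [← hMc']; exact hlM)
      have h2 := ih (insert s(Sum.inr b₁, Sum.inr b₂) M₀)
        (isMatching_insert hM₀ (Sum.inr_injective.ne hbb) (mem_freeRight.1 hb₁)
          (mem_freeRight.1 hb₂))
        ((crossCount_insert_of_not (not_isCross_inr _ _)).trans hcM₀)
        (by rw [Finset.card_insert_of_notMem hn2]; push_cast; rw [← hMc']; exact hlM)
      have e1 : ((freeLeft (insert s(Sum.inl a₁, Sum.inl a₂) M₀)).card : ℝ) = α - 1 := by
        have : ((freeLeft (insert s(Sum.inl a₁, Sum.inl a₂) M₀)).card + 2 : ℝ) =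
            (freeLeft M₀).card := by exact_mod_cast freeLeft_insert_left haa ha₁ ha₂
        linarith
      have e2 : ((freeRight (insert s(Sum.inr b₁, Sum.inr b₂) M₀)).card : ℝ) = β - 1 := by
        have : ((freeRight (insert s(Sum.inr b₁, Sum.inr b₂) M₀)).card + 2 : ℝ) =
            (freeRight M₀).card := by exact_mod_cast freeRight_insert_right hbb hb₁ hb₂
        linarith
      rw [e1, freeRight_insert_left, ← hβ] at h1
      rw [e2, freeLeft_insert_right, ← hα] at h2
      rw [← hα, ← hβ] at hstep
      have e3 : 1 / (α + 1) ≤ 4 / l := by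
        rw [div_le_div_iff₀ (by linarith) hl]; linarith
      have e4 : 1 / (β + 1) ≤ 4 / l := by
        rw [div_le_div_iff₀ (by linarith) hl]; linarith
      -- The martingale identity: the mean of `(x - 2) ^ 2` and `(x + 2) ^ 2` is `x ^ 2 + 4`, and
      -- the extra 4 is the drop in `4 * c`.
      have e5 : 4 * N / l ^ 2 * ((α - β) ^ 2 + 4 * ((c : ℝ) + 1)) * 2 =
          4 * N / l ^ 2 * ((α - 1 - (β + 1)) ^ 2 + 4 * c) +
          4 * N / l ^ 2 * ((α + 1 - (β - 1)) ^ 2 + 4 * c) := by ring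
      have e6 : 4 / l * ((c : ℝ) + 1) = 4 / l * c + 4 / l := by ring
      linarith

lemma exists_subset_of_le_crossCount {M : Finset (Sym2 (A ⊕ B))} (hM : IsMatching M) (m : ℕ)
    (hm : m ≤ crossCount M) :
    ∃ M' ⊆ M, M'.card + m = M.card ∧ (freeLeft M').card = (freeLeft M).card + m ∧
      (freeRight M').card = (freeRight M).card + m := by
  induction m generalizing M with
  | zero => exact ⟨M, subset_rfl, rfl, rfl, rfl⟩
  | succ m ih =>
    obtain ⟨M₀, a, b, hab, rfl, hM₀, ha, hb⟩ := exists_insert_cross hM (by omega)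
    rw [crossCount_insert_of_isCross ⟨a, b, rfl⟩ hab] at hm
    obtain ⟨M', h1, h2, h3, h4⟩ := ih hM₀ (by omega)
    have h5 := freeLeft_insert_cross (b := b) ha
    have h6 := freeRight_insert_cross (a := a) hb
    refine ⟨M', h1.trans (Finset.subset_insert _ _), ?_, by omega, by omega⟩
    rw [Finset.card_insert_of_notMem hab]
    omega

/-- Crude bookkeeping with at least `2 * m` free half-edges, at most `N / 2` crossing pairs and
initial squared imbalance at most 1. -/
lemma interpolation_error_le {N m l c D : ℝ} (hm : 1 ≤ m) (hl : 2 * m ≤ l) (hN : 2 * m ≤ N)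
    (hc : 0 ≤ c) (hcN : c ≤ N / 2) (hD : D ≤ 1) :
    4 / l * c + 4 * N / l ^ 2 * (D + 4 * c) ≤ 4 * N ^ 2 / m ^ 2 := by
  have hm0 : 0 < m := by linarith
  have hl0 : 0 < l := by linarith
  have hN0 : 0 < N := by linarith
  have e1 : 4 / l * c ≤ 4 / (2 * m) * (N / 2) := by gcongr
  have e2 : 4 * N / l ^ 2 * (D + 4 * c) ≤ 4 * N / (2 * m) ^ 2 * (1 + 4 * (N / 2)) := by
    calc 4 * N / l ^ 2 * (D + 4 * c) ≤ 4 * N / l ^ 2 * (1 + 4 * (N / 2)) := by gcongr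
      _ ≤ _ := by gcongr
  have e3 : 4 / (2 * m) * (N / 2) + 4 * N / (2 * m) ^ 2 * (1 + 4 * (N / 2)) =
      (N * m + N + 2 * N ^ 2) / m ^ 2 := by
    field_simp
    ring
  have e4 : (N * m + N + 2 * N ^ 2) / m ^ 2 ≤ 4 * N ^ 2 / m ^ 2 := by
    gcongr
    nlinarith
  linarith

/-- A complete matching of the union of two sets of half-edges is, on average over permutations
of the two sets, almost as good as the union of complete matchings of the two sets. -/
lemma SideInvariant.pairSum_sub_le {f : Finset (Sym2 (A ⊕ B)) → ℝ} (hf : SideInvariant f)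
    (hc : EdgeConcave f) {MA : Finset (Sym2 A)} {MB : Finset (Sym2 B)}
    (hMA : IsCompleteMatching MA) (hMB : IsCompleteMatching MB) {M : Finset (Sym2 (A ⊕ B))}
    (hM : IsCompleteMatching M) {m : ℕ} (hm : 1 ≤ m) :
    f (pairSum MA MB) - (3 * m + 4 * (Fintype.card A + Fintype.card B) ^ 2 / m ^ 2) ≤ f M := by
  have hm' : (1 : ℝ) ≤ m := by exact_mod_cast hm
  have hcard := hM.2
  rw [Fintype.card_sum] at hcard
  have hfree := card_freeHalfEdges hM.1
  rw [← card_freeLeft_add_card_freeRight, Fintype.card_sum] at hfree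
  have hc1 : (2 * M.card + 1 : ℝ) ≥ Fintype.card A + Fintype.card B := by
    exact_mod_cast (show 2 * M.card + 1 ≥ Fintype.card A + Fintype.card B by omega)
  have hc2 := card_le_half hM.1
  rw [Fintype.card_sum] at hc2
  push_cast at hc2
  -- Few crossing pairs can simply be dropped. Otherwise `m` of them are removed, which provides the
  -- free half-edges that the interpolation needs and frees equally many on both sides.
  rcases lt_or_ge (crossCount M) m with h | h
  · have h1 := (abs_le.1 (hf.abs_sub_pairSum_le hc hM.1 hMA hMB)).1
    have h2 : (crossCount M : ℝ) + 1 ≤ m := by exact_mod_cast h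
    have h3 : (0 : ℝ) ≤ 4 * (Fintype.card A + Fintype.card B) ^ 2 / m ^ 2 := by positivity
    linarith
  · obtain ⟨M', hsub, h1, h2, h3⟩ := exists_subset_of_le_crossCount hM.1 m h
    have h1' : (M'.card + m : ℝ) = M.card := by exact_mod_cast h1
    have h2' : ((freeLeft M').card : ℝ) = (freeLeft M).card + m := by exact_mod_cast h2
    have h3' : ((freeRight M').card : ℝ) = (freeRight M).card + m := by exact_mod_cast h3
    have hM' := hM.1.subset hsub
    have hlip := (abs_le.1 (hc.abs_sub_le hsub hM.1.1)).1
    have hcc : (crossCount M' : ℝ) ≤ M'.card := by exact_mod_cast Finset.card_filter_le _ _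
    have hMm : (m : ℝ) ≤ M.card := by
      exact_mod_cast h.trans (Finset.card_filter_le _ _)
    have haux := hf.pairSum_sub_le_aux hc hMA hMB
      (l := (Fintype.card A + Fintype.card B : ℝ) - 2 * M'.card) (by linarith)
      (crossCount M') M' hM' rfl rfl
    -- A complete matching leaves at most one half-edge free, and the removed crossing pairs do not
    -- alter the difference between the sides.
    have hD : (((freeLeft M').card - (freeRight M').card : ℝ)) ^ 2 ≤ 1 := by
      rw [h2', h3', add_sub_add_right_eq_sub, sq_le_one_iff_abs_le_one, abs_le]
      have h4 : (freeLeft M).card + (freeRight M).card ≤ 1 := by omega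
      have h5 : ((freeLeft M).card + (freeRight M).card : ℝ) ≤ 1 := by exact_mod_cast h4
      have h6 : (0 : ℝ) ≤ (freeLeft M).card := by positivity
      have h7 : (0 : ℝ) ≤ (freeRight M).card := by positivity
      constructor <;> linarith
    generalize (Fintype.card A + Fintype.card B : ℝ) = N at *
    generalize hl : N - 2 * (M'.card : ℝ) = l at *
    have hlm : 2 * (m : ℝ) ≤ l := by linarith
    have hN0 : 0 ≤ N := by linarith
    have hNm : 2 * (m : ℝ) ≤ N := by linarith
    have hcN : (crossCount M' : ℝ) ≤ N / 2 := by linarith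
    have := interpolation_error_le hm' hlm hNm (Nat.cast_nonneg (crossCount M')) hcN hD
    linarith

end Interpolation

/-! ### Averages over permutations and the expected hybrid bisection -/

section Averages

variable {A B H : Type*} [Fintype A] [Fintype B] [Fintype H]

/-- Positive semidefinite kernels are closed under permuting the arguments and under convex
combinations. This is what allows `hybridCut`, which is not side invariant, to be replaced by its
side average. -/
lemma EdgeConcave.avg {f : Finset (Sym2 H) → ℝ} (hf : EdgeConcave f) {ι : Type*} [Fintype ι]
    [Nonempty ι] (g : ι → Equiv.Perm H) :
    EdgeConcave fun M => (∑ i, f (M.map (g i).toEmbedding.sym2Map)) / Fintype.card ι := by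
  intro M
  have hι : (0 : ℝ) < Fintype.card ι := by exact_mod_cast Fintype.card_pos
  choose k Q hk hk' hQ hQ1 hins using fun i => hf (M.map (g i).toEmbedding.sym2Map)
  have hcard : ∑ _i : ι, (1 / (Fintype.card ι : ℝ)) = 1 := by
    simp [Finset.card_univ, hι.ne']
  refine ⟨∑ i, 1 / (Fintype.card ι : ℝ) * k i,
    fun x y => ∑ i, 1 / (Fintype.card ι : ℝ) * Q i (g i x) (g i y), ?_, ?_, ?_, ?_, ?_⟩
  · exact Finset.sum_nonneg fun i _ => mul_nonneg (by positivity) (hk i)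
  · exact (Finset.sum_le_sum fun i _ =>
      mul_le_of_le_one_right (by positivity) (hk' i)).trans_eq hcard
  · exact PosSemidefKernel.sum _ _ (fun i x y => Q i (g i x) (g i y))
      (fun _ _ => by positivity) fun i _ => (hQ i).comp_equiv (g i)
  · intro x y
    refine ⟨Finset.sum_nonneg fun i _ => mul_nonneg (by positivity) (hQ1 i _ _).1, ?_⟩
    exact (Finset.sum_le_sum fun i _ =>
      mul_le_of_le_one_right (by positivity) (hQ1 i _ _).2).trans_eq hcard
  · intro x y hxy hM
    have : ∀ i, f ((insert s(x, y) M).map (g i).toEmbedding.sym2Map) =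
        f (M.map (g i).toEmbedding.sym2Map) + k i - Q i (g i x) (g i y) := by
      intro i
      rw [map_insert_pair]
      refine hins i _ _ ((g i).injective.ne hxy) ?_
      intro h
      obtain ⟨q, hq, h⟩ := Finset.mem_map.1 h
      have : q = s(x, y) := (g i).toEmbedding.sym2Map.injective h
      exact hM (this ▸ hq)
    simp only [this, Finset.sum_div, ← Finset.sum_add_distrib, ← Finset.sum_sub_distrib]
    refine Finset.sum_congr rfl fun i _ => by ring

/-- The average of `f` over all permutations that preserve the two sides. -/
noncomputable def sideAverage (f : Finset (Sym2 (A ⊕ B)) → ℝ) (M : Finset (Sym2 (A ⊕ B))) : ℝ :=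
  (∑ g : Equiv.Perm A × Equiv.Perm B, f (M.map (sumPerm g).toEmbedding.sym2Map)) /
    Fintype.card (Equiv.Perm A × Equiv.Perm B)

lemma EdgeConcave.sideAverage {f : Finset (Sym2 (A ⊕ B)) → ℝ} (hf : EdgeConcave f) :
    EdgeConcave (sideAverage f) := hf.avg sumPerm

lemma sideInvariant_sideAverage (f : Finset (Sym2 (A ⊕ B)) → ℝ) :
    SideInvariant (sideAverage f) := by
  intro g M
  unfold sideAverage
  congr 1
  refine Fintype.sum_equiv (Equiv.mulRight g) _ _ fun g' => ?_
  rw [map_sym2Map_trans, ← Equiv.trans_toEmbedding]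
  congr 3
  ext x
  rcases x with x | x <;> rfl

/-- The average of `f` over all images of `M` under permutations. -/
noncomputable def permAverage (f : Finset (Sym2 H) → ℝ) (M : Finset (Sym2 H)) : ℝ :=
  (∑ g : Equiv.Perm H, f (M.map g.toEmbedding.sym2Map)) / Fintype.card (Equiv.Perm H)

lemma permAverage_map (f : Finset (Sym2 H) → ℝ) (g : Equiv.Perm H) (M : Finset (Sym2 H)) :
    permAverage f (M.map g.toEmbedding.sym2Map) = permAverage f M := by
  unfold permAverage
  congr 1
  refine Fintype.sum_equiv (Equiv.mulRight g) _ _ fun g' => ?_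
  rw [map_sym2Map_trans, ← Equiv.trans_toEmbedding]
  rfl

lemma permAverage_eq_of_isCompleteMatching (f : Finset (Sym2 H) → ℝ) {M M' : Finset (Sym2 H)}
    (hM : IsCompleteMatching M) (hM' : IsCompleteMatching M') :
    permAverage f M = permAverage f M' := by
  obtain ⟨g, rfl⟩ := hM.1.exists_perm hM'.1 (hM.2.trans hM'.2.symm)
  rw [permAverage_map]

lemma permAverage_map_comm (f : Finset (Sym2 H) → ℝ) (g : Equiv.Perm H) (M : Finset (Sym2 H)) :
    permAverage (fun M => f (M.map g.toEmbedding.sym2Map)) M = permAverage f M := by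
  unfold permAverage
  congr 1
  refine Fintype.sum_equiv (Equiv.mulLeft g) _ _ fun g' => ?_
  dsimp only
  rw [map_sym2Map_trans, ← Equiv.trans_toEmbedding]
  rfl

/-- Side permutations form a subgroup of all permutations, so averaging over them first is absorbed
by the full average. -/
lemma permAverage_sideAverage (f : Finset (Sym2 (A ⊕ B)) → ℝ) (M : Finset (Sym2 (A ⊕ B))) :
    permAverage (sideAverage f) M = permAverage f M := by
  have h : permAverage (sideAverage f) M = (∑ g : Equiv.Perm A × Equiv.Perm B,
      permAverage (fun M => f (M.map (sumPerm g).toEmbedding.sym2Map)) M) /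
        Fintype.card (Equiv.Perm A × Equiv.Perm B) := by
    unfold permAverage sideAverage
    simp only [← Finset.sum_div]
    rw [Finset.sum_comm, div_right_comm]
  have hpos : (0 : ℝ) < Fintype.card (Equiv.Perm A × Equiv.Perm B) := by
    exact_mod_cast Fintype.card_pos
  rw [h]
  simp only [permAverage_map_comm, Finset.sum_const, Finset.card_univ, nsmul_eq_mul]
  field_simp

lemma le_permAverage {f : Finset (Sym2 H) → ℝ} {M : Finset (Sym2 H)} {c : ℝ}
    (h : ∀ g : Equiv.Perm H, c ≤ f (M.map g.toEmbedding.sym2Map)) : c ≤ permAverage f M := by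
  have hpos : (0 : ℝ) < Fintype.card (Equiv.Perm H) := by exact_mod_cast Fintype.card_pos
  rw [permAverage, le_div_iff₀ hpos]
  calc c * Fintype.card (Equiv.Perm H) = ∑ _g : Equiv.Perm H, c := by
        simp [Finset.card_univ, mul_comm]
    _ ≤ _ := Finset.sum_le_sum fun g _ => h g

lemma permAverage_le {f : Finset (Sym2 H) → ℝ} {M : Finset (Sym2 H)} {c : ℝ}
    (h : ∀ g : Equiv.Perm H, f (M.map g.toEmbedding.sym2Map) ≤ c) : permAverage f M ≤ c := by
  have hpos : (0 : ℝ) < Fintype.card (Equiv.Perm H) := by exact_mod_cast Fintype.card_pos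
  rw [permAverage, div_le_iff₀ hpos]
  calc ∑ g : Equiv.Perm H, f (M.map g.toEmbedding.sym2Map) ≤ ∑ _g : Equiv.Perm H, c :=
        Finset.sum_le_sum fun g _ => h g
    _ = _ := by simp [Finset.card_univ, mul_comm]

lemma IsCompleteMatching.map {M : Finset (Sym2 H)} (hM : IsCompleteMatching M)
    (g : Equiv.Perm H) : IsCompleteMatching (M.map g.toEmbedding.sym2Map) :=
  ⟨hM.1.map _, by rw [Finset.card_map]; exact hM.2⟩

/-- The expected hybrid bisection of the graph of a uniformly random complete matching. -/
noncomputable def expectedCut {V : Type*} [Fintype V] (p : ℝ) (v : H → V) : ℝ :=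
  permAverage (hybridCut p v) (exists_isCompleteMatching H).choose

lemma expectedCut_eq {V : Type*} [Fintype V] (p : ℝ) (v : H → V) {M : Finset (Sym2 H)}
    (hM : IsCompleteMatching M) : expectedCut p v = permAverage (hybridCut p v) M :=
  permAverage_eq_of_isCompleteMatching _ (exists_isCompleteMatching H).choose_spec hM

/-- The expected hybrid bisection is superadditive up to an error of smaller order. -/
lemma expectedCut_add_le {V V' : Type*} [Fintype V] [Fintype V'] {p : ℝ} (hp : 1 / 2 ≤ p)
    (hp' : p ≤ 1) (v : A → V) (v' : B → V') {m : ℕ} (hm : 1 ≤ m) :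
    expectedCut p v + expectedCut p v' -
      (3 * m + 4 * (Fintype.card A + Fintype.card B) ^ 2 / m ^ 2) ≤
        expectedCut p (Sum.map v v') := by
  obtain ⟨MA, hMA⟩ := exists_isCompleteMatching A
  obtain ⟨MB, hMB⟩ := exists_isCompleteMatching B
  obtain ⟨M, hM⟩ := exists_isCompleteMatching (A ⊕ B)
  have hc := edgeConcave_hybridCut hp hp' (Sum.map v v')
  rw [expectedCut_eq p v hMA, expectedCut_eq p v' hMB, expectedCut_eq p _ hM,
    ← permAverage_sideAverage]
  -- Each image of `M` is again a complete matching, so the interpolation bound for the side average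
  -- applies to every term.
  refine le_permAverage fun g => le_trans ?_ ((sideInvariant_sideAverage _).pairSum_sub_le
    hc.sideAverage hMA hMB (hM.map g) hm)
  refine sub_le_sub_right ?_ _
  have hA : (0 : ℝ) < Fintype.card (Equiv.Perm A) := by exact_mod_cast Fintype.card_pos
  have hB : (0 : ℝ) < Fintype.card (Equiv.Perm B) := by exact_mod_cast Fintype.card_pos
  rw [sideAverage, permAverage, permAverage, Fintype.card_prod, Nat.cast_mul,
    le_div_iff₀ (by positivity)]
  calc _ = ∑ g : Equiv.Perm A × Equiv.Perm B, (hybridCut p v (MA.map g.1.toEmbedding.sym2Map) +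
        hybridCut p v' (MB.map g.2.toEmbedding.sym2Map)) := by
        rw [Fintype.sum_prod_type]
        simp only [Finset.sum_add_distrib, Finset.sum_const, Finset.card_univ, nsmul_eq_mul,
          ← Finset.mul_sum]
        field_simp
    _ ≤ _ := Finset.sum_le_sum fun g _ => by
        rw [map_pairSum]
        exact hybridCut_pairSum (by linarith) hp' v v' _ _

/-- Removing all crossing pairs frees that many half-edges on the right. -/
lemma crossCount_le_card {M : Finset (Sym2 (A ⊕ B))} (hM : IsMatching M) :
    crossCount M ≤ Fintype.card B := by
  obtain ⟨M', -, -, -, h⟩ := exists_subset_of_le_crossCount hM _ le_rfl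
  have := Finset.card_le_univ (freeRight M')
  omega

lemma sideAverage_pairSum_empty {V : Type*} [Fintype V] (p : ℝ) (v : A → V) (u : B → V)
    (MA : Finset (Sym2 A)) :
    sideAverage (hybridCut p (Sum.elim v u)) (pairSum MA ∅) = permAverage (hybridCut p v) MA := by
  have hA : (0 : ℝ) < Fintype.card (Equiv.Perm A) := by exact_mod_cast Fintype.card_pos
  have hB : (0 : ℝ) < Fintype.card (Equiv.Perm B) := by exact_mod_cast Fintype.card_pos
  have key : ∀ g : Equiv.Perm A × Equiv.Perm B,
      hybridCut p (Sum.elim v u) ((pairSum MA ∅).map (sumPerm g).toEmbedding.sym2Map) =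
        hybridCut p v (MA.map g.1.toEmbedding.sym2Map) := by
    intro g
    rw [map_pairSum, pairSum, Finset.map_empty, Finset.map_empty, Finset.union_empty,
      hybridCut_map]
    rfl
  simp only [sideAverage, key, permAverage, Fintype.sum_prod_type, Finset.sum_const,
    Finset.card_univ, nsmul_eq_mul, Fintype.card_prod, ← Finset.mul_sum, Nat.cast_mul]
  field_simp

/-- The expected hybrid bisection is Lipschitz continuous in the set of half-edges. -/
lemma abs_expectedCut_sumElim_sub_le {V : Type*} [Fintype V] {p : ℝ} (hp : 1 / 2 ≤ p)
    (hp' : p ≤ 1) (v : A → V) (u : B → V) :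
    |expectedCut p (Sum.elim v u) - expectedCut p v| ≤ 3 * Fintype.card B + 1 := by
  obtain ⟨MA, hMA⟩ := exists_isCompleteMatching A
  obtain ⟨MB, hMB⟩ := exists_isCompleteMatching B
  obtain ⟨M, hM⟩ := exists_isCompleteMatching (A ⊕ B)
  have hc := (edgeConcave_hybridCut hp hp' (Sum.elim v u)).sideAverage
  rw [expectedCut_eq p v hMA, expectedCut_eq p _ hM, ← permAverage_sideAverage,
    ← sideAverage_pairSum_empty p v u MA]
  -- `pairSum MA MB` is the intermediate point: discarding `MB` costs at most `Fintype.card B`, and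
  -- passing to a complete matching of everything costs at most `2 * Fintype.card B + 1`, since each
  -- crossing pair uses a half-edge of `B`.
  have h1 := abs_le.1 (hc.abs_sub_le (pairSum_mono subset_rfl (Finset.empty_subset MB))
    (isMatching_pairSum_iff.2 ⟨hMA.1, hMB.1⟩).1)
  have h2 : ((pairSum MA MB).card : ℝ) - (pairSum MA (∅ : Finset (Sym2 B))).card ≤
      Fintype.card B := by
    rw [card_pairSum, card_pairSum]
    have := card_le_half hMB.1
    have h0 : (0 : ℝ) ≤ Fintype.card B := by positivity
    push_cast
    simp only [Finset.card_empty, Nat.cast_zero]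
    linarith
  have key : ∀ g : Equiv.Perm (A ⊕ B),
      |sideAverage (hybridCut p (Sum.elim v u)) (M.map g.toEmbedding.sym2Map) -
        sideAverage (hybridCut p (Sum.elim v u)) (pairSum MA MB)| ≤
          2 * Fintype.card B + 1 := by
    intro g
    have hg := hM.map g
    refine ((sideInvariant_sideAverage _).abs_sub_pairSum_le hc hg.1 hMA hMB).trans ?_
    have h3 : (crossCount (M.map g.toEmbedding.sym2Map) : ℝ) ≤ Fintype.card B := by
      exact_mod_cast crossCount_le_card hg.1
    have h4 := hg.2
    rw [Fintype.card_sum] at h4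
    have h5 : (Fintype.card A + Fintype.card B : ℝ) ≤
        2 * (M.map g.toEmbedding.sym2Map).card + 1 := by
      exact_mod_cast (show Fintype.card A + Fintype.card B ≤
        2 * (M.map g.toEmbedding.sym2Map).card + 1 by omega)
    linarith
  rw [abs_le]
  constructor
  · rw [neg_le_sub_iff_le_add, ← sub_le_iff_le_add]
    refine le_permAverage fun g => ?_
    have := abs_le.1 (key g)
    linarith
  · rw [sub_le_iff_le_add]
    refine permAverage_le fun g => ?_
    have := abs_le.1 (key g)
    linarith

lemma abs_expectedCut_le {V : Type*} [Fintype V] {p : ℝ} (hp : 1 / 2 ≤ p) (hp' : p ≤ 1)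
    (v : H → V) : |expectedCut p v| ≤ Fintype.card H := by
  obtain ⟨M, hM⟩ := exists_isCompleteMatching H
  have hc := edgeConcave_hybridCut hp hp' v
  have key : ∀ g : Equiv.Perm H, |hybridCut p v (M.map g.toEmbedding.sym2Map)| ≤
      Fintype.card H := by
    intro g
    have h1 := hc.abs_sub_le (Finset.empty_subset _) (hM.map g).1.1
    have h2 := card_le_half (hM.map g).1
    rw [hybridCut_empty, sub_zero, Finset.card_empty, Nat.cast_zero, sub_zero] at h1
    have h0 : (0 : ℝ) ≤ Fintype.card H := by positivity
    linarith
  rw [expectedCut_eq p v hM, abs_le]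
  exact ⟨le_permAverage fun g => (abs_le.1 (key g)).1, permAverage_le fun g => (abs_le.1 (key g)).2⟩

lemma expectedCut_congr {H' V V' : Type*} [Fintype H'] [Fintype V] [Fintype V'] (p : ℝ)
    {v : H → V} {v' : H' → V'} (e : H ≃ H') (θ : V ≃ V') (h : v' ∘ e = θ ∘ v) :
    expectedCut p v = expectedCut p v' := by
  obtain ⟨M, hM⟩ := exists_isCompleteMatching H
  have hM' : IsCompleteMatching (M.map e.toEmbedding.sym2Map) :=
    ⟨hM.1.map _, by rw [Finset.card_map, hM.2, Fintype.card_congr e]⟩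
  rw [expectedCut_eq p v hM, expectedCut_eq p v' hM', permAverage, permAverage,
    Fintype.card_congr e.permCongr]
  congr 1
  refine Fintype.sum_equiv e.permCongr _ _ fun g => ?_
  rw [map_sym2Map_trans, ← hybridCut_comp_equiv p θ v, ← h]
  have : e.toEmbedding.trans (e.permCongr g).toEmbedding = g.toEmbedding.trans e.toEmbedding := by
    ext x
    simp [Equiv.permCongr_apply]
  rw [this, ← map_sym2Map_trans]
  exact (hybridCut_map p e.toEmbedding v' _).symm

end Averages

/-! ### Inequalities for the exponent 2/3 -/

section Powers

/-- Strict concavity with a definite gain for comparable arguments. With `u`, `v` the cube roots of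
`x`, `y`, the cube of the right side is at least `x ^ 2 + y ^ 2 + 6 * (x * y)`, and comparability
bounds `x * y` from below by `2 / 9 * (x + y) ^ 2`. -/
lemma six_fifths_mul_rpow_le {x y : ℝ} (hx : 0 < x) (hy : 0 < y) (hxy : y ≤ 2 * x)
    (hyx : x ≤ 2 * y) :
    6 / 5 * (x + y) ^ (2 / 3 : ℝ) ≤ x ^ (2 / 3 : ℝ) + y ^ (2 / 3 : ℝ) := by
  have key : ∀ z : ℝ, 0 < z → ∃ u : ℝ, 0 < u ∧ z = u ^ 3 ∧ z ^ (2 / 3 : ℝ) = u ^ 2 := by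
    intro z hz
    refine ⟨z ^ (1 / 3 : ℝ), Real.rpow_pos_of_pos hz _, ?_, ?_⟩
    · rw [← Real.rpow_natCast, ← Real.rpow_mul hz.le]; norm_num
    · rw [← Real.rpow_natCast, ← Real.rpow_mul hz.le]; norm_num
  obtain ⟨u, hu, hxu, hu2⟩ := key x hx
  obtain ⟨v, hv, hyv, hv2⟩ := key y hy
  obtain ⟨w, hw, hxyw, hw2⟩ := key (x + y) (by linarith)
  rw [hu2, hv2, hw2]
  refine le_of_pow_le_pow_left₀ (n := 3) (by norm_num) (by positivity) ?_
  have h1 : (6 / 5 * w ^ 2) ^ 3 = 216 / 125 * (x + y) ^ 2 := by rw [hxyw]; ring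
  have h2 : (u ^ 2 + v ^ 2) ^ 3 = x ^ 2 + y ^ 2 + 6 * (x * y) +
      3 * (u ^ 2 * v ^ 2) * (u - v) ^ 2 := by rw [hxu, hyv]; ring
  have h3 : 0 ≤ 3 * (u ^ 2 * v ^ 2) * (u - v) ^ 2 := by positivity
  have h4 : 0 ≤ (2 * x - y) * (2 * y - x) := mul_nonneg (by linarith) (by linarith)
  rw [h1, h2]
  nlinarith [mul_pos hx hy]

/-- The two error terms balance at `m` equal to `N ^ (2 / 3)`, rounded up. -/
lemma exists_nat_error_le {N : ℝ} (hN : 1 ≤ N) :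
    ∃ m : ℕ, 1 ≤ m ∧ 3 * (m : ℝ) + 4 * N ^ 2 / m ^ 2 ≤ 10 * N ^ (2 / 3 : ℝ) := by
  have hN0 : 0 < N := by linarith
  set r := N ^ (2 / 3 : ℝ) with hr
  have hr1 : 1 ≤ r := Real.one_le_rpow hN (by norm_num)
  have hr3 : N ^ 2 = r ^ 3 := by
    rw [hr, ← Real.rpow_natCast, ← Real.rpow_natCast, ← Real.rpow_mul hN0.le]; norm_num
  have h1 : r ≤ ⌈r⌉₊ := Nat.le_ceil r
  have h2 : (⌈r⌉₊ : ℝ) < r + 1 := Nat.ceil_lt_add_one (by linarith)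
  refine ⟨⌈r⌉₊, Nat.one_le_ceil_iff.2 (by linarith), ?_⟩
  have h3 : 4 * N ^ 2 / (⌈r⌉₊ : ℝ) ^ 2 ≤ 4 * r := by
    rw [div_le_iff₀ (by positivity), hr3]
    have : r ^ 2 ≤ (⌈r⌉₊ : ℝ) ^ 2 := by gcongr
    nlinarith
  linarith

end Powers

/-! ### Dependence on the degree function; copies of a degree function -/

section Degrees

variable {V V' : Type*} [Fintype V] [Fintype V']

/-- The expected hybrid bisection of the configuration model with degrees `d`. -/
noncomputable def degreeCut (p : ℝ) (d : V → ℕ) : ℝ :=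
  expectedCut p (Sigma.fst : HalfEdge d → V)

lemma card_halfEdge (d : V → ℕ) : Fintype.card (HalfEdge d) = ∑ i, d i := by
  simp [HalfEdge]

lemma abs_degreeCut_le {p : ℝ} (hp : 1 / 2 ≤ p) (hp' : p ≤ 1) (d : V → ℕ) :
    |degreeCut p d| ≤ ∑ i, (d i : ℝ) := by
  have := abs_expectedCut_le hp hp' (Sigma.fst : HalfEdge d → V)
  rw [card_halfEdge] at this
  exact_mod_cast this

lemma degreeCut_comp_equiv (p : ℝ) (d : V' → ℕ) (θ : V ≃ V') :
    degreeCut p (d ∘ θ) = degreeCut p d :=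
  expectedCut_congr p (Equiv.sigmaCongrLeft (β := fun i => Fin (d i)) θ) θ rfl

lemma degreeCut_sumElim (p : ℝ) (d : V → ℕ) (d' : V' → ℕ) :
    degreeCut p (Sum.elim d d') =
      expectedCut p (Sum.map (Sigma.fst : HalfEdge d → V) (Sigma.fst : HalfEdge d' → V')) := by
  refine expectedCut_congr p (Equiv.sumSigmaDistrib fun i => Fin (Sum.elim d d' i))
    (Equiv.refl _) ?_
  ext ⟨i, x⟩
  rcases i with i | i <;> rfl

lemma degreeCut_add_le {p : ℝ} (hp : 1 / 2 ≤ p) (hp' : p ≤ 1) (d : V → ℕ) (d' : V' → ℕ) :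
    degreeCut p d + degreeCut p d' -
      10 * (∑ i, (d i : ℝ) + ∑ i, (d' i : ℝ)) ^ (2 / 3 : ℝ) ≤ degreeCut p (Sum.elim d d') := by
  have hN : (Fintype.card (HalfEdge d) + Fintype.card (HalfEdge d') : ℝ) =
      ∑ i, (d i : ℝ) + ∑ i, (d' i : ℝ) := by
    rw [card_halfEdge, card_halfEdge]; push_cast; rfl
  rcases Nat.eq_zero_or_pos (Fintype.card (HalfEdge d) + Fintype.card (HalfEdge d')) with h | h
  · have h0 : ∑ i, (d i : ℝ) + ∑ i, (d' i : ℝ) = 0 := by rw [← hN]; exact_mod_cast h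
    have h1 : 0 ≤ ∑ i, (d i : ℝ) := Finset.sum_nonneg fun i _ => by positivity
    have h2 : 0 ≤ ∑ i, (d' i : ℝ) := Finset.sum_nonneg fun i _ => by positivity
    have h3 := abs_le.1 (abs_degreeCut_le hp hp' d)
    have h4 := abs_le.1 (abs_degreeCut_le hp hp' d')
    have h5 := abs_le.1 (abs_degreeCut_le hp hp' (Sum.elim d d'))
    rw [Fintype.sum_sum_type] at h5
    simp only [Sum.elim_inl, Sum.elim_inr] at h5
    rw [h0, Real.zero_rpow (by norm_num)]
    linarith
  · have h1 : (1 : ℝ) ≤ ∑ i, (d i : ℝ) + ∑ i, (d' i : ℝ) := by rw [← hN]; exact_mod_cast h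
    obtain ⟨m, hm, hm'⟩ := exists_nat_error_le h1
    have := expectedCut_add_le hp hp' (Sigma.fst : HalfEdge d → V) (Sigma.fst : HalfEdge d' → V') hm
    rw [hN, ← degreeCut_sumElim] at this
    unfold degreeCut at *
    linarith

lemma abs_degreeCut_sub_le_of_le {p : ℝ} (hp : 1 / 2 ≤ p) (hp' : p ≤ 1) {d d' : V → ℕ}
    (h : d' ≤ d) : |degreeCut p d - degreeCut p d'| ≤ 3 * ∑ i, ((d i : ℝ) - d' i) + 1 := by
  have e : ∀ i, Fin (d i) ≃ Fin (d' i) ⊕ Fin (d i - d' i) := fun i =>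
    (finCongr (by have : d' i ≤ d i := h i; omega)).trans finSumFinEquiv.symm
  have h1 : degreeCut p d = expectedCut p (Sum.elim (Sigma.fst : HalfEdge d' → V)
      (Sigma.fst : HalfEdge (fun i => d i - d' i) → V)) := by
    refine expectedCut_congr p ((Equiv.sigmaCongrRight e).trans (Equiv.sigmaSumDistrib _ _))
      (Equiv.refl _) ?_
    ext ⟨i, x⟩
    simp only [Function.comp_apply, Equiv.trans_apply, Equiv.sigmaCongrRight_apply,
      Equiv.sigmaSumDistrib_apply, Equiv.refl_apply]
    rcases e i x with y | y <;> rfl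
  have h2 := abs_expectedCut_sumElim_sub_le hp hp' (Sigma.fst : HalfEdge d' → V)
    (Sigma.fst : HalfEdge (fun i => d i - d' i) → V)
  have h3 : ((∑ i, (d i - d' i) : ℕ) : ℝ) = ∑ i, ((d i : ℝ) - d' i) := by
    push_cast
    exact Finset.sum_congr rfl fun i _ => Nat.cast_sub (h i)
  rw [← h1, card_halfEdge, h3] at h2
  exact h2

/-- The number of vertices of degree `k`. -/
noncomputable def degreeCount (d : V → ℕ) (k : ℕ) : ℕ := (Finset.univ.filter fun i => d i = k).card

lemma sum_degreeCount (d : V → ℕ) {K : ℕ} (hd : ∀ i, d i < K) :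
    ∑ k ∈ Finset.range K, degreeCount d k = Fintype.card V :=
  (Finset.card_eq_sum_card_fiberwise fun i _ => Finset.mem_range.2 (hd i)).symm

/-- Equal vertex numbers force the counts of degree 0 to agree as well. Leaving degree 0 out of the
hypothesis matters because erasing the half-edges of a vertex turns it into an isolated one. -/
lemma exists_equiv_of_degreeCount_eq {d : V → ℕ} {d' : V' → ℕ}
    (hVV : Fintype.card V = Fintype.card V') {K : ℕ} (hd : ∀ i, d i < K) (hd' : ∀ i, d' i < K)
    (h : ∀ k, k ≠ 0 → degreeCount d k = degreeCount d' k) : ∃ θ : V ≃ V', d' ∘ θ = d := by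
  have h0 : degreeCount d 0 = degreeCount d' 0 := by
    rcases Nat.eq_zero_or_pos K with rfl | hK
    · have h1 : IsEmpty V := ⟨fun i => absurd (hd i) (by omega)⟩
      have h2 : IsEmpty V' := ⟨fun i => absurd (hd' i) (by omega)⟩
      simp [degreeCount]
    · have h1 := sum_degreeCount d hd
      have h2 := sum_degreeCount d' hd'
      rw [← Finset.add_sum_erase _ _ (Finset.mem_range.2 hK)] at h1 h2
      have h3 : ∑ k ∈ (Finset.range K).erase 0, degreeCount d k =
          ∑ k ∈ (Finset.range K).erase 0, degreeCount d' k :=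
        Finset.sum_congr rfl fun k hk => h k (Finset.ne_of_mem_erase hk)
      omega
  have h' : ∀ k, degreeCount d k = degreeCount d' k := fun k => by
    by_cases hk : k = 0
    · rw [hk, h0]
    · exact h k hk
  refine ⟨Equiv.ofFiberEquiv (f := d) (g := d') fun k => Fintype.equivOfCardEq ?_, ?_⟩
  · rw [Fintype.card_subtype, Fintype.card_subtype]
    exact h' k
  · ext i
    exact Equiv.ofFiberEquiv_map _ i

/-- Erasing all but prescribed numbers of vertices of each degree. -/
lemma exists_le_degreeCount_eq (d : V → ℕ) (c : ℕ → ℕ) (hc : ∀ k, c k ≤ degreeCount d k) {K : ℕ}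
    (hd : ∀ i, d i < K) :
    ∃ d₀ : V → ℕ, d₀ ≤ d ∧ (∀ k, k ≠ 0 → degreeCount d₀ k = c k) ∧
      ∑ i, ((d i : ℝ) - d₀ i) = ∑ k ∈ Finset.range K, (k : ℝ) * (degreeCount d k - c k) := by
  choose S hS hSc using fun k => Finset.exists_subset_card_eq (hc k)
  have hmem : ∀ {k i}, i ∈ S k → d i = k := fun h => (Finset.mem_filter.1 (hS _ h)).2
  refine ⟨fun i => if i ∈ S (d i) then d i else 0, ?_, ?_, ?_⟩
  · intro i
    dsimp only
    split_ifs <;> simp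
  · intro k hk
    rw [← hSc k, degreeCount]
    congr 1
    ext i
    simp only [Finset.mem_filter, Finset.mem_univ, true_and]
    constructor
    · intro h
      split_ifs at h with h1
      · rwa [h] at h1
      · exact absurd h.symm hk
    · intro h
      rw [hmem h, if_pos h]
  · rw [← Finset.sum_fiberwise_of_maps_to (s := Finset.univ) (t := Finset.range K) (g := d)
      fun i _ => Finset.mem_range.2 (hd i)]
    refine Finset.sum_congr rfl fun k _ => ?_
    have h1 : ∀ i ∈ Finset.univ.filter (fun i => d i = k),
        ((d i : ℝ) - ((if i ∈ S (d i) then d i else 0 : ℕ) : ℝ)) =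
          k - if i ∈ S k then (k : ℝ) else 0 := by
      intro i hi
      rw [(Finset.mem_filter.1 hi).2]
      split_ifs <;> simp
    rw [Finset.sum_congr rfl h1, Finset.sum_sub_distrib, Finset.sum_ite_mem,
      Finset.inter_eq_right.2 (hS k), Finset.sum_const, Finset.sum_const, hSc]
    simp only [nsmul_eq_mul, degreeCount]
    ring

/-- Both degree functions are reduced to a common one, with the minimum of the two counts in every
positive degree, by emptying surplus vertices. The half-edges lost in total are exactly the weighted
distance of the counts. -/
lemma abs_degreeCut_sub_le {p : ℝ} (hp : 1 / 2 ≤ p) (hp' : p ≤ 1) {d : V → ℕ} {d' : V' → ℕ}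
    (hVV : Fintype.card V = Fintype.card V') {K : ℕ} (hd : ∀ i, d i < K) (hd' : ∀ i, d' i < K) :
    |degreeCut p d - degreeCut p d'| ≤
      3 * ∑ k ∈ Finset.range K, (k : ℝ) * |(degreeCount d k : ℝ) - degreeCount d' k| + 2 := by
  obtain ⟨e, he, hec, hes⟩ := exists_le_degreeCount_eq d
    (fun k => min (degreeCount d k) (degreeCount d' k)) (fun _ => min_le_left _ _) hd
  obtain ⟨e', he', hec', hes'⟩ := exists_le_degreeCount_eq d'
    (fun k => min (degreeCount d k) (degreeCount d' k)) (fun _ => min_le_right _ _) hd'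
  obtain ⟨θ, hθ⟩ := exists_equiv_of_degreeCount_eq hVV (fun i => (he i).trans_lt (hd i))
    (fun i => (he' i).trans_lt (hd' i)) fun k hk => (hec k hk).trans (hec' k hk).symm
  have h1 := abs_le.1 (abs_degreeCut_sub_le_of_le hp hp' he)
  have h2 := abs_le.1 (abs_degreeCut_sub_le_of_le hp hp' he')
  have h3 := degreeCut_comp_equiv p e' θ
  rw [hθ] at h3
  have h4 : ∑ k ∈ Finset.range K, (k : ℝ) * |(degreeCount d k : ℝ) - degreeCount d' k| =
      ∑ i, ((d i : ℝ) - e i) + ∑ i, ((d' i : ℝ) - e' i) := by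
    rw [hes, hes', ← Finset.sum_add_distrib]
    refine Finset.sum_congr rfl fun k _ => ?_
    rw [← mul_add]
    congr 1
    push_cast
    rcases le_total (degreeCount d k : ℝ) (degreeCount d' k) with h | h
    · rw [min_eq_left h, abs_of_nonpos (by linarith)]; ring
    · rw [min_eq_right h, abs_of_nonneg (by linarith)]; ring
  rw [h4, abs_le]
  constructor <;> linarith

lemma degreeCut_copies_add_le {p : ℝ} (hp : 1 / 2 ≤ p) (hp' : p ≤ 1) (d : V → ℕ) (k l : ℕ) :
    degreeCut p (fun i : Fin k × V => d i.2) + degreeCut p (fun i : Fin l × V => d i.2) -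
      10 * ((k + l : ℝ) ^ (2 / 3 : ℝ) * (∑ i, (d i : ℝ)) ^ (2 / 3 : ℝ)) ≤
        degreeCut p (fun i : Fin (k + l) × V => d i.2) := by
  have h := degreeCut_add_le hp hp' (fun i : Fin k × V => d i.2) (fun i : Fin l × V => d i.2)
  have h1 : degreeCut p (Sum.elim (fun i : Fin k × V => d i.2) (fun i : Fin l × V => d i.2)) =
      degreeCut p (fun i : Fin (k + l) × V => d i.2) := by
    rw [← degreeCut_comp_equiv p (fun i : Fin (k + l) × V => d i.2)
      ((Equiv.sumProdDistrib _ _ V).symm.trans (Equiv.prodCongr finSumFinEquiv (Equiv.refl V)))]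
    congr 1
    ext i
    rcases i with i | i <;> rfl
  have h2 : ∀ k : ℕ, ∑ i : Fin k × V, (d i.2 : ℝ) = k * ∑ i, (d i : ℝ) := by
    intro k
    rw [Fintype.sum_prod_type]
    simp
  rw [h1, h2, h2, ← add_mul, Real.mul_rpow (by positivity)
    (Finset.sum_nonneg fun i _ => by positivity)] at h
  exact h

/-- Induction by halving. The extra term in `k ^ (2 / 3)` strengthens the claim so that it absorbs
the error of each merge: a merge of comparable parts multiplies it by at least 6/5, and `6 / 5 * 50
- 10 = 50`. -/
lemma degreeCut_copies_ge {p : ℝ} (hp : 1 / 2 ≤ p) (hp' : p ≤ 1) (d : V → ℕ) (k : ℕ)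
    (hk : 1 ≤ k) :
    k * (degreeCut p d - 50 * (∑ i, (d i : ℝ)) ^ (2 / 3 : ℝ)) +
      50 * ((k : ℝ) ^ (2 / 3 : ℝ) * (∑ i, (d i : ℝ)) ^ (2 / 3 : ℝ)) ≤
        degreeCut p (fun i : Fin k × V => d i.2) := by
  have ht : 0 ≤ (∑ i, (d i : ℝ)) ^ (2 / 3 : ℝ) :=
    Real.rpow_nonneg (Finset.sum_nonneg fun i _ => by positivity) _
  induction k using Nat.strong_induction_on with
  | _ k ih =>
    rcases Nat.lt_or_ge k 2 with h | h
    · obtain rfl : k = 1 := by omega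
      have h1 : degreeCut p (fun i : Fin 1 × V => d i.2) = degreeCut p d :=
        degreeCut_comp_equiv p d (Equiv.uniqueProd V (Fin 1))
      rw [h1]
      simp
    · obtain ⟨a, b, ha, hb, hab, hba, rfl⟩ : ∃ a b, 1 ≤ a ∧ 1 ≤ b ∧ a ≤ 2 * b ∧ b ≤ 2 * a ∧
          k = a + b := ⟨k / 2, k - k / 2, by omega, by omega, by omega, by omega, by omega⟩
      have h1 := ih a (by omega) ha
      have h2 := ih b (by omega) hb
      have h3 := degreeCut_copies_add_le hp hp' d a b
      have h4 := six_fifths_mul_rpow_le (x := a) (y := b) (by exact_mod_cast ha)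
        (by exact_mod_cast hb) (by exact_mod_cast hba) (by exact_mod_cast hab)
      generalize (∑ i, (d i : ℝ)) ^ (2 / 3 : ℝ) = t at *
      have h5 := mul_le_mul_of_nonneg_right h4 ht
      push_cast
      nlinarith

/-- Adding isolated vertices is one more merge; its error is covered by the spare term of
`degreeCut_copies_ge`. -/
lemma degreeCut_copies_isolated_ge {p : ℝ} (hp : 1 / 2 ≤ p) (hp' : p ≤ 1) (d : V → ℕ) (k r : ℕ) :
    k * (degreeCut p d - 50 * (∑ i, (d i : ℝ)) ^ (2 / 3 : ℝ)) ≤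
      degreeCut p (Sum.elim (fun i : Fin k × V => d i.2) fun _ : Fin r => 0) := by
  have h0 : 0 ≤ ∑ i, (d i : ℝ) := Finset.sum_nonneg fun i _ => by positivity
  have ht : 0 ≤ (∑ i, (d i : ℝ)) ^ (2 / 3 : ℝ) := Real.rpow_nonneg h0 _
  rcases Nat.eq_zero_or_pos k with rfl | hk
  · have h := (abs_le.1 (abs_degreeCut_le hp hp'
      (Sum.elim (fun i : Fin 0 × V => d i.2) fun _ : Fin r => 0))).1
    rw [Fintype.sum_sum_type] at h
    simpa using h
  have h := degreeCut_add_le hp hp' (fun i : Fin k × V => d i.2) (fun _ : Fin r => 0)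
  have h1 := (abs_le.1 (abs_degreeCut_le hp hp' (fun _ : Fin r => 0))).1
  have h2 : ∑ i : Fin k × V, (d i.2 : ℝ) = k * ∑ i, (d i : ℝ) := by
    rw [Fintype.sum_prod_type]
    simp
  have h3 := degreeCut_copies_ge hp hp' d k hk
  simp only [h2, Nat.cast_zero, Finset.sum_const_zero, add_zero, neg_zero] at h h1
  rw [Real.mul_rpow (by positivity) h0] at h
  have h4 : 0 ≤ (k : ℝ) ^ (2 / 3 : ℝ) * (∑ i, (d i : ℝ)) ^ (2 / 3 : ℝ) := by positivity
  linarith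

end Degrees

/-! ### Convergence of the scaled expectation -/

section Limits

/-- Scheffé's argument: |a - b| = (a - b) + 2 max(b - a, 0), where the first part sums to a null
sequence by hypothesis and the second is dominated by the summable `b`. -/
lemma tendsto_tsum_abs_sub {a : ℕ → ℕ → ℝ} {b : ℕ → ℝ} (ha : ∀ n k, 0 ≤ a n k)
    (hb : ∀ k, 0 ≤ b k) (has : ∀ n, Summable (a n)) (hbs : Summable b)
    (hab : ∀ k, Tendsto (fun n => a n k) atTop (𝓝 (b k)))
    (hsum : Tendsto (fun n => ∑' k, a n k) atTop (𝓝 (∑' k, b k))) :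
    Tendsto (fun n => ∑' k, |a n k - b k|) atTop (𝓝 0) := by
  have hle : ∀ n k, max (b k - a n k) 0 ≤ b k := fun n k => by
    rw [max_le_iff]; exact ⟨by linarith [ha n k], hb k⟩
  have hms : ∀ n, Summable fun k => max (b k - a n k) 0 := fun n =>
    Summable.of_nonneg_of_le (fun k => le_max_right _ _) (hle n) hbs
  have h1 : Tendsto (fun n => ∑' k, max (b k - a n k) 0) atTop (𝓝 (∑' _k : ℕ, (0 : ℝ))) := by
    refine tendsto_tsum_of_dominated_convergence hbs (fun k => ?_) (Eventually.of_forall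
      fun n k => ?_)
    · have := ((tendsto_const_nhds (x := b k)).sub (hab k)).max (tendsto_const_nhds (x := (0 : ℝ)))
      simpa using this
    · rw [Real.norm_of_nonneg (le_max_right _ _)]
      exact hle n k
  have h2 : (fun n => ∑' k, |a n k - b k|) =
      fun n => ∑' k, a n k - ∑' k, b k + 2 * ∑' k, max (b k - a n k) 0 := by
    funext n
    rw [← (has n).tsum_sub hbs, ← tsum_mul_left, ← ((has n).sub hbs).tsum_add ((hms n).mul_left 2)]
    refine tsum_congr fun k => ?_
    rcases le_total (b k) (a n k) with h | h
    · rw [max_eq_right (by linarith), abs_of_nonneg (by linarith)]; ring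
    · rw [max_eq_left (by linarith), abs_of_nonpos (by linarith)]; ring
  rw [h2]
  have := (hsum.sub_const (∑' k, b k)).add (h1.const_mul 2)
  simpa using this

/-- The hypothesis gives `x n - e n ≤ liminf x` for large `n`, so the limsup does not exceed the
liminf. -/
lemma exists_tendsto_of_eventually_le {x e : ℕ → ℝ}
    (hx : IsBoundedUnder (· ≤ ·) atTop fun n => |x n|) (he : Tendsto e atTop (𝓝 0))
    (h : ∀ᶠ n in atTop, ∀ ε > 0, ∀ᶠ N in atTop, x n - e n - ε ≤ x N) :
    ∃ L, Tendsto x atTop (𝓝 L) := by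
  obtain ⟨hx1, hx2⟩ := isBoundedUnder_le_abs.1 hx
  refine ⟨liminf x atTop, tendsto_order.2 ⟨fun a ha => eventually_lt_of_lt_liminf ha hx2,
    fun a ha => ?_⟩⟩
  have h1 : ∀ᶠ n in atTop, e n < a - liminf x atTop :=
    (tendsto_order.1 he).2 _ (by linarith)
  filter_upwards [h, h1] with n hn hn1
  have h2 : x n - e n ≤ liminf x atTop := by
    refine le_of_forall_pos_le_add fun ε hε => ?_
    have := le_liminf_of_le hx1.isCoboundedUnder_ge (hn ε hε)
    linarith
  linarith

lemma sum_mul_degreeCount {V : Type*} [Fintype V] (d : V → ℕ) {K : ℕ} (hd : ∀ i, d i < K) :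
    ∑ k ∈ Finset.range K, (k : ℝ) * degreeCount d k = ∑ i, (d i : ℝ) := by
  rw [← Finset.sum_fiberwise_of_maps_to (s := Finset.univ) (t := Finset.range K) (g := d)
      fun i _ => Finset.mem_range.2 (hd i)]
  refine Finset.sum_congr rfl fun k _ => ?_
  rw [Finset.sum_congr rfl fun i hi => by rw [(Finset.mem_filter.1 hi).2], Finset.sum_const,
    nsmul_eq_mul, mul_comm]
  rfl

lemma exists_forall_lt {V : Type*} [Fintype V] (d : V → ℕ) : ∃ K, ∀ i, d i < K :=
  ⟨∑ i, d i + 1, fun i => Nat.lt_succ_of_le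
    (Finset.single_le_sum (f := d) (fun _ _ => Nat.zero_le _) (Finset.mem_univ i))⟩

lemma degreeCount_eq_zero {V : Type*} [Fintype V] {d : V → ℕ} {K k : ℕ} (hd : ∀ i, d i < K)
    (hk : K ≤ k) : degreeCount d k = 0 := by
  rw [degreeCount, Finset.card_eq_zero, Finset.filter_eq_empty_iff]
  intro i _ h
  have := hd i
  omega

/-- The weighted distance between the degree distribution of `d` and `μ`. -/
noncomputable def degreeDist (μ : PMF ℕ) {n : ℕ} (d : Fin n → ℕ) : ℝ :=
  ∑' k : ℕ, |(k : ℝ) * (1 / (n : ℝ) * degreeCount d k) - k * (μ k).toReal|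

variable {μ : PMF ℕ} {d : (n : ℕ) → Fin n → ℕ}

lemma hasSum_mul_degreeCount {n : ℕ} (d : Fin n → ℕ) :
    HasSum (fun k : ℕ => (k : ℝ) * (1 / (n : ℝ) * degreeCount d k))
      (1 / (n : ℝ) * ∑ i, (d i : ℝ)) := by
  obtain ⟨K, hK⟩ := exists_forall_lt d
  have h : 1 / (n : ℝ) * ∑ i, (d i : ℝ) =
      ∑ k ∈ Finset.range K, (k : ℝ) * (1 / (n : ℝ) * degreeCount d k) := by
    rw [← sum_mul_degreeCount d hK, Finset.mul_sum]
    exact Finset.sum_congr rfl fun k _ => by ring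
  rw [h]
  refine hasSum_sum_of_ne_finset_zero fun k hk => ?_
  rw [degreeCount_eq_zero hK (by simpa using hk)]
  simp

lemma summable_degreeDist (hμ : Summable fun k : ℕ => (k : ℝ) * (μ k).toReal) {n : ℕ}
    (d : Fin n → ℕ) :
    Summable fun k : ℕ => |(k : ℝ) * (1 / (n : ℝ) * degreeCount d k) - k * (μ k).toReal| :=
  ((hasSum_mul_degreeCount d).summable.sub hμ).abs

lemma ConvergesInDistribution.tendsto_degreeDist
    (hμ : Summable fun k : ℕ => (k : ℝ) * (μ k).toReal) (hd : ConvergesInDistribution d μ) :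
    Tendsto (fun n => degreeDist μ (d n)) atTop (𝓝 0) := by
  refine tendsto_tsum_abs_sub (fun n k => by positivity)
    (fun k => mul_nonneg (Nat.cast_nonneg k) ENNReal.toReal_nonneg)
    (fun n => (hasSum_mul_degreeCount (d n)).summable) hμ (fun k => ?_) ?_
  · refine Tendsto.const_mul _ ?_
    have := hd.tendsto_freq k
    simpa [degreeCount, Finset.sum_boole] using this
  · simp only [fun n => (hasSum_mul_degreeCount (d n)).tsum_eq]
    exact hd.tendsto_mean

lemma degreeCount_copies {n : ℕ} (d : Fin n → ℕ) (q r : ℕ) {k : ℕ} (hk : k ≠ 0) :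
    degreeCount (Sum.elim (fun i : Fin q × Fin n => d i.2) fun _ : Fin r => 0) k =
      q * degreeCount d k := by
  unfold degreeCount
  have : Finset.univ.filter (fun i => Sum.elim (fun i : Fin q × Fin n => d i.2)
      (fun _ : Fin r => 0) i = k) =
      ((Finset.univ : Finset (Fin q)) ×ˢ Finset.univ.filter fun i => d i = k).map
        Function.Embedding.inl := by
    ext i
    rcases i with ⟨i, j⟩ | i <;> simp [hk.symm]
  rw [this, Finset.card_map, Finset.card_product, Finset.card_univ, Fintype.card_fin]

/-- The limit of the scaled hybrid bisection along a large number of vertices is not much smaller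
than its value at any given number of vertices. -/
lemma degreeCut_ge {p : ℝ} (hp : 1 / 2 ≤ p) (hp' : p ≤ 1)
    (hμ : Summable fun k : ℕ => (k : ℝ) * (μ k).toReal) {n N : ℕ} (hn : 0 < n) (hN : 0 < N)
    (d : Fin n → ℕ) (d' : Fin N → ℕ) :
    1 / (n : ℝ) * (degreeCut p d - 50 * (∑ i, (d i : ℝ)) ^ (2 / 3 : ℝ)) -
      3 * degreeDist μ d - 3 * degreeDist μ d' -
        1 / (N : ℝ) * (|degreeCut p d - 50 * (∑ i, (d i : ℝ)) ^ (2 / 3 : ℝ)| +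
          3 * (∑ i, (d i : ℝ)) + 2) ≤
      1 / (N : ℝ) * degreeCut p d' := by
  set q := N / n with hq
  set r := N % n with hr
  have hqr : n * q + r = N := Nat.div_add_mod N n
  have hrn : r < n := Nat.mod_lt _ hn
  have hqr' : (n * q + r : ℝ) = N := by exact_mod_cast hqr
  have hrn' : (r : ℝ) ≤ n := by exact_mod_cast hrn.le
  have hn' : (0 : ℝ) < n := by exact_mod_cast hn
  have hN' : (0 : ℝ) < N := by exact_mod_cast hN
  -- `q` copies of `d` padded with `r` isolated vertices: exactly `N` vertices, with nearly the
  -- degree distribution of `d`.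
  set D := Sum.elim (fun i : Fin q × Fin n => d i.2) (fun _ : Fin r => 0) with hD
  obtain ⟨K₁, hK₁⟩ := exists_forall_lt d'
  obtain ⟨K₂, hK₂⟩ := exists_forall_lt D
  have h1 := (abs_le.1 (abs_degreeCut_sub_le hp hp' (d := d') (d' := D) (K := max K₁ K₂)
    (by simp [← hqr, mul_comm]) (fun i => (hK₁ i).trans_le (le_max_left _ _))
    (fun i => (hK₂ i).trans_le (le_max_right _ _)))).1
  have h2 := degreeCut_copies_isolated_ge hp hp' d q r
  rw [← hD] at h2
  set Y := degreeCut p d - 50 * (∑ i, (d i : ℝ)) ^ (2 / 3 : ℝ) with hY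
  set s := ∑ i, (d i : ℝ) with hs
  have hs0 : 0 ≤ s := Finset.sum_nonneg fun i _ => by positivity
  have hqN : (q : ℝ) ≤ N / n := by
    rw [le_div_iff₀ hn']
    have : (0 : ℝ) ≤ r := by positivity
    linarith
  have hqN' : (N : ℝ) / n ≤ q + 1 := by
    rw [div_le_iff₀ hn']
    linarith
  have h3 : ∑ k ∈ Finset.range (max K₁ K₂), (k : ℝ) * |(degreeCount d' k : ℝ) - degreeCount D k| ≤
      N * degreeDist μ d' + N * degreeDist μ d + s := by
    have hterm : ∀ k ∈ Finset.range (max K₁ K₂),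
        (k : ℝ) * |(degreeCount d' k : ℝ) - degreeCount D k| ≤
          N * |(k : ℝ) * (1 / (N : ℝ) * degreeCount d' k) - k * (μ k).toReal| +
          N * |(k : ℝ) * (1 / (n : ℝ) * degreeCount d k) - k * (μ k).toReal| +
          n * (k * (1 / (n : ℝ) * degreeCount d k)) := by
      intro k _
      rcases Nat.eq_zero_or_pos k with rfl | hk
      · simp
      rw [hD, degreeCount_copies d q r hk.ne']
      push_cast
      set x := (degreeCount d' k : ℝ)
      set y := (degreeCount d k : ℝ)
      have hy0 : 0 ≤ y := Nat.cast_nonneg _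
      have hk0 : (0 : ℝ) < k := by exact_mod_cast hk
      have e1 : (k : ℝ) * |x - q * y| = |k * (x - q * y)| := by
        rw [abs_mul, abs_of_pos hk0]
      -- Both counts are compared with `μ k`. The last term is the rounding error of `N / n` to `q`;
      -- as it is less than one copy of `d`, it adds up to at most `s` over all degrees.
      have e2 : (k : ℝ) * (x - q * y) =
          N * (k * (1 / (N : ℝ) * x) - k * (μ k).toReal) -
          N * (k * (1 / (n : ℝ) * y) - k * (μ k).toReal) + (N / n - q) * (k * y) := by
        field_simp
        ring
      have e3 : |((N : ℝ) / n - q) * (k * y)| ≤ n * (k * (1 / (n : ℝ) * y)) := by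
        rw [abs_mul, abs_of_nonneg (by linarith), abs_of_nonneg (by positivity)]
        calc ((N : ℝ) / n - q) * (k * y) ≤ 1 * (k * y) :=
              mul_le_mul_of_nonneg_right (by linarith) (by positivity)
          _ = _ := by field_simp
      rw [e1, e2]
      refine (abs_add_le _ _).trans (add_le_add ((abs_sub _ _).trans_eq ?_) e3)
      rw [abs_mul, abs_mul, abs_of_pos hN']
    refine (Finset.sum_le_sum hterm).trans ?_
    rw [Finset.sum_add_distrib, Finset.sum_add_distrib, ← Finset.mul_sum, ← Finset.mul_sum,
      ← Finset.mul_sum]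
    refine add_le_add (add_le_add ?_ ?_) ?_
    · exact mul_le_mul_of_nonneg_left ((summable_degreeDist hμ d').sum_le_tsum _
        fun _ _ => abs_nonneg _) hN'.le
    · exact mul_le_mul_of_nonneg_left ((summable_degreeDist hμ d).sum_le_tsum _
        fun _ _ => abs_nonneg _) hN'.le
    · have := (hasSum_mul_degreeCount d).summable.sum_le_tsum (Finset.range (max K₁ K₂))
        fun k _ => by positivity
      rw [(hasSum_mul_degreeCount d).tsum_eq] at this
      calc _ ≤ (n : ℝ) * (1 / (n : ℝ) * s) := mul_le_mul_of_nonneg_left this hn'.le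
        _ = s := by field_simp
  have h4 : (N : ℝ) / n * Y - |Y| ≤ q * Y := by
    have e : |((N : ℝ) / n - q) * Y| ≤ |Y| := by
      rw [abs_mul, abs_of_nonneg (by linarith)]
      exact mul_le_of_le_one_left (abs_nonneg _) (by linarith)
    have := (abs_le.1 e).2
    linarith
  have h5 : (N : ℝ) / n * Y - |Y| - 3 * (N * degreeDist μ d' + N * degreeDist μ d + s) - 2 ≤
      degreeCut p d' := by linarith
  have h6 := mul_le_mul_of_nonneg_left h5 (show 0 ≤ 1 / (N : ℝ) by positivity)
  refine le_trans (le_of_eq ?_) h6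
  field_simp
  ring

/-- The scaled expected hybrid bisection converges. -/
lemma ConvergesInDistribution.exists_tendsto_degreeCut {p : ℝ} (hp : 1 / 2 ≤ p) (hp' : p ≤ 1)
    (hμ : Summable fun k : ℕ => (k : ℝ) * (μ k).toReal) (hd : ConvergesInDistribution d μ) :
    ∃ L, Tendsto (fun n : ℕ => 1 / (n : ℝ) * degreeCut p (d n)) atTop (𝓝 L) := by
  have hw := hd.tendsto_degreeDist hμ
  have hmean := hd.tendsto_mean
  -- The number of half-edges is of order `n`, so its power 2/3 is negligible against `n`.
  have hpow : Tendsto (fun n : ℕ => 1 / (n : ℝ) * (∑ i, (d n i : ℝ)) ^ (2 / 3 : ℝ)) atTop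
      (𝓝 0) := by
    have h1 := hmean.rpow_const (p := (2 / 3 : ℝ)) (Or.inr (by norm_num))
    have h2 : Tendsto (fun n : ℕ => (n : ℝ) ^ (-(1 / 3) : ℝ)) atTop (𝓝 0) :=
      (tendsto_rpow_neg_atTop (by norm_num)).comp tendsto_natCast_atTop_atTop
    have h3 := h2.mul h1
    rw [zero_mul] at h3
    refine h3.congr' ?_
    filter_upwards [eventually_gt_atTop 0] with n hn
    have hn' : (0 : ℝ) < n := by exact_mod_cast hn
    rw [Real.mul_rpow (by positivity) (Finset.sum_nonneg fun i _ => by positivity), ← mul_assoc]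
    congr 1
    have h4 : 1 / (n : ℝ) = (n : ℝ) ^ (-1 : ℝ) := by rw [Real.rpow_neg_one, one_div]
    rw [h4, ← Real.rpow_mul hn'.le, ← Real.rpow_add hn']
    norm_num
  refine exists_tendsto_of_eventually_le
    (e := fun n => 50 * (1 / (n : ℝ) * (∑ i, (d n i : ℝ)) ^ (2 / 3 : ℝ)) +
      3 * degreeDist μ (d n)) ?_ ?_ ?_
  · refine hmean.isBoundedUnder_le.mono_le (Eventually.of_forall fun n => ?_)
    dsimp only
    rw [abs_mul, abs_of_nonneg (by positivity)]
    exact mul_le_mul_of_nonneg_left (abs_degreeCut_le hp hp' (d n)) (by positivity)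
  · simpa using (hpow.const_mul 50).add (hw.const_mul 3)
  · filter_upwards [eventually_gt_atTop 0] with n hn ε hε
    have h1 : Tendsto (fun N : ℕ => 3 * degreeDist μ (d N) + 1 / (N : ℝ) *
        (|degreeCut p (d n) - 50 * (∑ i, (d n i : ℝ)) ^ (2 / 3 : ℝ)| +
          3 * (∑ i, (d n i : ℝ)) + 2)) atTop (𝓝 0) := by
      simpa using (hw.const_mul 3).add (tendsto_one_div_atTop_nhds_zero_nat.mul_const _)
    filter_upwards [(tendsto_order.1 h1).2 ε hε, eventually_gt_atTop 0] with N hN hN0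
    have := degreeCut_ge hp hp' hμ hn hN0 (d n) (d N)
    rw [mul_sub] at this
    linarith

end Limits

/-! ### Exponential moments of functions of a random permutation -/

section Concentration

/-- `exp y ≤ 1 + y + y ^ 2` for `|y| ≤ 1`, and the linear terms cancel. -/
lemma sum_exp_le_of_sum_eq_zero {ι : Type*} [Fintype ι] {y : ι → ℝ} {δ : ℝ} (hδ : δ ≤ 1)
    (hy : ∀ i, |y i| ≤ δ) (hsum : ∑ i, y i = 0) :
    ∑ i, Real.exp (y i) ≤ Fintype.card ι * Real.exp (δ ^ 2) := by
  have h1 : ∀ i, Real.exp (y i) ≤ 1 + δ ^ 2 + y i := by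
    intro i
    have h2 := (abs_le.1 (Real.abs_exp_sub_one_sub_id_le ((hy i).trans hδ))).2
    have h3 : y i ^ 2 ≤ δ ^ 2 := sq_le_sq' (by linarith [(abs_le.1 (hy i)).1]) (abs_le.1 (hy i)).2
    linarith
  calc ∑ i, Real.exp (y i) ≤ ∑ i, (1 + δ ^ 2 + y i) := Finset.sum_le_sum fun i _ => h1 i
    _ = Fintype.card ι * (δ ^ 2 + 1) := by
        rw [Finset.sum_add_distrib, hsum]
        simp
        ring
    _ ≤ _ := mul_le_mul_of_nonneg_left (Real.add_one_le_exp _) (by positivity)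

/-- Functions of permutations that change by at most `c` under composition with a
transposition. -/
def SwapLipschitz {H : Type*} [DecidableEq H] (c : ℝ) (g : Equiv.Perm H → ℝ) : Prop :=
  ∀ a b π, |g (Equiv.swap a b * π) - g π| ≤ c

/-- A transposition acting on the remaining permutation corresponds to a conjugated transposition of
the whole one. Hence fixing the image of 0 leaves a function that is `SwapLipschitz` with the same
constant. -/
lemma decomposeFin_symm_swap_mul {n : ℕ} (i : Fin (n + 1)) (a b : Fin n)
    (π : Equiv.Perm (Fin n)) :
    Equiv.Perm.decomposeFin.symm (i, Equiv.swap a b * π) =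
      Equiv.swap (Equiv.swap 0 i a.succ) (Equiv.swap 0 i b.succ) *
        Equiv.Perm.decomposeFin.symm (i, π) := by
  rw [Equiv.swap_apply_apply]
  ext x
  refine congrArg Fin.val ?_
  refine Fin.cases ?_ (fun x => ?_) x
  · simp only [Equiv.Perm.mul_apply, Equiv.Perm.decomposeFin_symm_apply_zero]
    rw [Equiv.swap_inv, Equiv.swap_apply_right, Equiv.swap_apply_of_ne_of_ne
      (Fin.succ_ne_zero a).symm (Fin.succ_ne_zero b).symm, Equiv.swap_apply_left]
  · simp only [Equiv.Perm.mul_apply, Equiv.Perm.decomposeFin_symm_apply_succ, Equiv.swap_inv,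
      Equiv.swap_apply_self]
    rw [(Fin.succ_injective n).swap_apply]

lemma decomposeFin_symm_eq_swap_mul {n : ℕ} (i : Fin (n + 1)) (π : Equiv.Perm (Fin n)) :
    Equiv.Perm.decomposeFin.symm (i, π) =
      Equiv.swap 0 i * Equiv.Perm.decomposeFin.symm (0, π) := by
  ext x
  refine congrArg Fin.val ?_
  refine Fin.cases ?_ (fun x => ?_) x
  · simp
  · simp

/-- Martingale argument that reveals the image of 0. Changing this image is a left multiplication by
a transposition, so conditional means differ from that for image 0 by at most `c`, and from the
overall mean by at most `2 * c`. Each revealed value contributes one factor `exp ((|t| * (2 * c)) ^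
2)`. -/
lemma sum_exp_perm_fin_le {c t : ℝ} (ht : |t| * (2 * c) ≤ 1) (n : ℕ)
    (g : Equiv.Perm (Fin n) → ℝ) (hg : SwapLipschitz c g) :
    ∑ π, Real.exp (t * (g π - (∑ π, g π) / Fintype.card (Equiv.Perm (Fin n)))) ≤
      Fintype.card (Equiv.Perm (Fin n)) * Real.exp (n * (|t| * (2 * c)) ^ 2) := by
  induction n with
  | zero => simp
  | succ n ih =>
    set C : ℝ := (Fintype.card (Equiv.Perm (Fin n)) : ℝ) with hC
    have hC0 : 0 < C := by rw [hC]; exact_mod_cast Fintype.card_pos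
    have hcard : (Fintype.card (Equiv.Perm (Fin (n + 1))) : ℝ) = (n + 1) * C := by
      rw [Fintype.card_congr Equiv.Perm.decomposeFin, Fintype.card_prod, Fintype.card_fin]
      push_cast; rfl
    let G : Fin (n + 1) → Equiv.Perm (Fin n) → ℝ := fun i π =>
      g (Equiv.Perm.decomposeFin.symm (i, π))
    have hG : ∀ i, SwapLipschitz c (G i) := by
      intro i a b π
      simp only [G]
      rw [decomposeFin_symm_swap_mul]
      exact hg _ _ _
    have hsum : ∀ φ : Equiv.Perm (Fin (n + 1)) → ℝ, ∑ π, φ π =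
        ∑ i, ∑ π, φ (Equiv.Perm.decomposeFin.symm (i, π)) := by
      intro φ
      rw [← Equiv.sum_comp Equiv.Perm.decomposeFin.symm, Fintype.sum_prod_type]
    let m : Fin (n + 1) → ℝ := fun i => (∑ π, G i π) / C
    have hm0 : ∀ i, |m i - m 0| ≤ c := by
      intro i
      simp only [m]
      rw [← sub_div, abs_div, abs_of_pos hC0, div_le_iff₀ hC0, ← Finset.sum_sub_distrib]
      refine (Finset.abs_sum_le_sum_abs _ _).trans ?_
      calc ∑ π, |G i π - G 0 π| ≤ ∑ _π : Equiv.Perm (Fin n), c := by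
            refine Finset.sum_le_sum fun π _ => ?_
            simp only [G]
            rw [decomposeFin_symm_eq_swap_mul i]
            exact hg _ _ _
        _ = c * C := by simp [hC, Finset.card_univ, mul_comm]
    have hmm : ∀ i j, |m i - m j| ≤ 2 * c := by
      intro i j
      have h1 := abs_le.1 (hm0 i)
      have h2 := abs_le.1 (hm0 j)
      rw [abs_le]
      constructor <;> linarith
    set M : ℝ := (∑ π, g π) / Fintype.card (Equiv.Perm (Fin (n + 1))) with hM
    have hn0 : (0 : ℝ) < n + 1 := by positivity
    have hMm : (n + 1) * M = ∑ i, m i := by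
      rw [hM, hcard, hsum, ← Finset.sum_div]
      field_simp
      rfl
    have hmM : ∀ i, |m i - M| ≤ 2 * c := by
      intro i
      have h1 : (n + 1) * (m i - M) = ∑ j, (m i - m j) := by
        rw [mul_sub, hMm, Finset.sum_sub_distrib]
        simp
      have h2 : (n + 1) * |m i - M| ≤ (n + 1) * (2 * c) := by
        rw [← abs_of_pos hn0, ← abs_mul, abs_of_pos hn0, h1]
        refine (Finset.abs_sum_le_sum_abs _ _).trans
          ((Finset.sum_le_sum fun j _ => hmm i j).trans_eq ?_)
        simp
      exact le_of_mul_le_mul_left h2 hn0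
    have hy : ∑ i, Real.exp (t * (m i - M)) ≤
        Fintype.card (Fin (n + 1)) * Real.exp ((|t| * (2 * c)) ^ 2) := by
      refine sum_exp_le_of_sum_eq_zero ht (fun i => ?_) ?_
      · rw [abs_mul]
        exact mul_le_mul_of_nonneg_left (hmM i) (abs_nonneg _)
      · rw [← Finset.mul_sum, Finset.sum_sub_distrib, ← hMm]
        simp
    rw [hsum, hcard]
    -- The deviation splits into that of the conditional mean `m i` and that around `m i`; the
    -- induction hypothesis bounds the latter uniformly in `i`.
    calc ∑ i, ∑ π, Real.exp (t * (g (Equiv.Perm.decomposeFin.symm (i, π)) - M))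
        = ∑ i, Real.exp (t * (m i - M)) * ∑ π, Real.exp (t * (G i π - m i)) := by
          refine Finset.sum_congr rfl fun i _ => ?_
          rw [Finset.mul_sum]
          refine Finset.sum_congr rfl fun π _ => ?_
          rw [← Real.exp_add]
          congr 1
          simp only [G]
          ring
      _ ≤ ∑ i, Real.exp (t * (m i - M)) * (C * Real.exp (n * (|t| * (2 * c)) ^ 2)) :=
          Finset.sum_le_sum fun i _ =>
            mul_le_mul_of_nonneg_left (ih (G i) (hG i)) (Real.exp_pos _).le
      _ ≤ (Fintype.card (Fin (n + 1)) * Real.exp ((|t| * (2 * c)) ^ 2)) *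
          (C * Real.exp (n * (|t| * (2 * c)) ^ 2)) := by
          rw [← Finset.sum_mul]
          exact mul_le_mul_of_nonneg_right hy (by positivity)
      _ = _ := by
          rw [Fintype.card_fin]
          push_cast
          rw [add_mul (n : ℝ) 1 ((|t| * (2 * c)) ^ 2), Real.exp_add, one_mul]
          ring

lemma sum_exp_perm_le {H : Type*} [Fintype H] {c t : ℝ} (ht : |t| * (2 * c) ≤ 1)
    (g : Equiv.Perm H → ℝ) (hg : SwapLipschitz c g) :
    ∑ π, Real.exp (t * (g π - (∑ π, g π) / Fintype.card (Equiv.Perm H))) ≤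
      Fintype.card (Equiv.Perm H) * Real.exp (Fintype.card H * (|t| * (2 * c)) ^ 2) := by
  let e := (Fintype.equivFin H).symm
  have h := sum_exp_perm_fin_le ht (Fintype.card H) (fun π => g (e.permCongr π)) (by
    intro a b π
    have : e.permCongr (Equiv.swap a b * π) = Equiv.swap (e a) (e b) * e.permCongr π := by
      ext x
      simp only [Equiv.permCongr_apply, Equiv.Perm.mul_apply]
      rw [← e.injective.swap_apply]
    dsimp only
    rw [this]
    exact hg _ _ _)
  rw [Equiv.sum_comp e.permCongr g, Equiv.sum_comp e.permCongr fun π =>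
    Real.exp (t * (g π - (∑ π, g π) / Fintype.card (Equiv.Perm (Fin (Fintype.card H))))),
    Fintype.card_congr e.permCongr] at h
  exact h

/-- A transposition disturbs only the at most two pairs containing `a` or `b`. Removing them and
inserting their images costs at most 2 each way. -/
lemma EdgeConcave.swapLipschitz {H : Type*} [Fintype H] {f : Finset (Sym2 H) → ℝ}
    (hf : EdgeConcave f) {M : Finset (Sym2 H)} (hM : IsMatching M) :
    SwapLipschitz 4 fun π => f (M.map (Equiv.toEmbedding π).sym2Map) := by
  intro a b π
  dsimp only
  have hmul : M.map (Equiv.swap a b * π).toEmbedding.sym2Map =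
      (M.map (Equiv.toEmbedding π).sym2Map).map (Equiv.swap a b).toEmbedding.sym2Map := by
    rw [map_sym2Map_trans]
    rfl
  rw [hmul]
  have hM' := hM.map (Equiv.toEmbedding π)
  generalize M.map (Equiv.toEmbedding π).sym2Map = N at *
  set R := N.filter fun e => a ∉ e ∧ b ∉ e with hR
  have h1 : R ⊆ N := Finset.filter_subset _ _
  have h2 : R ⊆ N.map (Equiv.swap a b).toEmbedding.sym2Map := by
    have : R.map (Equiv.swap a b).toEmbedding.sym2Map = R := by
      refine map_eq_self_of_fixed fun e he x hx => ?_
      obtain ⟨-, h3, h4⟩ := Finset.mem_filter.1 he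
      exact Equiv.swap_apply_of_ne_of_ne (fun h => h3 (h ▸ hx)) fun h => h4 (h ▸ hx)
    rw [← this]
    exact Finset.map_subset_map.2 h1
  have hone : ∀ x, (N.filter fun e => x ∈ e).card ≤ 1 := by
    intro x
    refine Finset.card_le_one.2 fun e he e' he' => ?_
    rw [Finset.mem_filter] at he he'
    exact hM'.2 e he.1 e' he'.1 x he.2 he'.2
  have hcard : N.card ≤ R.card + 2 := by
    have h3 : N ⊆ R ∪ (N.filter (fun e => a ∈ e) ∪ N.filter fun e => b ∈ e) := by
      intro e he
      simp only [hR, Finset.mem_union, Finset.mem_filter]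
      tauto
    have h4 := (Finset.card_le_card h3).trans (Finset.card_union_le _ _)
    have h5 := Finset.card_union_le (N.filter fun e => a ∈ e) (N.filter fun e => b ∈ e)
    have h6 := hone a
    have h7 := hone b
    omega
  have hcard' : (N.card : ℝ) ≤ R.card + 2 := by exact_mod_cast hcard
  have h8 := abs_le.1 (hf.abs_sub_le h1 hM'.1)
  have h9 := abs_le.1 (hf.abs_sub_le h2 (hM'.map _).1)
  rw [Finset.card_map] at h9
  rw [abs_le]
  constructor <;> linarith

lemma permAverage_exp_le {H : Type*} [Fintype H] {f : Finset (Sym2 H) → ℝ}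
    (hf : EdgeConcave f) {M : Finset (Sym2 H)} (hM : IsMatching M) {t : ℝ} (ht : |t| * 8 ≤ 1) :
    permAverage (fun N => Real.exp (t * (f N - permAverage f M))) M ≤
      Real.exp (Fintype.card H * (|t| * 8) ^ 2) := by
  have hpos : (0 : ℝ) < Fintype.card (Equiv.Perm H) := by exact_mod_cast Fintype.card_pos
  have h := sum_exp_perm_le (c := 4) (t := t) (by linarith) _ (hf.swapLipschitz hM)
  have h8 : |t| * (2 * 4) = |t| * 8 := by ring
  rw [h8] at h
  rw [permAverage, div_le_iff₀ hpos, mul_comm (Real.exp _)]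
  exact h

end Concentration

/-! ### The configuration model as a random permutation of a fixed matching -/

section UniformMatching

/-- Double counting over permutations and complete matchings: each permutation permutes the complete
matchings, and the average over permutations does not depend on the matching. -/
lemma sum_isCompleteMatching {H : Type*} [Fintype H]
    [Fintype {m : Finset (Sym2 H) // IsCompleteMatching m}] (φ : Finset (Sym2 H) → ℝ)
    {M : Finset (Sym2 H)} (hM : IsCompleteMatching M) :
    (∑ m : {m : Finset (Sym2 H) // IsCompleteMatching m}, φ m.1) /
      Fintype.card {m : Finset (Sym2 H) // IsCompleteMatching m} = permAverage φ M := by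
  have hpos : (0 : ℝ) < Fintype.card (Equiv.Perm H) := by
    exact_mod_cast Fintype.card_pos
  have : Nonempty {m : Finset (Sym2 H) // IsCompleteMatching m} := ⟨⟨M, hM⟩⟩
  have hpos' : (0 : ℝ) < Fintype.card {m : Finset (Sym2 H) // IsCompleteMatching m} := by
    exact_mod_cast Fintype.card_pos
  have h1 : ∀ g : Equiv.Perm H, ∑ m : {m : Finset (Sym2 H) // IsCompleteMatching m}, φ m.1 =
      ∑ m : {m : Finset (Sym2 H) // IsCompleteMatching m}, φ (m.1.map g.toEmbedding.sym2Map) := by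
    intro g
    let F : {m : Finset (Sym2 H) // IsCompleteMatching m} →
        {m : Finset (Sym2 H) // IsCompleteMatching m} := fun m =>
      ⟨m.1.map g.toEmbedding.sym2Map, IsCompleteMatching.map m.2 g⟩
    have hF : Function.Injective F := fun m m' h =>
      Subtype.ext (Finset.map_injective _ (congrArg Subtype.val h))
    exact (Fintype.sum_bijective F (Finite.injective_iff_bijective.1 hF) _ _ fun _ => rfl).symm
  have h2 : Fintype.card (Equiv.Perm H) * ∑ m : {m : Finset (Sym2 H) // IsCompleteMatching m}, φ m.1 =
      ∑ m : {m : Finset (Sym2 H) // IsCompleteMatching m},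
        ∑ g : Equiv.Perm H, φ (m.1.map g.toEmbedding.sym2Map) := by
    rw [Finset.sum_comm, ← Finset.sum_congr rfl fun g _ => h1 g]
    simp [Finset.card_univ]
  have h3 : ∀ m : {m : Finset (Sym2 H) // IsCompleteMatching m}, ∑ g : Equiv.Perm H,
      φ (m.1.map g.toEmbedding.sym2Map) =
        Fintype.card (Equiv.Perm H) * permAverage φ M := by
    intro m
    rw [permAverage_eq_of_isCompleteMatching φ hM (M' := m.1) m.2, permAverage, mul_comm]
    exact (div_mul_cancel₀ _ hpos.ne').symm
  rw [Finset.sum_congr rfl fun m _ => h3 m, Finset.sum_const, Finset.card_univ,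
    nsmul_eq_mul] at h2
  rw [div_eq_iff hpos'.ne']
  refine mul_left_cancel₀ hpos.ne' ?_
  rw [h2]
  ring

variable {V : Type*} [Fintype V] (d : V → ℕ)

lemma sum_completeMatching (φ : Finset (Sym2 (HalfEdge d)) → ℝ)
    {M : Finset (Sym2 (HalfEdge d))} (hM : IsCompleteMatching M) :
    (∑ m : CompleteMatching d, φ m.1) / Fintype.card (CompleteMatching d) = permAverage φ M := by
  let _ : Fintype {m : Finset (Sym2 (HalfEdge d)) // IsCompleteMatching m} :=
    instFintypeCompleteMatching d
  exact sum_isCompleteMatching φ hM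

lemma integral_configurationModel (φ : Graph V (Sym2 (HalfEdge d)) → ℝ)
    {M : Finset (Sym2 (HalfEdge d))} (hM : IsCompleteMatching M) :
    Integrable φ (configurationModel d).toMeasure ∧
    ∫ G, φ G ∂(configurationModel d).toMeasure =
      permAverage (fun N => φ (graphOfMatching N)) M := by
  let _ : MeasurableSpace (CompleteMatching d) := ⊤
  have : DiscreteMeasurableSpace (CompleteMatching d) := ⟨fun _ => trivial⟩
  have hmeas : Measurable fun m : CompleteMatching d => graphOfMatching m.1 :=
    Measurable.of_discrete
  have hφ : Measurable φ := fun _ _ => trivial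
  rw [configurationModel, ← PMF.toMeasure_map _ _ hmeas]
  constructor
  · rw [integrable_map_measure hφ.aestronglyMeasurable hmeas.aemeasurable]
    exact Integrable.of_finite
  · rw [integral_map hmeas.aemeasurable hφ.aestronglyMeasurable, PMF.integral_eq_sum,
      ← sum_completeMatching d _ hM, Finset.sum_div]
    refine Finset.sum_congr rfl fun m _ => ?_
    rw [PMF.uniformOfFintype_apply, ENNReal.toReal_inv, ENNReal.toReal_natCast, smul_eq_mul]
    ring

lemma integral_hybridBisection (p : ℝ) :
    ∫ G, hybridBisection p G ∂(configurationModel d).toMeasure = degreeCut p d := by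
  obtain ⟨M, hM⟩ := exists_isCompleteMatching (HalfEdge d)
  rw [(integral_configurationModel d (fun G => hybridBisection p G) hM).2, degreeCut,
    expectedCut_eq p _ hM]
  simp only [hybridBisection_graphOfMatching]

lemma mgf_hybridBisection_le {p : ℝ} (hp : 1 / 2 ≤ p) (hp' : p ≤ 1) {t : ℝ}
    (ht : |t| * 8 ≤ 1) :
    mgf (fun G => hybridBisection p G - degreeCut p d) (configurationModel d).toMeasure t ≤
      Real.exp ((∑ i, (d i : ℝ)) * (|t| * 8) ^ 2) := by
  obtain ⟨M, hM⟩ := exists_isCompleteMatching (HalfEdge d)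
  have h := permAverage_exp_le (edgeConcave_hybridCut hp hp' (Sigma.fst : HalfEdge d → V)) hM.1 ht
  rw [card_halfEdge] at h
  rw [mgf, (integral_configurationModel d
    (fun G => Real.exp (t * (hybridBisection p G - degreeCut p d))) hM).2, degreeCut,
    expectedCut_eq p _ hM]
  simp only [hybridBisection_graphOfMatching]
  push_cast at h
  exact h

/-- Chernoff's bound at `t` and at `-t`, one for each tail. -/
lemma measure_le_abs_hybridBisection_sub {p : ℝ} (hp : 1 / 2 ≤ p) (hp' : p ≤ 1) {t : ℝ}
    (ht0 : 0 ≤ t) (ht : t * 8 ≤ 1) (ε : ℝ) :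
    (configurationModel d).toMeasure.real {G | ε ≤ |hybridBisection p G - degreeCut p d|} ≤
      2 * Real.exp ((∑ i, (d i : ℝ)) * (t * 8) ^ 2 - t * ε) := by
  obtain ⟨M, hM⟩ := exists_isCompleteMatching (HalfEdge d)
  set ν := (configurationModel d).toMeasure
  have hint : ∀ s : ℝ, Integrable
      (fun G => Real.exp (s * (hybridBisection p G - degreeCut p d))) ν := fun s =>
    (integral_configurationModel d _ hM).1
  have h1 := measure_ge_le_exp_mul_mgf (μ := ν)
    (X := fun G => hybridBisection p G - degreeCut p d) ε ht0 (hint t)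
  have h2 := measure_le_le_exp_mul_mgf (μ := ν)
    (X := fun G => hybridBisection p G - degreeCut p d) (-ε) (neg_nonpos.2 ht0) (hint (-t))
  have h3 := mgf_hybridBisection_le d hp hp' (t := t) (by rwa [abs_of_nonneg ht0])
  have h4 := mgf_hybridBisection_le d hp hp' (t := -t) (by rwa [abs_neg, abs_of_nonneg ht0])
  rw [abs_neg] at h4
  rw [abs_of_nonneg ht0] at h3 h4
  have h5 : {G : Graph V (Sym2 (HalfEdge d)) | ε ≤ |hybridBisection p G - degreeCut p d|} ⊆
      {G | ε ≤ hybridBisection p G - degreeCut p d} ∪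
        {G | hybridBisection p G - degreeCut p d ≤ -ε} := by
    intro G hG
    rcases le_abs'.1 (show ε ≤ |hybridBisection p G - degreeCut p d| from hG) with h | h
    · exact Or.inr h
    · exact Or.inl h
  have h6 := (measureReal_mono (μ := ν) h5).trans (measureReal_union_le _ _)
  have h7 : Real.exp (-t * ε) * Real.exp ((∑ i, (d i : ℝ)) * (t * 8) ^ 2) =
      Real.exp ((∑ i, (d i : ℝ)) * (t * 8) ^ 2 - t * ε) := by
    rw [← Real.exp_add]; congr 1; ring
  have h8 := mul_le_mul_of_nonneg_left h3 (Real.exp_pos (-t * ε)).le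
  have h9 := mul_le_mul_of_nonneg_left h4 (Real.exp_pos (-t * ε)).le
  have h10 : -(-t) * -ε = -t * ε := by ring
  rw [h10] at h2
  rw [h7] at h8 h9
  linarith

end UniformMatching

/-! ### Almost sure convergence by Borel–Cantelli -/

section AlmostSure

lemma ae_eventually_abs_hybridBisection_sub_lt {p : ℝ} (hp : 1 / 2 ≤ p) (hp' : p ≤ 1)
    {μ : PMF ℕ} {d : (n : ℕ) → Fin n → ℕ} (hd : ConvergesInDistribution d μ) {Ω : Type*}
    [MeasurableSpace Ω] (P : Measure Ω) [IsProbabilityMeasure P]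
    (G : (n : ℕ) → Ω → Graph (Fin n) (Sym2 (HalfEdge (d n))))
    (hG : ∀ n, HasLaw (G n) (configurationModel (d n)).toMeasure P) {ε : ℝ} (hε : 0 < ε) :
    ∀ᵐ ω ∂P, ∀ᶠ n : ℕ in atTop,
      |hybridBisection p (G n ω) - degreeCut p (d n)| < ε * n := by
  obtain ⟨C, hC0, hC⟩ : ∃ C : ℝ, 0 < C ∧ ∀ᶠ n : ℕ in atTop, ∑ i, (d n i : ℝ) ≤ C * n := by
    set m := ∑' k : ℕ, (k : ℝ) * (μ k).toReal
    have hm : 0 ≤ m := tsum_nonneg fun k => by positivity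
    refine ⟨m + 1, by linarith, ?_⟩
    filter_upwards [hd.tendsto_mean.eventually_lt_const (lt_add_one m), eventually_gt_atTop 0]
      with n hn hn0
    have hn1 : (0 : ℝ) < n := by exact_mod_cast hn0
    rw [one_div, ← div_eq_inv_mul, div_lt_iff₀ hn1] at hn
    exact hn.le
  -- With at most `C * n` half-edges the exponent is at most `n * (64 * C * t ^ 2 - t * ε)`; the
  -- condition `128 * C * t ≤ ε` makes this at most `-n * t * ε / 2`, so the tails are dominated by
  -- a geometric series.
  obtain ⟨t, ht0, ht8, htC⟩ : ∃ t : ℝ, 0 < t ∧ t * 8 ≤ 1 ∧ 128 * C * t ≤ ε := by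
    refine ⟨min (1 / 8) (ε / (128 * C)), by positivity, ?_, ?_⟩
    · linarith [min_le_left (1 / 8) (ε / (128 * C))]
    · rw [mul_comm, ← le_div_iff₀ (by positivity)]
      exact min_le_right _ _
  set s : ℕ → Set Ω := fun n =>
    {ω | ε * n ≤ |hybridBisection p (G n ω) - degreeCut p (d n)|} with hs
  have hreal : ∀ᶠ n : ℕ in atTop, ‖P.real (s n)‖ ≤ 2 * Real.exp (-(t * ε / 2)) ^ n := by
    filter_upwards [hC] with n hn
    have h1 : P (s n) = (configurationModel (d n)).toMeasure
        {H | ε * n ≤ |hybridBisection p H - degreeCut p (d n)|} :=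
      (hG n).measure_eq (p := fun H => ε * n ≤ |hybridBisection p H - degreeCut p (d n)|) trivial
    rw [Real.norm_of_nonneg measureReal_nonneg, measureReal_def, h1, ← measureReal_def]
    refine (measure_le_abs_hybridBisection_sub (d n) hp hp' ht0.le ht8 (ε * n)).trans ?_
    rw [← Real.exp_nat_mul]
    refine mul_le_mul_of_nonneg_left (Real.exp_le_exp.2 ?_) zero_le_two
    have h2 : (∑ i, (d n i : ℝ)) * (t * 8) ^ 2 ≤ C * n * (t * 8) ^ 2 :=
      mul_le_mul_of_nonneg_right hn (by positivity)
    have h3 : 128 * C * t * (t * n / 2) ≤ ε * (t * n / 2) :=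
      mul_le_mul_of_nonneg_right htC (by positivity)
    linarith
  have hsummable : Summable fun n => P.real (s n) := by
    refine Summable.of_norm_bounded_eventually_nat (Summable.mul_left 2
      (summable_geometric_of_lt_one (Real.exp_pos _).le ?_)) hreal
    rw [Real.exp_lt_one_iff, neg_lt_zero]
    positivity
  have htsum : ∑' n, P (s n) ≠ ⊤ := by
    rw [← tsum_congr fun n => ofReal_measureReal (measure_ne_top P (s n))]
    exact hsummable.tsum_ofReal_ne_top
  filter_upwards [ae_eventually_notMem htsum] with ω hω
  filter_upwards [hω] with n hn
  exact not_le.1 hn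

lemma ae_tendsto_hybridBisection {p : ℝ} (hp : 1 / 2 ≤ p) (hp' : p ≤ 1)
    {μ : PMF ℕ} {d : (n : ℕ) → Fin n → ℕ} (hd : ConvergesInDistribution d μ) {L : ℝ}
    (hL : Tendsto (fun n : ℕ => (1 / (n : ℝ)) * degreeCut p (d n)) atTop (𝓝 L)) {Ω : Type*}
    [MeasurableSpace Ω] (P : Measure Ω) [IsProbabilityMeasure P]
    (G : (n : ℕ) → Ω → Graph (Fin n) (Sym2 (HalfEdge (d n))))
    (hG : ∀ n, HasLaw (G n) (configurationModel (d n)).toMeasure P) :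
    ∀ᵐ ω ∂P, Tendsto (fun n : ℕ => (1 / (n : ℝ)) * hybridBisection p (G n ω)) atTop (𝓝 L) := by
  -- Countably many tolerances keep the exceptional set null.
  have hdev : ∀ᵐ ω ∂P, ∀ j : ℕ, ∀ᶠ n : ℕ in atTop,
      |hybridBisection p (G n ω) - degreeCut p (d n)| < 1 / ((j : ℝ) + 1) * n :=
    ae_all_iff.2 fun j => ae_eventually_abs_hybridBisection_sub_lt hp hp' hd P G hG
      Nat.one_div_pos_of_nat
  filter_upwards [hdev] with ω hω
  have h0 : Tendsto (fun n : ℕ =>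
      (1 / (n : ℝ)) * (hybridBisection p (G n ω) - degreeCut p (d n))) atTop (𝓝 0) := by
    rw [Metric.tendsto_nhds]
    intro ε hε
    obtain ⟨j, hj⟩ := exists_nat_one_div_lt hε
    filter_upwards [hω j, eventually_gt_atTop 0] with n hn hn0
    have hn1 : (0 : ℝ) < n := by exact_mod_cast hn0
    rw [Real.dist_eq, sub_zero, abs_mul, abs_of_pos (one_div_pos.2 hn1), one_div,
      ← div_eq_inv_mul, div_lt_iff₀ hn1]
    exact hn.trans (mul_lt_mul_of_pos_right hj hn1)
  simpa [← mul_add] using hL.add h0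

end AlmostSure

end HybridBisection

open HybridBisection in
theorem theorem3p2 (p : ℝ) (hp : 1 / 2 ≤ p) (hp_le : p ≤ 1)
    (μ : PMF ℕ) (hμ : Summable fun k : ℕ => (k : ℝ) * (μ k).toReal)
    (d : (n : ℕ) → Fin n → ℕ) (hd : ConvergesInDistribution d μ) :
    ∃ L : ℝ,
      (∀ (Ω : Type*) [MeasurableSpace Ω] (P : Measure Ω) [IsProbabilityMeasure P]
        (G : (n : ℕ) → Ω → Graph (Fin n) (Sym2 (HalfEdge (d n)))),
        (∀ n, HasLaw (G n) (configurationModel (d n)).toMeasure P) →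
        iIndepFun G P →
        ∀ᵐ ω ∂P, Tendsto (fun n : ℕ => (1 / (n : ℝ)) * hybridBisection p (G n ω)) atTop (𝓝 L)) ∧
      Tendsto (fun n : ℕ => (1 / (n : ℝ)) *
        ∫ H, hybridBisection p H ∂(configurationModel (d n)).toMeasure) atTop (𝓝 L) := by
  obtain ⟨L, hL⟩ := hd.exists_tendsto_degreeCut hp hp_le hμ
  refine ⟨L, fun Ω _ P _ G hG _ => ae_tendsto_hybridBisection hp hp_le hd hL P G hG, ?_⟩
  simpa only [integral_hybridBisection] using hL
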